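/- Let $n\ge 3$ and let $S(x,y)=\sum_{k=0}^{n}a_kx^{n-k}y^k$ be a homogeneous polynomial with real coefficients whose mixed second derivative factors as $$S''_{xy}(x,y)=c\,x^{\gamma}y^{\beta}\prod_{j=1}^{m}(y-\alpha_jx)^{m_j}\prod_{j=1}^{s}Q_j(x,y),$$ where $c\neq 0$ is real, $\gamma,\beta,m,s\ge 0$ and $m_j\ge 1$ are integers, the $\alpha_j$ are distinct nonzero real numbers, and the $Q_j$ are positive definite real quadratic forms (so that $\beta\le n-2$). Put $$D(x,y)=x^{\gamma}\prod_{j=1}^{m}(y-\alpha_jx)^{m_j}\prod_{j=1}^{s}Q_j(x,y)$$ and, if $\beta<n-2$, $$a_\beta=\frac{1}{2(\beta+1)}\,\frac{n-2(\beta+1)}{n-\beta-2}.$$ (i) If $\beta<n-2$, there is a constant $C$, depending only on $S$, such that for every $z\in\mathbb C$ with $\Re z=a_\beta$ the operator $$Wf(x)=\int_{-\infty}^{\infty}e^{iS(x,y)}|D(x,y)|^{z}f(y)\,dy,$$ defined for $f\in C_0^\infty(\mathbb R)$ and almost every $x$ by an absolutely convergent integral, extends to a bounded operator on $L^2(\mathbb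 R)$ with $\|W\|_{L^2\to L^2}\le C(1+|\Im z|)^2$. (ii) For every $\varphi\in C_0^\infty(\mathbb R\times\mathbb R)$ there is a constant $C$, depending only on $S$ and $\varphi$, such that for every real $\lambda\ne0$ and every $z\in\mathbb C$ with $\Re z=a_\beta$, the operator $$W_\lambda f(x)=\int_{-\infty}^{\infty}e^{i\lambda S(x,y)}|D(x,y)|^{z}\varphi(x,y)f(y)\,dy$$ (defined likewise for $f\in C_0^\infty(\mathbb R)$) extends to a bounded operator on $L^2(\mathbb R)$ with $$\|W_\lambda\|_{L^2\to L^2}\le C(1+|\Im z|)^2|\lambda|^{-\frac{1}{2(\beta+1)}}.$$ When $\beta=n-2$, so that $D\equiv1$ and $|D|^z\equiv 1$, this estimate holds without any condition on $z$. -/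

import Mathlib

open MeasureTheory
open scoped ContDiff

noncomputable section

namespace DampedOIO

/-- The homogeneous polynomial `∑_{k=0}^n a_k x^{n-k} y^k`. -/
def phase (n : ℕ) (a : ℕ → ℝ) (x y : ℝ) : ℝ :=
  ∑ k ∈ Finset.range (n + 1), a k * x ^ (n - k) * y ^ k

/-- The mixed second derivative `∂_x ∂_y S` at `(x, y)`. -/
def mixedDeriv (S : ℝ → ℝ → ℝ) (x y : ℝ) : ℝ :=
  deriv (fun u => deriv (fun v => S u v) y) x

/-- The damping factor
`D(x,y) = x^γ ∏_{j=1}^m (y - α_j x)^{m_j} ∏_{j=1}^s Q_j(x,y)`. -/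
def damping (γ : ℕ) {m s : ℕ} (α : Fin m → ℝ) (μ : Fin m → ℕ)
    (Q : Fin s → QuadraticForm ℝ (ℝ × ℝ)) (x y : ℝ) : ℝ :=
  x ^ γ * (∏ j, (y - α j * x) ^ μ j) * ∏ j, Q j (x, y)

/-- The critical damping exponent `a_β`, meaningful for `β + 2 < n`. -/
def criticalExponent (n β : ℕ) : ℝ :=
  1 / (2 * ((β : ℝ) + 1)) * (((n : ℝ) - 2 * ((β : ℝ) + 1)) / ((n : ℝ) - (β : ℝ) - 2))

/-- The kernel `e^{i S(x,y)} |D(x,y)|^z`. -/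
def kernel (S D : ℝ → ℝ → ℝ) (z : ℂ) (x y : ℝ) : ℂ :=
  Complex.exp (Complex.I * (S x y : ℂ)) * ((|D x y| : ℝ) : ℂ) ^ z

/-- The kernel `e^{i λ S(x,y)} |D(x,y)|^z φ(x,y)`. -/
def cutoffKernel (S D : ℝ → ℝ → ℝ) (z : ℂ) (lam : ℝ) (φ : ℝ × ℝ → ℂ) (x y : ℝ) : ℂ :=
  kernel (fun u v => lam * S u v) D z x y * φ (x, y)

/-- The operator `f ↦ ∫ K(·, y) f(y) dy`, given on smooth compactly supported `f` by an
absolutely convergent integral for almost every `x`, extends to a bounded operator on `L²(ℝ)`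
with operator norm at most `B`. -/
def ExtendsToL2WithNormLE (K : ℝ → ℝ → ℂ) (B : ℝ) : Prop :=
  ∃ T : Lp ℂ 2 (volume : Measure ℝ) →L[ℂ] Lp ℂ 2 (volume : Measure ℝ),
    ‖T‖ ≤ B ∧
    ∀ (f : ℝ → ℂ) (_ : ContDiff ℝ ∞ f) (_ : HasCompactSupport f)
      (hf : MemLp f 2 (volume : Measure ℝ)),
      (∀ᵐ x : ℝ, Integrable (fun y : ℝ => K x y * f y)) ∧
      (T (hf.toLp f) : ℝ → ℂ) =ᵐ[volume] fun x : ℝ => ∫ y : ℝ, K x y * f y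

end DampedOIO

end

/-!
The kernel `e^{iS} |D|^z` is cut into pieces along the zeros of the mixed derivative
`P = ∂ₓ∂_y S`, each piece is estimated both by its size and by its oscillation, and the pieces are
put together by almost orthogonality. No structure is used beyond the factorization of `P` into
linear and definite quadratic forms.

The real lines on which `P` vanishes, together with the two axes, cut the plane into sectors
`L₁ > 0`, `L₂ > 0` with no further line inside. In the half `L₁ ≲ L₂` of such a sector every
factor of `P` other than `L₁` is comparable to a power of `L₂`, so that `|P| ∼ L₁ ^ m L₂ ^ e` and
`|D| ∼ L₁ ^ m' L₂ ^ e'`, with matching bounds for derivatives (`Tame`, `HalfSector`). A dyadic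
piece `T` lives where `L₁ ∼ δ`, `L₂ ∼ R`. The phase of the kernel of `T T*` is
`S(x, ·) - S(x', ·)`, whose derivative is the integral of `P` over a segment in the sector, hence of
size at least `|x - x'| δ ^ m R ^ e` (`OneSided.phase_difference`). Two integrations by parts give the
oscillatory bound `oscSize` for `‖T‖`, while Schur's test gives the trivial bound `trivSize`. For
two pieces at different scales the supports are separated in `x` by the larger scale, and the same
integration by parts shows that `‖T T'*‖` gains the square root of the ratio of the scales
(`HalfSector.exists_norm_mul_star_le`); exchanging `x` and `y` gives the same for `T* T'`.

The exponent is critical in that the geometric mean `oscSize ^ θ * trivSize ^ (1 - θ)` with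
`θ = 1 / (β + 1)` is bounded over all scales (`CriticalModel.mean_le_one`). Interpolating the two
bounds for the products therefore leaves a positive power of the ratio of the scales, which sums by
the Cotlar–Stein lemma (`norm_sum_le_of_almostOrthogonal`). The constants are linear in `1 + ‖z‖`.
Dominated convergence and Fatou's lemma remove the truncation to finitely many pieces
(`L2Bounded.of_tendsto`).

A smooth cutoff `φ(x, y)` is the integral over `v` of `∂_y φ(x, v) 1_{v ≤ y}`, a superposition of
products of functions of one variable, so it preserves `L²` bounds up to a constant
(`exists_l2Bounded_mul_smooth`). Since `S` and `D` are homogeneous, the power of `|λ|` comes from a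
dilation (`CriticalModel.exists_l2Bounded_smul`). If `β = n - 2`, then `D = 1` and up to functions of
one variable `S` is a multiple of `x y ^ (β + 1)`. After localization in `x` by a function `W`, the
kernel of `T* T` is the Fourier transform of `W ^ 2` at `b (t ^ (β + 1) - y ^ (β + 1))`, and
`|t ^ k - y ^ k| ≥ |t - y| ^ k` for `t`, `y` of the same sign (`exists_l2Bounded_monomial`).
-/

namespace DampedOIO

set_option linter.unusedSectionVars false

/-! ### The Cotlar–Stein lemma -/

section CotlarStein

variable {ι A : Type*} [Fintype ι] [NormedRing A] [StarRing A] [CStarRing A]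

/-- Iterated sum of `f` over all words of length `n` in the alphabet `ι`. -/
def wordSum {M : Type*} [AddCommMonoid M] : ℕ → (List ι → M) → M
  | 0, f => f []
  | n + 1, f => ∑ j, wordSum n (fun l => f (j :: l))

theorem norm_wordSum_le (n : ℕ) (f : List ι → A) (g : List ι → ℝ) (h : ∀ l, ‖f l‖ ≤ g l) :
    ‖wordSum n f‖ ≤ wordSum n g := by
  induction n generalizing f g with
  | zero => exact h []
  | succ n ih =>
    exact norm_sum_le_of_le _ fun j _ => ih _ _ fun l => h (j :: l)

theorem wordSum_mul_left {M : Type*} [NonUnitalNonAssocSemiring M] (n : ℕ) (a : M)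
    (f : List ι → M) : wordSum n (fun l => a * f l) = a * wordSum n f := by
  induction n generalizing f with
  | zero => rfl
  | succ n ih => simp only [wordSum, ih, Finset.mul_sum]

/-- The alternating product `T i₀ * star (T i₁) * T i₂ * ⋯` along the word `i₀ :: l`; it starts
with a starred factor when the flag is `true`. -/
def altProd (T : ι → A) : Bool → ι → List ι → A
  | s, i, [] => if s then star (T i) else T i
  | s, i, j :: l => (if s then star (T i) else T i) * altProd T (!s) j l

/-- The alternating power `S * star S * S * ⋯` with `n + 1` factors. -/
def altPow (S : A) : Bool → ℕ → A
  | s, 0 => if s then star S else S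
  | s, n + 1 => (if s then star S else S) * altPow S (!s) n

theorem altPow_sum (T : ι → A) (n : ℕ) (s : Bool) :
    altPow (∑ i, T i) s n = ∑ i, wordSum n (altProd T s i) := by
  induction n generalizing s with
  | zero => cases s <;> simp [altPow, wordSum, altProd, star_sum]
  | succ n ih =>
    simp only [altPow, ih, wordSum, altProd, wordSum_mul_left, ← Finset.mul_sum, ← Finset.sum_mul]
    cases s <;> simp [star_sum]

theorem altPow_odd (S : A) (n : ℕ) : altPow S false (2 * n + 1) = (S * star S) ^ (n + 1) := by
  induction n with
  | zero => simp [altPow]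
  | succ n ih =>
    rw [show 2 * (n + 1) + 1 = (2 * n + 1) + 1 + 1 by ring, altPow, altPow]
    simp only [Bool.not_false, Bool.not_true, ih]
    rw [pow_succ' (S * star S) (n + 1)]
    simp [mul_assoc]

/-- The product of `γ` over consecutive letters of the word `i :: l`. -/
def pathWeight (γ : ι → ι → ℝ) : ι → List ι → ℝ
  | _, [] => 1
  | i, j :: l => γ i j * pathWeight γ j l

/-- The bound for an alternating product obtained by grouping its factors in pairs. -/
def pairWeight (γ : ι → ι → ℝ) (B : ℝ) : ι → List ι → ℝ
  | _, [] => B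
  | i, [j] => γ i j ^ 2
  | i, j :: k :: l => γ i j ^ 2 * pairWeight γ B k l

variable {T : ι → A} {γ : ι → ι → ℝ} {B : ℝ}

theorem wordSum_pathWeight_le (h0 : ∀ i j, 0 ≤ γ i j) (hB : 0 ≤ B) (hs : ∀ i, ∑ j, γ i j ≤ B)
    (n : ℕ) (i : ι) : wordSum n (pathWeight γ i) ≤ B ^ n := by
  induction n generalizing i with
  | zero => simp [wordSum, pathWeight]
  | succ n ih =>
    simp only [wordSum, pathWeight, wordSum_mul_left]
    calc ∑ j, γ i j * wordSum n (pathWeight γ j) ≤ ∑ j, γ i j * B ^ n :=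
          Finset.sum_le_sum fun j _ => mul_le_mul_of_nonneg_left (ih j) (h0 i j)
      _ = (∑ j, γ i j) * B ^ n := by rw [Finset.sum_mul]
      _ ≤ B * B ^ n := by gcongr; exact hs i
      _ = B ^ (n + 1) := by ring

theorem pairWeight_nonneg (hB : 0 ≤ B) : ∀ (i : ι) (l : List ι), 0 ≤ pairWeight γ B i l
  | _, [] => hB
  | _, [_] => sq_nonneg _
  | _, _ :: k :: l => mul_nonneg (sq_nonneg _) (pairWeight_nonneg hB k l)

theorem pairWeight_mul_le (hB : 0 ≤ B) : ∀ (i j : ι) (l : List ι),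
    pairWeight γ B i (j :: l) * pairWeight γ B j l ≤ B * pathWeight γ i (j :: l) ^ 2
  | i, j, [] => by simp [pairWeight, pathWeight, mul_comm]
  | i, j, k :: l => by
    have h := pairWeight_mul_le hB j k l
    calc pairWeight γ B i (j :: k :: l) * pairWeight γ B j (k :: l)
        = γ i j ^ 2 * (pairWeight γ B j (k :: l) * pairWeight γ B k l) := by
          simp only [pairWeight]; ring
      _ ≤ γ i j ^ 2 * (B * pathWeight γ j (k :: l) ^ 2) := by gcongr
      _ = B * pathWeight γ i (j :: k :: l) ^ 2 := by simp only [pathWeight]; ring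

theorem norm_altProd_le_pairWeight (hT : ∀ i, ‖T i‖ ≤ B)
    (h1 : ∀ i j, ‖T i * star (T j)‖ ≤ γ i j ^ 2) (h2 : ∀ i j, ‖star (T i) * T j‖ ≤ γ i j ^ 2) :
    ∀ (s : Bool) (i : ι) (l : List ι), ‖altProd T s i l‖ ≤ pairWeight γ B i l
  | s, i, [] => by cases s <;> simp [altProd, pairWeight, hT]
  | s, i, [j] => by cases s <;> simp [altProd, pairWeight, h1, h2]
  | s, i, j :: k :: l => by
    have h := norm_altProd_le_pairWeight hT h1 h2 s k l
    simp only [altProd, pairWeight, Bool.not_not, ← mul_assoc]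
    refine (norm_mul_le _ _).trans ?_
    refine mul_le_mul ?_ h (norm_nonneg _) (sq_nonneg _)
    cases s <;> simp [h1, h2]

/-- An alternating product can be grouped in pairs from either end; the geometric mean of the two
resulting bounds has one factor `γ` for each pair of neighbours. -/
theorem norm_altProd_le_pathWeight (h0 : ∀ i j, 0 ≤ γ i j) (hB : 0 ≤ B) (hT : ∀ i, ‖T i‖ ≤ B)
    (h1 : ∀ i j, ‖T i * star (T j)‖ ≤ γ i j ^ 2) (h2 : ∀ i j, ‖star (T i) * T j‖ ≤ γ i j ^ 2)
    (s : Bool) (i : ι) (l : List ι) : ‖altProd T s i l‖ ≤ B * pathWeight γ i l := by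
  have hp : ∀ (i : ι) (l : List ι), 0 ≤ pathWeight γ i l := by
    intro i l
    induction l generalizing i with
    | nil => simp [pathWeight]
    | cons j l ih => exact mul_nonneg (h0 i j) (ih j)
  cases l with
  | nil => simpa [pathWeight, pairWeight] using norm_altProd_le_pairWeight hT h1 h2 s i []
  | cons j l =>
    -- the geometric mean of the two ways of grouping consecutive factors in pairs
    have e1 := norm_altProd_le_pairWeight hT h1 h2 s i (j :: l)
    have e2 : ‖altProd T s i (j :: l)‖ ≤ B * pairWeight γ B j l := by
      simp only [altProd]
      refine (norm_mul_le _ _).trans ?_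
      refine mul_le_mul ?_ (norm_altProd_le_pairWeight hT h1 h2 _ j l) (norm_nonneg _) hB
      cases s <;> simp [hT]
    refine le_of_sq_le_sq ?_ (mul_nonneg hB (hp _ _))
    calc ‖altProd T s i (j :: l)‖ ^ 2
        ≤ pairWeight γ B i (j :: l) * (B * pairWeight γ B j l) := by
          rw [sq]
          exact mul_le_mul e1 e2 (norm_nonneg _) (pairWeight_nonneg hB _ _)
      _ = B * (pairWeight γ B i (j :: l) * pairWeight γ B j l) := by ring
      _ ≤ B * (B * pathWeight γ i (j :: l) ^ 2) := by
          exact mul_le_mul_of_nonneg_left (pairWeight_mul_le hB i j l) hB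
      _ = (B * pathWeight γ i (j :: l)) ^ 2 := by ring

/-- The power trick: a constant factor independent of the power can be dropped. -/
theorem le_of_pow_le_const_mul_pow {x N : ℝ} (hB : 0 ≤ B)
    (h : ∀ n : ℕ, (x ^ 2) ^ (2 ^ n) ≤ N * (B ^ 2) ^ (2 ^ n)) : x ≤ B := by
  by_contra! hlt
  rcases hB.eq_or_lt with rfl | hBpos
  · have := h 0
    have : 0 < (x ^ 2) ^ (2 ^ 0) := by positivity
    simp at *
    nlinarith [h 0]
  · have hr : 1 < x ^ 2 / B ^ 2 := by
      rw [one_lt_div (by positivity)]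
      gcongr
    obtain ⟨m, hm⟩ := pow_unbounded_of_one_lt N hr
    have h2 : N < (x ^ 2 / B ^ 2) ^ (2 ^ m) :=
      hm.trans_le (pow_le_pow_right₀ hr.le Nat.lt_two_pow_self.le)
    rw [div_pow, lt_div_iff₀ (by positivity)] at h2
    exact absurd (h m) (not_le.mpr h2)

/-- **Cotlar–Stein lemma** for a finite family in a C⋆-ring. -/
theorem norm_sum_le_of_almostOrthogonal (h0 : ∀ i j, 0 ≤ γ i j) (hB : 0 ≤ B)
    (h1 : ∀ i j, ‖T i * star (T j)‖ ≤ γ i j ^ 2) (h2 : ∀ i j, ‖star (T i) * T j‖ ≤ γ i j ^ 2)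
    (hs : ∀ i, ∑ j, γ i j ≤ B) : ‖∑ i, T i‖ ≤ B := by
  have hT : ∀ i, ‖T i‖ ≤ B := by
    intro i
    have h3 : ‖T i‖ ^ 2 ≤ γ i i ^ 2 := by
      rw [sq, ← CStarRing.norm_self_mul_star]; exact h1 i i
    exact (le_of_sq_le_sq h3 (h0 i i)).trans
      ((Finset.single_le_sum (fun j _ => h0 i j) (Finset.mem_univ i)).trans (hs i))
  set S := ∑ i, T i with hS
  have key : ∀ n : ℕ, ‖altPow S false n‖ ≤ Fintype.card ι * B ^ (n + 1) := by
    intro n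
    rw [hS, altPow_sum]
    refine (norm_sum_le _ _).trans ?_
    calc ∑ i, ‖wordSum n (altProd T false i)‖
        ≤ ∑ _i : ι, B * B ^ n := by
          refine Finset.sum_le_sum fun i _ => ?_
          refine (norm_wordSum_le n _ _
            (norm_altProd_le_pathWeight h0 hB hT h1 h2 false i)).trans ?_
          rw [wordSum_mul_left]
          gcongr
          exact wordSum_pathWeight_le h0 hB hs n i
      _ = Fintype.card ι * B ^ (n + 1) := by simp [pow_succ']
  refine le_of_pow_le_const_mul_pow (N := Fintype.card ι) hB fun n => ?_
  have hsa : IsSelfAdjoint (S * star S) := IsSelfAdjoint.mul_star_self S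
  have e1 : (‖S‖ ^ 2) ^ (2 ^ n) = ‖(S * star S) ^ (2 ^ n)‖ := by
    rw [hsa.norm_pow_two_pow, CStarRing.norm_self_mul_star, sq]
  obtain ⟨k, hk⟩ : ∃ k, 2 ^ n = k + 1 := ⟨2 ^ n - 1, by have := Nat.one_le_two_pow (n := n); omega⟩
  rw [e1, hk, ← altPow_odd]
  refine (key _).trans_eq ?_
  rw [← pow_mul, show 2 * k + 1 + 1 = 2 * (k + 1) by ring]

end CotlarStein

end DampedOIO

namespace DampedOIO

/-! ### Integral operators with bounded compactly supported kernels -/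

open scoped ENNReal ComplexConjugate

theorem eLpNorm_two_sq {f : ℝ → ℂ} : eLpNorm f 2 volume ^ 2 = ∫⁻ x, ‖f x‖ₑ ^ 2 := by
  have h := eLpNorm_nnreal_pow_eq_lintegral (μ := (volume : Measure ℝ)) (f := f) (p := 2)
    (by norm_num)
  simpa using h

/-- Cauchy–Schwarz with respect to the weight `k`. -/
theorem lintegral_mul_sq_le {α : Type*} [MeasurableSpace α] {μ : Measure α} {k g : α → ℝ≥0∞}
    (hk : AEMeasurable k μ) (hg : AEMeasurable g μ) :
    (∫⁻ x, k x * g x ∂μ) ^ 2 ≤ (∫⁻ x, k x ∂μ) * ∫⁻ x, k x * g x ^ 2 ∂μ := by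
  have h := ENNReal.lintegral_mul_le_Lp_mul_Lq μ (p := 2) (q := 2)
    Real.HolderConjugate.two_two (f := fun x => k x ^ (1 / 2 : ℝ))
    (g := fun x => k x ^ (1 / 2 : ℝ) * g x) (hk.pow_const _) ((hk.pow_const _).mul hg)
  have hh : ∀ t : ℝ≥0∞, t ^ (1 / 2 : ℝ) * t ^ (1 / 2 : ℝ) = t := fun t => by
    rw [← ENNReal.rpow_add_of_nonneg _ _ (by norm_num) (by norm_num)]; norm_num
  have hsq : ∀ t : ℝ≥0∞, (t ^ (1 / 2 : ℝ)) ^ 2 = t := fun t => by rw [sq, hh]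
  have h2 : ∀ t : ℝ≥0∞, t ^ (2 : ℝ) = t ^ 2 := fun t => by
    rw [← ENNReal.rpow_natCast]; norm_num
  simp only [Pi.mul_apply, ← mul_assoc, hh, h2, mul_pow, hsq] at h
  calc _ ≤ ((∫⁻ x, k x ∂μ) ^ (1 / 2 : ℝ) * (∫⁻ x, k x * g x ^ 2 ∂μ) ^ (1 / 2 : ℝ)) ^ 2 := by
        gcongr
    _ = _ := by rw [mul_pow, hsq, hsq]

/-- **Schur's test**, in the form of an estimate for the integral operator. -/
theorem eLpNorm_integral_mul_le_schur {K : ℝ → ℝ → ℂ} (hK : Measurable (Function.uncurry K))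
    {f : ℝ → ℂ} (hf : AEStronglyMeasurable f) {X Y : ℝ≥0∞}
    (hX : ∀ᵐ x : ℝ, ∫⁻ y, ‖K x y‖ₑ ≤ X) (hY : ∀ᵐ y : ℝ, ∫⁻ x, ‖K x y‖ₑ ≤ Y) :
    eLpNorm (fun x => ∫ y, K x y * f y) 2 volume ^ 2 ≤ X * Y * eLpNorm f 2 volume ^ 2 := by
  rw [eLpNorm_two_sq, eLpNorm_two_sq]
  have hKx : ∀ x, Measurable fun y => ‖K x y‖ₑ := fun x =>
    (hK.comp measurable_prodMk_left).enorm
  have hfe : AEMeasurable fun y => ‖f y‖ₑ := hf.enorm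
  calc ∫⁻ x, ‖∫ y, K x y * f y‖ₑ ^ 2
      ≤ ∫⁻ x, X * ∫⁻ y, ‖K x y‖ₑ * ‖f y‖ₑ ^ 2 := by
        refine lintegral_mono_ae ?_
        filter_upwards [hX] with x hx
        calc ‖∫ y, K x y * f y‖ₑ ^ 2 ≤ (∫⁻ y, ‖K x y‖ₑ * ‖f y‖ₑ) ^ 2 := by
              gcongr
              refine (enorm_integral_le_lintegral_enorm _).trans_eq ?_
              simp only [enorm_mul]
          _ ≤ (∫⁻ y, ‖K x y‖ₑ) * ∫⁻ y, ‖K x y‖ₑ * ‖f y‖ₑ ^ 2 :=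
              lintegral_mul_sq_le (hKx x).aemeasurable hfe
          _ ≤ _ := by gcongr
    _ = X * ∫⁻ x, ∫⁻ y, ‖K x y‖ₑ * ‖f y‖ₑ ^ 2 := by
        obtain ⟨g, hg, hfg⟩ := hfe
        have : ∀ x, ∫⁻ y, ‖K x y‖ₑ * ‖f y‖ₑ ^ 2 = ∫⁻ y, ‖K x y‖ₑ * g y ^ 2 := fun x =>
          lintegral_congr_ae (by filter_upwards [hfg] with y hy; rw [hy])
        simp only [this]
        refine lintegral_const_mul _ ?_
        exact Measurable.lintegral_prod_right
          (hK.enorm.mul ((hg.comp measurable_snd).pow_const 2))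
    _ = X * ∫⁻ y, ∫⁻ x, ‖K x y‖ₑ * ‖f y‖ₑ ^ 2 := by
        congr 1
        refine lintegral_lintegral_swap ?_
        exact hK.enorm.aemeasurable.mul
          ((hfe.comp_quasiMeasurePreserving Measure.quasiMeasurePreserving_snd).pow_const 2)
    _ ≤ X * ∫⁻ y, Y * ‖f y‖ₑ ^ 2 := by
        gcongr 1
        refine lintegral_mono_ae ?_
        filter_upwards [hY] with y hy
        rw [lintegral_mul_const' _ _ (by simp)]
        gcongr
    _ = X * Y * ∫⁻ y, ‖f y‖ₑ ^ 2 := by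
        rw [lintegral_const_mul'' _ (hfe.pow_const 2), mul_assoc]

/-- A measurable kernel that is bounded and vanishes off a bounded set. -/
structure NiceKernel (K : ℝ → ℝ → ℂ) : Prop where
  meas : Measurable (Function.uncurry K)
  bdd : ∃ R : ℝ, 0 ≤ R ∧ (∀ x y, ‖K x y‖ ≤ R) ∧ ∀ x y, K x y ≠ 0 → |x| ≤ R ∧ |y| ≤ R

namespace NiceKernel

variable {K G : ℝ → ℝ → ℂ}

theorem swap (hK : NiceKernel K) : NiceKernel fun x y => K y x := by
  obtain ⟨R, h0, h1, h2⟩ := hK.bdd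
  exact ⟨hK.meas.comp measurable_swap, R, h0, fun x y => h1 y x, fun x y h => (h2 y x h).symm⟩

theorem starKernel (hK : NiceKernel K) : NiceKernel fun x y => conj (K x y) := by
  obtain ⟨R, h0, h1, h2⟩ := hK.bdd
  refine ⟨Complex.continuous_conj.measurable.comp hK.meas, R, h0, fun x y => by simpa using h1 x y,
    fun x y h => h2 x y fun h' => h (by simp [h'])⟩

theorem sum {ι : Type*} {K : ι → ℝ → ℝ → ℂ} (s : Finset ι) (hK : ∀ i, NiceKernel (K i)) :
    NiceKernel fun x y => ∑ i ∈ s, K i x y := by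
  choose R h0 h1 h2 using fun i => (hK i).bdd
  refine ⟨?_, ∑ i ∈ s, R i, Finset.sum_nonneg fun i _ => h0 i,
    fun x y => norm_sum_le_of_le _ fun i _ => h1 i x y, fun x y h => ?_⟩
  · exact Finset.measurable_sum s fun i _ => (hK i).meas
  · obtain ⟨i, hi, hne⟩ := Finset.exists_ne_zero_of_sum_ne_zero h
    have h3 : R i ≤ ∑ i ∈ s, R i := Finset.single_le_sum (fun i _ => h0 i) hi
    exact ⟨(h2 i x y hne).1.trans h3, (h2 i x y hne).2.trans h3⟩

theorem lintegral_enorm_le (hK : NiceKernel K) :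
    ∃ C : ℝ≥0∞, C ≠ ⊤ ∧ ∀ x, ∫⁻ y, ‖K x y‖ₑ ≤ C := by
  obtain ⟨R, h0, h1, h2⟩ := hK.bdd
  refine ⟨ENNReal.ofReal R * volume (Set.Icc (-R) R), by
    rw [Real.volume_Icc]; exact ENNReal.mul_ne_top (by simp) (by simp), fun x => ?_⟩
  calc ∫⁻ y, ‖K x y‖ₑ ≤ ∫⁻ y, (Set.Icc (-R) R).indicator (fun _ => ENNReal.ofReal R) y := by
        refine lintegral_mono fun y => ?_
        by_cases h : K x y = 0
        · simp [h]
        · rw [Set.indicator_of_mem (by simpa [Set.mem_Icc, abs_le] using (h2 x y h).2),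
            ← ofReal_norm]
          exact ENNReal.ofReal_le_ofReal (h1 x y)
    _ = _ := by rw [lintegral_indicator measurableSet_Icc]; simp

theorem integrable_mul (hK : NiceKernel K) (x : ℝ) {f : ℝ → ℂ} (hf : LocallyIntegrable f) :
    Integrable fun y => K x y * f y := by
  obtain ⟨R, h0, h1, h2⟩ := hK.bdd
  have hf' : Integrable ((Set.Icc (-R) R).indicator f) :=
    (hf.integrableOn_isCompact isCompact_Icc).integrable_indicator measurableSet_Icc
  refine (hf'.bdd_mul (c := R) (hK.meas.comp measurable_prodMk_left).aestronglyMeasurable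
    (Filter.Eventually.of_forall fun y => h1 x y)).congr (Filter.Eventually.of_forall fun y => ?_)
  by_cases h : K x y = 0
  · simp [h]
  · have : y ∈ Set.Icc (-R) R := by simpa [Set.mem_Icc, abs_le] using (h2 x y h).2
    simp [this]

theorem integrable_mul_prod (hK : NiceKernel K) {f g : ℝ → ℂ} (hf : LocallyIntegrable f)
    (hg : LocallyIntegrable g) :
    Integrable (fun p : ℝ × ℝ => K p.1 p.2 * (f p.1 * g p.2)) := by
  obtain ⟨R, h0, h1, h2⟩ := hK.bdd
  have hf' : Integrable ((Set.Icc (-R) R).indicator f) :=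
    (hf.integrableOn_isCompact isCompact_Icc).integrable_indicator measurableSet_Icc
  have hg' : Integrable ((Set.Icc (-R) R).indicator g) :=
    (hg.integrableOn_isCompact isCompact_Icc).integrable_indicator measurableSet_Icc
  refine ((hf'.mul_prod hg').bdd_mul (c := R) hK.meas.aestronglyMeasurable
    (Filter.Eventually.of_forall fun p => h1 p.1 p.2)).congr
    (Filter.Eventually.of_forall fun p => ?_)
  by_cases h : K p.1 p.2 = 0
  · simp [Function.uncurry, h]
  · have hx : p.1 ∈ Set.Icc (-R) R := by simpa [Set.mem_Icc, abs_le] using (h2 _ _ h).1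
    have hy : p.2 ∈ Set.Icc (-R) R := by simpa [Set.mem_Icc, abs_le] using (h2 _ _ h).2
    simp [Function.uncurry, hx, hy]

/-- The kernel of a composition of two integral operators. -/
theorem comp (hK : NiceKernel K) (hG : NiceKernel G) :
    NiceKernel fun x z => ∫ y, K x y * G y z := by
  obtain ⟨R, h0, h1, h2⟩ := hK.bdd
  obtain ⟨Q, g0, g1, g2⟩ := hG.bdd
  refine ⟨?_, R + Q + R * Q * (2 * R), by positivity, fun x z => ?_, fun x z h => ?_⟩
  · have : StronglyMeasurable fun q : (ℝ × ℝ) × ℝ => K q.1.1 q.2 * G q.2 q.1.2 := by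
      refine Measurable.stronglyMeasurable (Measurable.mul ?_ ?_)
      · exact hK.meas.comp ((measurable_fst.comp measurable_fst).prodMk measurable_snd)
      · exact hG.meas.comp (measurable_snd.prodMk (measurable_snd.comp measurable_fst))
    exact this.integral_prod_right'.measurable
  · have h3 : ‖∫ y in Set.Icc (-R) R, K x y * G y z‖ ≤ R * Q * (volume (Set.Icc (-R) R)).toReal :=
      norm_setIntegral_le_of_norm_le_const (by simp) fun y _ => by
        rw [norm_mul]; exact mul_le_mul (h1 x y) (g1 y z) (norm_nonneg _) h0
    rw [setIntegral_eq_integral_of_forall_compl_eq_zero] at h3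
    · rw [Real.volume_Icc, ENNReal.toReal_ofReal (by linarith)] at h3
      calc _ ≤ _ := h3
        _ = R * Q * (2 * R) := by ring
        _ ≤ _ := by linarith
    · intro y hy
      by_contra hne
      refine hy ?_
      simpa [Set.mem_Icc, abs_le] using (h2 x y (left_ne_zero_of_mul hne)).2
  · have : ∃ y, K x y * G y z ≠ 0 := by
      by_contra! hall
      exact h (by simp [hall])
    obtain ⟨y, hy⟩ := this
    have e1 := (h2 x y (left_ne_zero_of_mul hy)).1
    have e2 := (g2 y z (right_ne_zero_of_mul hy)).2
    have : 0 ≤ R * Q * (2 * R) := by positivity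
    constructor <;> linarith

theorem memLp_integral (hK : NiceKernel K) {f : ℝ → ℂ} (hf : MemLp f 2 volume) :
    MemLp (fun x => ∫ y, K x y * f y) 2 volume := by
  obtain ⟨X, hX, h1⟩ := hK.lintegral_enorm_le
  obtain ⟨Y, hY, h2⟩ := hK.swap.lintegral_enorm_le
  constructor
  · obtain ⟨g, hg, hfg⟩ := hf.1
    have : (fun x => ∫ y, K x y * f y) = fun x => ∫ y, K x y * g y := funext fun x =>
      integral_congr_ae (by filter_upwards [hfg] with y hy; rw [hy])
    rw [this]
    exact (StronglyMeasurable.integral_prod_right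
      ((hK.meas.mul (hg.measurable.comp measurable_snd)).stronglyMeasurable)).aestronglyMeasurable
  · have h3 := eLpNorm_integral_mul_le_schur hK.meas hf.1 (.of_forall h1) (.of_forall h2)
    have : X * Y * eLpNorm f 2 volume ^ 2 < ⊤ :=
      ENNReal.mul_lt_top (ENNReal.mul_lt_top hX.lt_top hY.lt_top)
        (ENNReal.pow_lt_top hf.2)
    by_contra htop
    simp only [not_lt, top_le_iff] at htop
    rw [htop] at h3
    simp only [ne_eq, OfNat.ofNat_ne_zero, not_false_eq_true, ENNReal.top_pow, top_le_iff] at h3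
    exact this.ne h3

end NiceKernel

/-- The Hilbert space `L²(ℝ)`. -/
abbrev L2 : Type := Lp ℂ 2 (volume : Measure ℝ)

theorem L2.locallyIntegrable (f : L2) : LocallyIntegrable (f : ℝ → ℂ) :=
  (Lp.memLp f).locallyIntegrable (by norm_num)

open Classical in
/-- The operator on `L²(ℝ)` with kernel `K`; it is `0` unless `K` is a `NiceKernel`. -/
noncomputable def kerOp (K : ℝ → ℝ → ℂ) : L2 →L[ℂ] L2 :=
  if hK : NiceKernel K then
    LinearMap.mkContinuousOfExistsBound
      { toFun := fun f => (hK.memLp_integral (Lp.memLp f)).toLp _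
        map_add' := fun f g => by
          rw [← MemLp.toLp_add, MemLp.toLp_eq_toLp_iff]
          refine .of_forall fun x => ?_
          simp only [Pi.add_apply]
          rw [← integral_add (hK.integrable_mul x f.locallyIntegrable)
            (hK.integrable_mul x g.locallyIntegrable)]
          refine integral_congr_ae ?_
          filter_upwards [Lp.coeFn_add f g] with y hy
          rw [hy, Pi.add_apply, mul_add]
        map_smul' := fun c f => by
          rw [RingHom.id_apply, ← MemLp.toLp_const_smul, MemLp.toLp_eq_toLp_iff]
          refine .of_forall fun x => ?_
          simp only [Pi.smul_apply, smul_eq_mul]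
          rw [← integral_const_mul]
          refine integral_congr_ae ?_
          filter_upwards [Lp.coeFn_smul c f] with y hy
          rw [hy, Pi.smul_apply, smul_eq_mul, mul_left_comm] }
      (by
        obtain ⟨X, hX, h1⟩ := hK.lintegral_enorm_le
        obtain ⟨Y, hY, h2⟩ := hK.swap.lintegral_enorm_le
        refine ⟨Real.sqrt (X * Y).toReal, fun f => ?_⟩
        have h3 := eLpNorm_integral_mul_le_schur hK.meas (Lp.memLp f).1 (.of_forall h1)
          (.of_forall h2)
        refine le_of_sq_le_sq ?_ (by positivity)
        rw [mul_pow, Real.sq_sqrt (by positivity)]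
        simp only [LinearMap.coe_mk, AddHom.coe_mk, Lp.norm_toLp]
        rw [Lp.norm_def, ← ENNReal.toReal_pow, ← ENNReal.toReal_pow, ← ENNReal.toReal_mul]
        exact ENNReal.toReal_mono (ENNReal.mul_ne_top (ENNReal.mul_ne_top hX hY)
          (ENNReal.pow_ne_top (Lp.eLpNorm_ne_top f))) h3)
  else 0

section kerOp

variable {K G : ℝ → ℝ → ℂ}

theorem kerOp_apply (hK : NiceKernel K) (f : L2) :
    (kerOp K f : ℝ → ℂ) =ᵐ[volume] fun x => ∫ y, K x y * f y := by
  rw [kerOp, dif_pos hK]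
  exact (hK.memLp_integral (Lp.memLp f)).coeFn_toLp

theorem norm_kerOp_le (hK : NiceKernel K) {X Y : ℝ} (hX0 : 0 ≤ X) (hY0 : 0 ≤ Y)
    (hX : ∀ᵐ x : ℝ, ∫⁻ y, ‖K x y‖ₑ ≤ ENNReal.ofReal X)
    (hY : ∀ᵐ y : ℝ, ∫⁻ x, ‖K x y‖ₑ ≤ ENNReal.ofReal Y) : ‖kerOp K‖ ≤ Real.sqrt (X * Y) := by
  refine ContinuousLinearMap.opNorm_le_bound _ (Real.sqrt_nonneg _) fun f => ?_
  have h3 := eLpNorm_integral_mul_le_schur hK.meas (Lp.memLp f).1 hX hY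
  rw [← eLpNorm_congr_ae (kerOp_apply hK f)] at h3
  refine le_of_sq_le_sq ?_ (by positivity)
  rw [mul_pow, Real.sq_sqrt (by positivity), Lp.norm_def, Lp.norm_def]
  have h4 := ENNReal.toReal_mono (ENNReal.mul_ne_top (ENNReal.mul_ne_top
    ENNReal.ofReal_ne_top ENNReal.ofReal_ne_top) (ENNReal.pow_ne_top (Lp.eLpNorm_ne_top f))) h3
  rwa [ENNReal.toReal_mul, ENNReal.toReal_mul, ENNReal.toReal_ofReal hX0,
    ENNReal.toReal_ofReal hY0, ENNReal.toReal_pow, ENNReal.toReal_pow] at h4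

theorem star_kerOp (hK : NiceKernel K) :
    star (kerOp K) = kerOp fun x y => conj (K y x) := by
  symm
  rw [ContinuousLinearMap.star_eq_adjoint, ContinuousLinearMap.eq_adjoint_iff]
  intro f g
  rw [L2.inner_def, L2.inner_def]
  have e1 : ∫ y, inner ℂ ((kerOp (fun x y => conj (K y x)) f : L2) y) (g y) =
      ∫ y, ∫ x, K x y * (conj (f x) * g y) := by
    refine integral_congr_ae ?_
    filter_upwards [kerOp_apply hK.swap.starKernel f] with y hy
    rw [hy, RCLike.inner_apply, ← integral_conj, ← integral_const_mul]
    refine integral_congr_ae (.of_forall fun x => ?_)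
    simp; ring
  have e2 : ∫ x, inner ℂ (f x) ((kerOp K g : L2) x) =
      ∫ x, ∫ y, K x y * (conj (f x) * g y) := by
    refine integral_congr_ae ?_
    filter_upwards [kerOp_apply hK g] with x hx
    rw [hx, RCLike.inner_apply, ← integral_mul_const]
    refine integral_congr_ae (.of_forall fun y => ?_)
    simp; ring
  rw [e1, e2]
  refine (integral_integral_swap (f := fun x y => K x y * (conj (f x) * g y)) ?_).symm
  refine hK.integrable_mul_prod (f := fun x => conj (f x)) ?_ g.locallyIntegrable
  exact ((Lp.memLp f).star).locallyIntegrable (by norm_num)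

theorem kerOp_mul (hK : NiceKernel K) (hG : NiceKernel G) :
    kerOp K * kerOp G = kerOp fun x z => ∫ y, K x y * G y z := by
  ext1 f
  refine Lp.ext ?_
  filter_upwards [kerOp_apply hK (kerOp G f), kerOp_apply (hK.comp hG) f] with x h1 h2
  rw [mul_apply_eq_comp, h1, h2]
  have hKx : LocallyIntegrable fun y => K x y := by
    have := hK.integrable_mul x (f := fun _ => 1) (locallyIntegrable_const 1)
    simpa using this.locallyIntegrable
  have hI := hG.integrable_mul_prod hKx f.locallyIntegrable
  calc ∫ y, K x y * (kerOp G f : L2) y = ∫ y, ∫ z, G y z * (K x y * f z) := by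
        refine integral_congr_ae ?_
        filter_upwards [kerOp_apply hG f] with y hy
        rw [hy, ← integral_const_mul]
        refine integral_congr_ae (.of_forall fun z => ?_)
        simp only; ring
    _ = ∫ z, ∫ y, G y z * (K x y * f z) := integral_integral_swap hI
    _ = _ := by
        refine integral_congr_ae (.of_forall fun z => ?_)
        simp only
        rw [← integral_mul_const]
        refine integral_congr_ae (.of_forall fun y => ?_)
        simp only; ring

theorem kerOp_sum {ι : Type*} {K : ι → ℝ → ℝ → ℂ} (s : Finset ι) (hK : ∀ i, NiceKernel (K i)) :
    ∑ i ∈ s, kerOp (K i) = kerOp fun x y => ∑ i ∈ s, K i x y := by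
  ext1 f
  refine Lp.ext ?_
  have h : ∀ᵐ x, ∀ i ∈ s, (kerOp (K i) f : L2) x = ∫ y, K i x y * f y := by
    rw [Filter.eventually_all_finset]
    exact fun i _ => kerOp_apply (hK i) f
  rw [sum_apply]
  have hc : ⇑(∑ i ∈ s, kerOp (K i) f) =ᵐ[volume] fun x => ∑ i ∈ s, (kerOp (K i) f : L2) x := by
    exact Lp.coeFn_fun_finsetSum s fun i => kerOp (K i) f
  filter_upwards [hc, h, kerOp_apply (NiceKernel.sum s hK) f] with x h1 h2 h3
  rw [h1, h3, Finset.sum_congr rfl h2, ← integral_finsetSum _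
    fun i _ => (hK i).integrable_mul x f.locallyIntegrable]
  simp only [Finset.sum_mul]

end kerOp

end DampedOIO

namespace DampedOIO

/-! ### Amplitudes and repeated integration by parts -/

open scoped Topology

/-- On `U`, the function `f` is of size `a` and each of its first two derivatives costs a
factor `κ`. -/
def SymOn (f : ℝ → ℂ) (U : Set ℝ) (a κ : ℝ) : Prop :=
  ∃ f1 f2 : ℝ → ℂ, ∀ y ∈ U, HasDerivAt f (f1 y) y ∧ HasDerivAt f1 (f2 y) y ∧
    ‖f y‖ ≤ a ∧ ‖f1 y‖ ≤ a * κ ∧ ‖f2 y‖ ≤ a * κ ^ 2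

/-- On `U`, the real function `F` does not vanish and each of its first two derivatives costs a
factor `κ` relative to `F` itself. -/
def RelOn (F : ℝ → ℝ) (U : Set ℝ) (κ : ℝ) : Prop :=
  ∃ F1 F2 : ℝ → ℝ, ∀ y ∈ U, HasDerivAt F (F1 y) y ∧ HasDerivAt F1 (F2 y) y ∧
    F y ≠ 0 ∧ |F1 y| ≤ κ * |F y| ∧ |F2 y| ≤ κ ^ 2 * |F y|

theorem SymOn.mul {f g : ℝ → ℂ} {U : Set ℝ} {a κ b κ' : ℝ} (hf : SymOn f U a κ)
    (hg : SymOn g U b κ') (hκ : 0 ≤ κ) :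
    SymOn (fun y => f y * g y) U (a * b) (κ + κ') := by
  obtain ⟨f1, f2, hf⟩ := hf
  obtain ⟨g1, g2, hg⟩ := hg
  refine ⟨fun y => f1 y * g y + f y * g1 y,
    fun y => (f2 y * g y + f1 y * g1 y) + (f1 y * g1 y + f y * g2 y), fun y hy => ?_⟩
  obtain ⟨d1, d2, b0, b1, b2⟩ := hf y hy
  obtain ⟨e1, e2, c0, c1, c2⟩ := hg y hy
  have ha : 0 ≤ a := (norm_nonneg _).trans b0
  have hb : 0 ≤ b := (norm_nonneg _).trans c0
  refine ⟨d1.mul e1, (d2.mul e1).add (d1.mul e2), ?_, ?_, ?_⟩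
  · rw [norm_mul]; gcongr
  · calc _ ≤ ‖f1 y‖ * ‖g y‖ + ‖f y‖ * ‖g1 y‖ := by
          simpa only [norm_mul] using norm_add_le (f1 y * g y) (f y * g1 y)
      _ ≤ (a * κ) * b + a * (b * κ') := by gcongr
      _ = _ := by ring
  · calc _ ≤ (‖f2 y‖ * ‖g y‖ + ‖f1 y‖ * ‖g1 y‖) + (‖f1 y‖ * ‖g1 y‖ + ‖f y‖ * ‖g2 y‖) := by
          simp only [← norm_mul]
          exact (norm_add_le _ _).trans (add_le_add (norm_add_le _ _) (norm_add_le _ _))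
      _ ≤ ((a * κ ^ 2) * b + (a * κ) * (b * κ')) + ((a * κ) * (b * κ') + a * (b * κ' ^ 2)) := by
          gcongr
      _ = _ := by ring

theorem SymOn.mono {f : ℝ → ℂ} {U V : Set ℝ} {a κ b κ' : ℝ} (hf : SymOn f U a κ) (hV : V ⊆ U)
    (hab : a ≤ b) (h0 : 0 ≤ κ) (hκ : κ ≤ κ') : SymOn f V b κ' := by
  obtain ⟨f1, f2, hf⟩ := hf
  refine ⟨f1, f2, fun y hy => ?_⟩
  obtain ⟨d1, d2, b0, b1, b2⟩ := hf y (hV hy)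
  have ha : 0 ≤ a := (norm_nonneg _).trans b0
  have hb : 0 ≤ b := ha.trans hab
  exact ⟨d1, d2, b0.trans hab, b1.trans (by gcongr), b2.trans (by gcongr)⟩

theorem SymOn.congr {f g : ℝ → ℂ} {U : Set ℝ} {a κ : ℝ} (hf : SymOn f U a κ) (hU : IsOpen U)
    (h : ∀ y ∈ U, g y = f y) : SymOn g U a κ := by
  obtain ⟨f1, f2, hf⟩ := hf
  refine ⟨f1, f2, fun y hy => ?_⟩
  obtain ⟨d1, d2, b0, b1, b2⟩ := hf y hy
  refine ⟨d1.congr_of_eventuallyEq ?_, d2, by rwa [h y hy], b1, b2⟩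
  filter_upwards [hU.mem_nhds hy] with w hw using h w hw

theorem SymOn.conj {f : ℝ → ℂ} {U : Set ℝ} {a κ : ℝ} (hf : SymOn f U a κ) :
    SymOn (fun y => (starRingEnd ℂ) (f y)) U a κ := by
  obtain ⟨f1, f2, hf⟩ := hf
  refine ⟨fun y => (starRingEnd ℂ) (f1 y), fun y => (starRingEnd ℂ) (f2 y), fun y hy => ?_⟩
  obtain ⟨d1, d2, b0, b1, b2⟩ := hf y hy
  exact ⟨d1.star, d2.star, by simpa using b0, by simpa using b1, by simpa using b2⟩

theorem RelOn.mul {F G : ℝ → ℝ} {U : Set ℝ} {κ κ' : ℝ} (hF : RelOn F U κ)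
    (hG : RelOn G U κ') (hκ : 0 ≤ κ) :
    RelOn (fun y => F y * G y) U (κ + κ') := by
  obtain ⟨f1, f2, hf⟩ := hF
  obtain ⟨g1, g2, hg⟩ := hG
  refine ⟨fun y => f1 y * G y + F y * g1 y,
    fun y => (f2 y * G y + f1 y * g1 y) + (f1 y * g1 y + F y * g2 y), fun y hy => ?_⟩
  obtain ⟨d1, d2, b0, b1, b2⟩ := hf y hy
  obtain ⟨e1, e2, c0, c1, c2⟩ := hg y hy
  refine ⟨d1.mul e1, (d2.mul e1).add (d1.mul e2), mul_ne_zero b0 c0, ?_, ?_⟩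
  · calc _ ≤ |f1 y| * |G y| + |F y| * |g1 y| := by
          simpa only [abs_mul] using abs_add_le (f1 y * G y) (F y * g1 y)
      _ ≤ (κ * |F y|) * |G y| + |F y| * (κ' * |G y|) := by gcongr
      _ = _ := by rw [abs_mul]; ring
  · calc _ ≤ (|f2 y| * |G y| + |f1 y| * |g1 y|) + (|f1 y| * |g1 y| + |F y| * |g2 y|) := by
          simp only [← abs_mul]
          exact (abs_add_le _ _).trans (add_le_add (abs_add_le _ _) (abs_add_le _ _))
      _ ≤ ((κ ^ 2 * |F y|) * |G y| + (κ * |F y|) * (κ' * |G y|)) +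
          ((κ * |F y|) * (κ' * |G y|) + |F y| * (κ' ^ 2 * |G y|)) := by gcongr
      _ = _ := by rw [abs_mul]; ring

theorem RelOn.mono {F : ℝ → ℝ} {U V : Set ℝ} {κ κ' : ℝ} (hF : RelOn F U κ) (hV : V ⊆ U)
    (h0 : 0 ≤ κ) (hκ : κ ≤ κ') : RelOn F V κ' := by
  obtain ⟨f1, f2, hf⟩ := hF
  refine ⟨f1, f2, fun y hy => ?_⟩
  obtain ⟨d1, d2, b0, b1, b2⟩ := hf y (hV hy)
  exact ⟨d1, d2, b0, b1.trans (by gcongr), b2.trans (by gcongr)⟩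

theorem RelOn.const {c : ℝ} (hc : c ≠ 0) (U : Set ℝ) : RelOn (fun _ => c) U 0 :=
  ⟨fun _ => 0, fun _ => 0, fun y _ =>
    ⟨hasDerivAt_const y c, hasDerivAt_const y 0, hc, by simp, by simp⟩⟩

/-- Each derivative of `|F| ^ z` costs one factor of size `1 + ‖z‖`. -/
theorem RelOn.symOn_cpow {F : ℝ → ℝ} {U : Set ℝ} {κ a : ℝ} (hF : RelOn F U κ) (hU : IsOpen U)
    (hκ : 0 ≤ κ) (z : ℂ) (ha : ∀ y ∈ U, |F y| ^ z.re ≤ a) :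
    SymOn (fun y => ((|F y| : ℝ) : ℂ) ^ z) U a ((1 + ‖z‖) * κ) := by
  obtain ⟨F1, F2, h⟩ := hF
  have key : SymOn (fun y => Complex.exp (z * (Real.log (F y) : ℂ))) U a ((1 + ‖z‖) * κ) := by
    refine ⟨fun y => Complex.exp (z * (Real.log (F y) : ℂ)) * (z * ((F1 y / F y : ℝ) : ℂ)),
      fun y => Complex.exp (z * (Real.log (F y) : ℂ)) * (z * ((F1 y / F y : ℝ) : ℂ)) *
        (z * ((F1 y / F y : ℝ) : ℂ)) + Complex.exp (z * (Real.log (F y) : ℂ)) *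
        (z * (((F2 y * F y - F1 y * F1 y) / F y ^ 2 : ℝ) : ℂ)), fun y hy => ?_⟩
    obtain ⟨d1, d2, b0, b1, b2⟩ := h y hy
    have hl : HasDerivAt (fun y => z * (Real.log (F y) : ℂ)) (z * ((F1 y / F y : ℝ) : ℂ)) y :=
      (d1.log b0).ofReal_comp.const_mul z
    have hq : HasDerivAt (fun y => z * ((F1 y / F y : ℝ) : ℂ))
        (z * (((F2 y * F y - F1 y * F1 y) / F y ^ 2 : ℝ) : ℂ)) y :=
      ((d2.div d1 b0).ofReal_comp).const_mul z
    have hFp : 0 < |F y| := abs_pos.mpr b0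
    have hn : ‖Complex.exp (z * (Real.log (F y) : ℂ))‖ ≤ a := by
      refine le_trans (le_of_eq ?_) (ha y hy)
      rw [Complex.norm_exp, Real.rpow_def_of_pos hFp, Real.log_abs]
      simp [mul_comm]
    have ha0 : 0 ≤ a := (norm_nonneg _).trans hn
    have q1 : |F1 y / F y| ≤ κ := by
      rw [abs_div, div_le_iff₀ hFp]; exact b1
    have q2 : |(F2 y * F y - F1 y * F1 y) / F y ^ 2| ≤ 2 * κ ^ 2 := by
      rw [abs_div, abs_pow, div_le_iff₀ (by positivity)]
      calc |F2 y * F y - F1 y * F1 y| ≤ |F2 y| * |F y| + |F1 y| * |F1 y| := by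
            rw [← abs_mul, ← abs_mul]; exact abs_sub _ _
        _ ≤ (κ ^ 2 * |F y|) * |F y| + (κ * |F y|) * (κ * |F y|) := by gcongr
        _ = _ := by ring
    refine ⟨hl.cexp, (hl.cexp).mul hq, hn, ?_, ?_⟩
    · rw [norm_mul, norm_mul, Complex.norm_real, Real.norm_eq_abs]
      gcongr
      linarith
    · calc _ ≤ a * (‖z‖ * κ) * (‖z‖ * κ) + a * (‖z‖ * (2 * κ ^ 2)) := by
            refine (norm_add_le _ _).trans ?_
            simp only [norm_mul, Complex.norm_real, Real.norm_eq_abs]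
            gcongr
        _ ≤ a * (((1 + ‖z‖) * κ) ^ 2) := by
            have : 0 ≤ a * κ ^ 2 := by positivity
            nlinarith
  refine key.congr hU fun y hy => ?_
  have b0 := (h y hy).2.2.1
  rw [Complex.cpow_def_of_ne_zero (by simpa using b0), ← Complex.ofReal_log (abs_nonneg _),
    Real.log_abs, mul_comm]

/-- Two integrations by parts: an oscillatory integral whose phase derivative is at least `Λ` in
absolute value, with derivatives of phase and amplitude costing factors `κ` and `κ'`, gains
`((κ + κ') / Λ) ^ 2` over the trivial bound. -/
theorem norm_integral_exp_mul_le {A : ℝ → ℂ} {Φ Φ1 Φ2 Φ3 : ℝ → ℝ} {U : Set ℝ}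
    {a κ κ' Λ ℓ : ℝ} (hU : IsOpen U) (hΛ : 0 < Λ) (hκ : 0 ≤ κ) (hκ' : 0 ≤ κ') (ha : 0 ≤ a)
    (hℓ : 0 ≤ ℓ)
    (hΦ : ∀ y ∈ U, HasDerivAt Φ (Φ1 y) y ∧ HasDerivAt Φ1 (Φ2 y) y ∧ HasDerivAt Φ2 (Φ3 y) y ∧
      Λ ≤ |Φ1 y| ∧ |Φ2 y| ≤ κ * |Φ1 y| ∧ |Φ3 y| ≤ κ ^ 2 * |Φ1 y|)
    (hA : SymOn A U a κ') (hsupp : ∀ y ∉ U, A =ᶠ[𝓝 y] 0)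
    (hvol : volume U ≤ ENNReal.ofReal ℓ) :
    ‖∫ y, Complex.exp (Complex.I * (Φ y : ℂ)) * A y‖ ≤ 4 * a * ((κ + κ') / Λ) ^ 2 * ℓ := by
  obtain ⟨A1, A2, hA⟩ := hA
  set E : ℝ → ℂ := fun y => Complex.exp (Complex.I * (Φ y : ℂ)) with hE
  have hEn : ∀ y, ‖E y‖ = 1 := fun y => by
    simp [hE, Complex.norm_exp]
  -- `e^{iΦ} G` is the approximate primitive of `e^{iΦ} A`, and `e^{iΦ} r` the error
  set G : ℝ → ℂ := fun y => -Complex.I * A y / Φ1 y + (A1 y * Φ1 y - A y * Φ2 y) / Φ1 y ^ 3 with hG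
  set r : ℝ → ℂ := fun y => -(A2 y / Φ1 y ^ 2 - 3 * A1 y * Φ2 y / Φ1 y ^ 3 -
    A y * Φ3 y / Φ1 y ^ 3 + 3 * A y * Φ2 y ^ 2 / Φ1 y ^ 4) with hr
  set F : ℝ → ℂ := U.indicator fun y => E y * G y with hF
  set F' : ℝ → ℂ := U.indicator fun y => E y * (A y - r y) with hF'
  have hUF : volume U < ⊤ := hvol.trans_lt ENNReal.ofReal_lt_top
  have hmem : ∀ y, y ∉ U → A y = 0 := fun y hy => by simpa using (hsupp y hy).self_of_nhds
  -- off `U`, near `y` the amplitude vanishes, and so do its derivatives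
  have hzero : ∀ y ∉ U, ∀ᶠ w in 𝓝 y, A w = 0 ∧ (w ∈ U → A1 w = 0) := by
    intro y hy
    filter_upwards [(hsupp y hy).eventuallyEq_nhds] with w hw
    refine ⟨by simpa using hw.self_of_nhds, fun hwU => ?_⟩
    exact (hA w hwU).1.unique ((hasDerivAt_const w (0 : ℂ)).congr_of_eventuallyEq hw)
  have hFderiv : ∀ y, HasDerivAt F (F' y) y := by
    intro y
    by_cases hy : y ∈ U
    · obtain ⟨p1, p2, p3, p4, -, -⟩ := hΦ y hy
      obtain ⟨q1, q2, -, -, -⟩ := hA y hy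
      have hne : (Φ1 y : ℂ) ≠ 0 := by
        have : 0 < |Φ1 y| := hΛ.trans_le p4
        exact_mod_cast abs_pos.mp this
      have c1 := p1.ofReal_comp
      have c2 := p2.ofReal_comp
      have c3 := p3.ofReal_comp
      have hd : HasDerivAt (fun y => E y * G y) (E y * (A y - r y)) y := by
        have hEd : HasDerivAt E (E y * (Complex.I * Φ1 y)) y := (c1.const_mul Complex.I).cexp
        have hGd := ((q1.const_mul (-Complex.I)).div c2 hne).add
          (((q2.mul c2).sub (q1.mul c3)).div (c2.pow 3) (pow_ne_zero 3 hne))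
        refine (hEd.mul hGd).congr_deriv ?_
        simp only [hr, Pi.mul_apply, Pi.pow_apply, Pi.sub_apply, Pi.add_apply, Pi.div_apply]
        field_simp
        ring_nf
        simp only [Complex.I_sq]
        ring
      rw [hF', Set.indicator_of_mem hy]
      refine hd.congr_of_eventuallyEq ?_
      filter_upwards [hU.mem_nhds hy] with w hw
      rw [hF, Set.indicator_of_mem hw]
    · rw [hF', Set.indicator_of_notMem hy]
      refine (hasDerivAt_const y (0 : ℂ)).congr_of_eventuallyEq ?_
      filter_upwards [hzero y hy] with w hw
      by_cases hwU : w ∈ U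
      · simp [hF, hwU, hG, hw.1, hw.2 hwU]
      · simp [hF, hwU]
  have hEA : ∀ y, DifferentiableAt ℝ (fun y => E y * A y) y := by
    intro y
    by_cases hy : y ∈ U
    · have hEd : DifferentiableAt ℝ E y :=
        (((hΦ y hy).1.ofReal_comp).const_mul Complex.I).cexp.differentiableAt
      exact hEd.mul (hA y hy).1.differentiableAt
    · refine ((hasDerivAt_const y (0 : ℂ)).congr_of_eventuallyEq ?_).differentiableAt
      filter_upwards [hzero y hy] with w hw
      simp [hw.1]
  have hbr : ∀ y ∈ U, ‖r y‖ ≤ 4 * a * ((κ + κ') / Λ) ^ 2 := by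
    intro y hy
    obtain ⟨-, -, -, p4, p5, p6⟩ := hΦ y hy
    obtain ⟨-, -, q0, q1, q2⟩ := hA y hy
    set L := |Φ1 y| with hL
    have hLp : 0 < L := hΛ.trans_le p4
    have t1 : ‖A2 y / (Φ1 y : ℂ) ^ 2‖ ≤ a * κ' ^ 2 / L ^ 2 := by
      rw [norm_div, norm_pow, Complex.norm_real, Real.norm_eq_abs]; gcongr
    have t2 : ‖3 * A1 y * Φ2 y / (Φ1 y : ℂ) ^ 3‖ ≤ 3 * (a * κ') * κ / L ^ 2 := by
      rw [norm_div, norm_pow, norm_mul, norm_mul, Complex.norm_real, Complex.norm_real,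
        Real.norm_eq_abs, Real.norm_eq_abs, Complex.norm_ofNat, ← hL]
      rw [div_le_div_iff₀ (by positivity) (by positivity)]
      calc 3 * ‖A1 y‖ * |Φ2 y| * L ^ 2 ≤ 3 * (a * κ') * (κ * L) * L ^ 2 := by gcongr
        _ = _ := by ring
    have t3 : ‖A y * Φ3 y / (Φ1 y : ℂ) ^ 3‖ ≤ a * κ ^ 2 / L ^ 2 := by
      rw [norm_div, norm_pow, norm_mul, Complex.norm_real, Complex.norm_real,
        Real.norm_eq_abs, Real.norm_eq_abs, ← hL]
      rw [div_le_div_iff₀ (by positivity) (by positivity)]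
      calc ‖A y‖ * |Φ3 y| * L ^ 2 ≤ a * (κ ^ 2 * L) * L ^ 2 := by gcongr
        _ = _ := by ring
    have t4 : ‖3 * A y * (Φ2 y : ℂ) ^ 2 / (Φ1 y : ℂ) ^ 4‖ ≤ 3 * a * κ ^ 2 / L ^ 2 := by
      rw [norm_div, norm_pow, norm_mul, norm_mul, norm_pow, Complex.norm_real, Complex.norm_real,
        Real.norm_eq_abs, Real.norm_eq_abs, Complex.norm_ofNat, ← hL]
      rw [div_le_div_iff₀ (by positivity) (by positivity)]
      calc 3 * ‖A y‖ * |Φ2 y| ^ 2 * L ^ 2 ≤ 3 * a * (κ * L) ^ 2 * L ^ 2 := by gcongr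
        _ = _ := by ring
    calc ‖r y‖ ≤ a * κ' ^ 2 / L ^ 2 + 3 * (a * κ') * κ / L ^ 2 + a * κ ^ 2 / L ^ 2 +
          3 * a * κ ^ 2 / L ^ 2 := by
          simp only [hr, norm_neg]
          refine (norm_add_le _ _).trans (add_le_add ((norm_sub_le _ _).trans
            (add_le_add ((norm_sub_le _ _).trans (add_le_add t1 t2)) t3)) t4)
      _ = a * (κ' ^ 2 + 3 * κ' * κ + 4 * κ ^ 2) / L ^ 2 := by ring
      _ ≤ a * (4 * (κ + κ') ^ 2) / Λ ^ 2 := by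
          gcongr
          nlinarith [mul_nonneg hκ hκ']
      _ = _ := by ring
  have hint : ∀ (f : ℝ → ℂ), AEStronglyMeasurable f → (∀ y ∉ U, f y = 0) →
      (∃ B, ∀ y ∈ U, ‖f y‖ ≤ B) → Integrable f := by
    intro f hfm hf0 ⟨B, hB⟩
    have : IntegrableOn f U := by
      refine IntegrableOn.of_bound hUF hfm.restrict B ?_
      exact (ae_restrict_iff' hU.measurableSet).mpr (.of_forall hB)
    exact this.integrable_of_forall_notMem_eq_zero hf0
  have hEAint : Integrable fun y => E y * A y := by
    refine hint _ (Differentiable.continuous hEA).aestronglyMeasurable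
      (fun y hy => by simp [hmem y hy]) ⟨a, fun y hy => ?_⟩
    rw [norm_mul, hEn, one_mul]; exact (hA y hy).2.2.1
  have hFint : Integrable F := by
    refine hint F ?_ (fun y hy => by simp [hF, hy])
      ⟨a / Λ + ((a * κ') / Λ ^ 2 + a * κ / Λ ^ 2), fun y hy => ?_⟩
    · exact (Differentiable.continuous fun y => (hFderiv y).differentiableAt).aestronglyMeasurable
    · obtain ⟨-, -, -, p4, p5, p6⟩ := hΦ y hy
      obtain ⟨-, -, q0, q1, q2⟩ := hA y hy
      set L := |Φ1 y| with hL
      have hLp : 0 < L := hΛ.trans_le p4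
      rw [hF, Set.indicator_of_mem hy, norm_mul, hEn, one_mul]
      refine (norm_add_le _ _).trans (add_le_add ?_ ?_)
      · rw [norm_div, norm_mul, norm_neg, Complex.norm_I, one_mul, Complex.norm_real,
          Real.norm_eq_abs]
        gcongr
      · rw [norm_div, norm_pow, Complex.norm_real, Real.norm_eq_abs, ← hL, ← add_div]
        calc ‖A1 y * Φ1 y - A y * Φ2 y‖ / L ^ 3 ≤ (a * κ' * L + a * (κ * L)) / L ^ 3 := by
              gcongr
              refine (norm_sub_le _ _).trans ?_
              rw [norm_mul, norm_mul, Complex.norm_real, Complex.norm_real, Real.norm_eq_abs,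
                Real.norm_eq_abs, ← hL]
              gcongr
          _ = (a * κ' + a * κ) / L ^ 2 := by field_simp
          _ ≤ _ := by gcongr
  have hF'int : Integrable F' := by
    refine hint F' ?_ (fun y hy => by simp [hF', hy]) ⟨a + 4 * a * ((κ + κ') / Λ) ^ 2,
      fun y hy => ?_⟩
    · have : F' = deriv F := funext fun y => (hFderiv y).deriv.symm
      rw [this]
      exact (measurable_deriv F).aestronglyMeasurable
    · rw [hF', Set.indicator_of_mem hy, norm_mul, hEn, one_mul]
      exact (norm_sub_le _ _).trans (add_le_add (hA y hy).2.2.1 (hbr y hy))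
  have h0 : ∫ y, F' y = 0 := integral_eq_zero_of_hasDerivAt_of_integrable hFderiv hF'int hFint
  have h1 : ∫ y, E y * A y = ∫ y in U, E y * r y := by
    rw [← sub_zero (∫ y, E y * A y), ← h0, ← integral_sub hEAint hF'int,
      ← integral_indicator hU.measurableSet]
    refine integral_congr_ae (.of_forall fun y => ?_)
    by_cases hy : y ∈ U
    · simp [hF', hy]; ring
    · simp [hF', hy, hmem y hy]
  rw [h1]
  refine (norm_setIntegral_le_of_norm_le_const hUF (C := 4 * a * ((κ + κ') / Λ) ^ 2)
    fun y hy => ?_).trans ?_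
  · rw [norm_mul, hEn, one_mul]; exact hbr y hy
  · gcongr
    rw [measureReal_def]
    exact ENNReal.toReal_le_of_le_ofReal hℓ hvol

end DampedOIO

namespace DampedOIO

open scoped Topology

/-! ### Smooth dyadic cutoffs -/

/-- A smooth step: `1` on `(-∞, 1]` and `0` on `[2, ∞)`. -/
noncomputable def step (s : ℝ) : ℝ := Real.smoothTransition (2 - s)

/-- The dyadic cutoff `step s - step (2 s)`, supported in `[1/2, 2]`; its dilates by powers of `2`
sum to `1` on `(0, ∞)`. -/
noncomputable def bump (s : ℝ) : ℝ := step s - step (2 * s)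

theorem step_of_le {s : ℝ} (h : s ≤ 1) : step s = 1 :=
  Real.smoothTransition.one_of_one_le (by linarith)

theorem step_of_ge {s : ℝ} (h : 2 ≤ s) : step s = 0 :=
  Real.smoothTransition.zero_of_nonpos (by linarith)

theorem step_nonneg (s : ℝ) : 0 ≤ step s := Real.smoothTransition.nonneg _

theorem step_le_one (s : ℝ) : step s ≤ 1 := Real.smoothTransition.le_one _

theorem contDiff_step : ContDiff ℝ 2 step :=
  Real.smoothTransition.contDiff.comp (contDiff_const.sub contDiff_id)

theorem contDiff_bump : ContDiff ℝ 2 bump :=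
  contDiff_step.sub (contDiff_step.comp (contDiff_const.mul contDiff_id))

theorem bump_of_le {s : ℝ} (h : s ≤ 1 / 2) : bump s = 0 := by
  rw [bump, step_of_le (by linarith), step_of_le (by linarith), sub_self]

theorem bump_of_ge {s : ℝ} (h : 2 ≤ s) : bump s = 0 := by
  rw [bump, step_of_ge h, step_of_ge (by linarith), sub_self]

theorem bump_nonneg (s : ℝ) : 0 ≤ bump s := by
  rcases le_total s 1 with h | h
  · rw [bump, step_of_le h]; linarith [step_le_one (2 * s)]
  · rw [bump, step_of_ge (by linarith : 2 ≤ 2 * s)]; linarith [step_nonneg s]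

theorem bump_le_one (s : ℝ) : bump s ≤ 1 := by
  rw [bump]; linarith [step_le_one s, step_nonneg (2 * s)]

theorem exists_bump_deriv_bound : ∃ C : ℝ, 0 < C ∧ ∀ s, |deriv bump s| ≤ C ∧
    |deriv (deriv bump) s| ≤ C ^ 2 := by
  have hsupp : HasCompactSupport bump :=
    HasCompactSupport.intro (isCompact_Icc (a := (1 / 2 : ℝ)) (b := 2)) fun s hs => by
      rw [Set.mem_Icc, not_and_or, not_le, not_le] at hs
      rcases hs with h | h
      · exact bump_of_le h.le
      · exact bump_of_ge h.le
  have h1 : ContDiff ℝ 1 (deriv bump) := by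
    have := contDiff_bump
    rw [show (2 : ℕ∞ω) = 1 + 1 from rfl, contDiff_succ_iff_deriv] at this
    exact this.2.2
  have h2 : Continuous (deriv (deriv bump)) := h1.continuous_deriv le_rfl
  obtain ⟨C1, hC1⟩ := hsupp.deriv.exists_bound_of_continuous h1.continuous
  obtain ⟨C2, hC2⟩ := hsupp.deriv.deriv.exists_bound_of_continuous h2
  refine ⟨max 1 (max C1 C2), by positivity, fun s => ⟨?_, ?_⟩⟩
  · exact (hC1 s).trans ((le_max_left _ _).trans (le_max_right _ _))
  · have h3 : C2 ≤ max 1 (max C1 C2) := (le_max_right _ _).trans (le_max_right _ _)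
    have h4 : 1 ≤ max 1 (max C1 C2) := le_max_left _ _
    refine (hC2 s).trans (h3.trans ?_)
    nlinarith

/-- A constant controlling the first two derivatives of `bump`. -/
noncomputable def bumpConst : ℝ := exists_bump_deriv_bound.choose

theorem bumpConst_pos : 0 < bumpConst := exists_bump_deriv_bound.choose_spec.1

/-- The linear form `a y + b x`. -/
def lin (a b x y : ℝ) : ℝ := a * y + b * x

theorem symOn_bump_lin (a b x : ℝ) {ρ : ℝ} (hρ : 0 < ρ) (U : Set ℝ) :
    SymOn (fun y => ((bump (lin a b x y / ρ) : ℝ) : ℂ)) U 1 (bumpConst * |a| / ρ) := by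
  have hb := exists_bump_deriv_bound.choose_spec.2
  refine ⟨fun y => ((deriv bump (lin a b x y / ρ) * (a / ρ) : ℝ) : ℂ),
    fun y => ((deriv (deriv bump) (lin a b x y / ρ) * (a / ρ) * (a / ρ) : ℝ) : ℂ),
    fun y _ => ?_⟩
  have hl : HasDerivAt (fun y => lin a b x y / ρ) (a / ρ) y := by
    have : HasDerivAt (fun y => a * y + b * x) a y := by
      simpa using ((hasDerivAt_id y).const_mul a).add_const (b * x)
    exact this.div_const ρ
  have h1 : ContDiff ℝ 1 (deriv bump) := by
    have := contDiff_bump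
    rw [show (2 : ℕ∞ω) = 1 + 1 from rfl, contDiff_succ_iff_deriv] at this
    exact this.2.2
  have d1 : HasDerivAt bump (deriv bump (lin a b x y / ρ)) (lin a b x y / ρ) :=
    (contDiff_bump.differentiable (by norm_num)).differentiableAt.hasDerivAt
  have d2 : HasDerivAt (deriv bump) (deriv (deriv bump) (lin a b x y / ρ)) (lin a b x y / ρ) :=
    (h1.differentiable (by norm_num)).differentiableAt.hasDerivAt
  have e1 : HasDerivAt (fun y => bump (lin a b x y / ρ))
      (deriv bump (lin a b x y / ρ) * (a / ρ)) y := by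
    exact HasDerivAt.comp (h₂ := bump) y d1 hl
  have e2 : HasDerivAt (fun y => deriv bump (lin a b x y / ρ))
      (deriv (deriv bump) (lin a b x y / ρ) * (a / ρ)) y := by
    exact HasDerivAt.comp (h₂ := deriv bump) y d2 hl
  refine ⟨e1.ofReal_comp, (e2.mul_const (a / ρ)).ofReal_comp, ?_, ?_, ?_⟩
  · rw [Complex.norm_real, Real.norm_eq_abs, abs_of_nonneg (bump_nonneg _)]
    exact bump_le_one _
  · rw [Complex.norm_real, Real.norm_eq_abs, abs_mul, abs_div, abs_of_pos hρ, one_mul, mul_div_assoc]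
    exact mul_le_mul_of_nonneg_right (hb _).1 (by positivity)
  · rw [Complex.norm_real, Real.norm_eq_abs, abs_mul, abs_mul, abs_div, abs_of_pos hρ, one_mul,
      mul_div_assoc, mul_pow, mul_assoc, ← sq]
    exact mul_le_mul_of_nonneg_right (hb _).2 (by positivity)

/-! ### Phase differences -/

/-- A nonvanishing derivative `p` of `f` dominates the increments of any `g` whose derivative is
dominated by `p`. -/
theorem abs_sub_le_of_deriv_le {f g p q : ℝ → ℝ} {s t κ : ℝ} (hst : s < t)
    (hf : ∀ u ∈ Set.Icc s t, HasDerivAt f (p u) u) (hg : ∀ u ∈ Set.Icc s t, HasDerivAt g (q u) u)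
    (hp : ∀ u ∈ Set.Icc s t, p u ≠ 0) (hq : ∀ u ∈ Set.Icc s t, |q u| ≤ κ * |p u|) :
    |g t - g s| ≤ κ * |f t - f s| := by
  obtain ⟨c, hc, h⟩ := exists_ratio_hasDerivAt_eq_ratio_slope f p hst
    (fun u hu => (hf u hu).continuousAt.continuousWithinAt)
    (fun u hu => hf u (Set.Ioo_subset_Icc_self hu)) g q
    (fun u hu => (hg u hu).continuousAt.continuousWithinAt)
    (fun u hu => hg u (Set.Ioo_subset_Icc_self hu))
  have hc' := Set.Ioo_subset_Icc_self hc
  have hpc : 0 < |p c| := abs_pos.mpr (hp c hc')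
  have h2 : |g t - g s| * |p c| = |f t - f s| * |q c| := by rw [← abs_mul, ← abs_mul, h]
  have h3 : |g t - g s| * |p c| ≤ κ * |f t - f s| * |p c| := by
    rw [h2]
    calc |f t - f s| * |q c| ≤ |f t - f s| * (κ * |p c|) := by gcongr; exact hq c hc'
      _ = _ := by ring
  exact le_of_mul_le_mul_right h3 hpc

/-- If the derivative never vanishes, the increment over an interval is at least the increment
over any subinterval. -/
theorem mul_sub_le_abs_sub {f p : ℝ → ℝ} {s t v w ℓ : ℝ} (hsv : s ≤ v) (hvw : v ≤ w) (hwt : w ≤ t)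
    (hf : ∀ u ∈ Set.Icc s t, HasDerivAt f (p u) u)
    (hp : ∀ u ∈ Set.Icc s t, p u ≠ 0) (hl : ∀ u ∈ Set.Icc v w, ℓ ≤ |p u|) :
    ℓ * (w - v) ≤ |f t - f s| := by
  wlog hpos : ∀ u ∈ Set.Icc s t, 0 < p u generalizing f p
  · have hneg : ∀ u ∈ Set.Icc s t, p u < 0 := by
      rcases hasDerivWithinAt_forall_lt_or_forall_gt_of_forall_ne (convex_Icc s t)
        (fun u hu => (hf u hu).hasDerivWithinAt) hp with h | h
      · exact h
      · exact absurd h hpos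
    have := this (f := fun u => -f u) (p := fun u => -p u) (fun u hu => (hf u hu).neg)
      (fun u hu => neg_ne_zero.mpr (hp u hu)) (fun u hu => by simpa using hl u hu)
      (fun u hu => by simpa using hneg u hu)
    rw [show -f t - -f s = -(f t - f s) by ring, abs_neg] at this
    exact this
  have hmono : MonotoneOn f (Set.Icc s t) := by
    refine monotoneOn_of_deriv_nonneg (convex_Icc s t)
      (fun u hu => (hf u hu).continuousAt.continuousWithinAt)
      (fun u hu => (hf u (interior_subset hu)).differentiableAt.differentiableWithinAt) fun u hu => ?_
    rw [(hf u (interior_subset hu)).deriv]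
    exact (hpos u (interior_subset hu)).le
  have hsub : Set.Icc v w ⊆ Set.Icc s t := Set.Icc_subset_Icc hsv hwt
  have hvw' : ℓ * (w - v) ≤ f w - f v := by
    refine Convex.mul_sub_le_image_sub_of_le_deriv (convex_Icc v w)
      (fun u hu => (hf u (hsub hu)).continuousAt.continuousWithinAt)
      (fun u hu => (hf u (hsub (interior_subset hu))).differentiableAt.differentiableWithinAt)
      (fun u hu => ?_) v (Set.left_mem_Icc.mpr hvw) w (Set.right_mem_Icc.mpr hvw) hvw
    rw [(hf u (hsub (interior_subset hu))).deriv]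
    exact (hl u (interior_subset hu)).trans_eq (abs_of_pos (hpos u (hsub (interior_subset hu))))
  have h1 : f s ≤ f v := hmono (Set.left_mem_Icc.mpr (by linarith)) ⟨hsv, by linarith⟩ hsv
  have h2 : f w ≤ f t := hmono ⟨by linarith, hwt⟩ (Set.right_mem_Icc.mpr (by linarith)) hwt
  exact (by linarith : ℓ * (w - v) ≤ f t - f s).trans (le_abs_self _)

end DampedOIO

namespace DampedOIO

open scoped Topology ComplexConjugate

/-! ### Kernels of the pieces and of their products -/

/-- The part of a sector where `L₁ = a₁ y + b₁ x` exceeds `t`, `L₂ = a₂ y + b₂ x` exceeds `s` and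
`L₁ < 16 L₂`, cut at abscissa `x`. -/
def sectorSlice (a₁ b₁ a₂ b₂ t s x : ℝ) : Set ℝ :=
  {y | t < lin a₁ b₁ x y ∧ s < lin a₂ b₂ x y ∧ lin a₁ b₁ x y < 16 * lin a₂ b₂ x y}

/-- Quantitative hypotheses, in the variable `y`, on a phase `S` with mixed derivative `P` and on
a damping factor `D` in the half-sector `0 < L₁ < 16 L₂`: there `|P| ≳ L₁ ^ m L₂ ^ e`,
`|D| ∼ L₁ ^ m' L₂ ^ e'`, and a derivative in `y` costs `1 / L₁`, or `1 / L₂` if `L₁` does not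
depend on `y`. -/
structure OneSided (S P D : ℝ → ℝ → ℝ) (a₁ b₁ a₂ b₂ : ℝ) (m e m' e' : ℕ) (C : ℝ) : Prop where
  one_le : 1 ≤ C
  det_ne : a₁ * b₂ - a₂ * b₁ ≠ 0
  tower : ∃ S1 S2 S3 P1 P2 : ℝ → ℝ → ℝ, ∀ x y,
    HasDerivAt (fun y => S x y) (S1 x y) y ∧ HasDerivAt (fun y => S1 x y) (S2 x y) y ∧
    HasDerivAt (fun y => S2 x y) (S3 x y) y ∧ HasDerivAt (fun x => S1 x y) (P x y) x ∧
    HasDerivAt (fun x => S2 x y) (P1 x y) x ∧ HasDerivAt (fun x => S3 x y) (P2 x y) x ∧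
    HasDerivAt (fun y => P x y) (P1 x y) y ∧ HasDerivAt (fun y => P1 x y) (P2 x y) y
  phase_lower : ∀ x y, y ∈ sectorSlice a₁ b₁ a₂ b₂ 0 0 x →
    C⁻¹ * (lin a₁ b₁ x y ^ m * lin a₂ b₂ x y ^ e) ≤ |P x y|
  phase_rel : ∀ x t s, 0 < t → 0 < s →
    RelOn (P x) (sectorSlice a₁ b₁ a₂ b₂ t s x) (C / if a₁ = 0 then s else t)
  damp_lower : ∀ x y, y ∈ sectorSlice a₁ b₁ a₂ b₂ 0 0 x →
    C⁻¹ * (lin a₁ b₁ x y ^ m' * lin a₂ b₂ x y ^ e') ≤ |D x y|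
  damp_upper : ∀ x y, y ∈ sectorSlice a₁ b₁ a₂ b₂ 0 0 x →
    |D x y| ≤ C * (lin a₁ b₁ x y ^ m' * lin a₂ b₂ x y ^ e')
  damp_rel : ∀ x t s, 0 < t → 0 < s →
    RelOn (D x) (sectorSlice a₁ b₁ a₂ b₂ t s x) (C / if a₁ = 0 then s else t)

/-- The cutoff to `L₁ ∼ δ`, `L₂ ∼ R`. -/
noncomputable def cell (a₁ b₁ a₂ b₂ R δ x y : ℝ) : ℝ :=
  bump (lin a₂ b₂ x y / R) * bump (lin a₁ b₁ x y / δ)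

/-- The piece of the kernel `e^{iS} |D|^z` with `L₁ ∼ δ`, `L₂ ∼ R`. -/
noncomputable def piece (S D : ℝ → ℝ → ℝ) (a₁ b₁ a₂ b₂ : ℝ) (z : ℂ) (R δ x y : ℝ) : ℂ :=
  kernel S D z x y * (cell a₁ b₁ a₂ b₂ R δ x y : ℂ)

theorem continuous_lin (a b x : ℝ) : Continuous fun y => lin a b x y := by
  unfold lin; fun_prop

/-- The set of `y` at which the piece at scales `R, δ` may be nonzero, with some room to spare. -/
def cellSlice (a₁ b₁ a₂ b₂ R δ x : ℝ) : Set ℝ :=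
  {y | δ / 4 < lin a₁ b₁ x y ∧ lin a₁ b₁ x y < 4 * δ ∧ R / 4 < lin a₂ b₂ x y ∧
    lin a₂ b₂ x y < 4 * R}

section

variable {a₁ b₁ a₂ b₂ R δ x : ℝ}

theorem isOpen_cellSlice : IsOpen (cellSlice a₁ b₁ a₂ b₂ R δ x) := by
  have h1 := continuous_lin a₁ b₁ x
  have h2 := continuous_lin a₂ b₂ x
  exact (isOpen_lt continuous_const h1).inter ((isOpen_lt h1 continuous_const).inter
    ((isOpen_lt continuous_const h2).inter (isOpen_lt h2 continuous_const)))

theorem bump_eventually_eq_zero {a b ρ y : ℝ} (hρ : 0 < ρ)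
    (h : ¬ (ρ / 4 < lin a b x y ∧ lin a b x y < 4 * ρ)) :
    ∀ᶠ w in 𝓝 y, bump (lin a b x w / ρ) = 0 := by
  have hc := (continuous_lin a b x).continuousAt (x := y)
  rw [not_and_or, not_lt, not_lt] at h
  rcases h with h | h
  · filter_upwards [hc.eventually (gt_mem_nhds (show lin a b x y < ρ / 2 by linarith))] with w hw
    exact bump_of_le (by rw [div_le_iff₀ hρ]; linarith)
  · filter_upwards [hc.eventually (lt_mem_nhds (show 2 * ρ < lin a b x y by linarith))] with w hw
    exact bump_of_ge (by rw [le_div_iff₀ hρ]; linarith)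

theorem cell_eventually_eq_zero {y : ℝ} (hR : 0 < R) (hδ : 0 < δ)
    (h : y ∉ cellSlice a₁ b₁ a₂ b₂ R δ x) :
    ∀ᶠ w in 𝓝 y, cell a₁ b₁ a₂ b₂ R δ x w = 0 := by
  by_cases h1 : δ / 4 < lin a₁ b₁ x y ∧ lin a₁ b₁ x y < 4 * δ
  · have h2 : ¬ (R / 4 < lin a₂ b₂ x y ∧ lin a₂ b₂ x y < 4 * R) := fun h2 =>
      h ⟨h1.1, h1.2, h2.1, h2.2⟩
    filter_upwards [bump_eventually_eq_zero hR h2] with w hw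
    simp [cell, hw]
  · filter_upwards [bump_eventually_eq_zero hδ h1] with w hw
    simp [cell, hw]

theorem mem_cellSlice_of_cell_ne_zero {y : ℝ} (hR : 0 < R) (hδ : 0 < δ)
    (h : cell a₁ b₁ a₂ b₂ R δ x y ≠ 0) : y ∈ cellSlice a₁ b₁ a₂ b₂ R δ x := by
  by_contra hc
  exact h (cell_eventually_eq_zero hR hδ hc).self_of_nhds

theorem mem_sectorSlice_of_mem_cellSlice {y t s : ℝ} (hδR : δ ≤ R) (ht : t ≤ δ / 4)
    (hs : s ≤ R / 4) (h : y ∈ cellSlice a₁ b₁ a₂ b₂ R δ x) :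
    y ∈ sectorSlice a₁ b₁ a₂ b₂ t s x := by
  obtain ⟨h1, h2, h3, h4⟩ := h
  exact ⟨by linarith, by linarith, by linarith⟩

theorem symOn_cell (hR : 0 < R) (hδ : 0 < δ) (U : Set ℝ) :
    SymOn (fun y => (cell a₁ b₁ a₂ b₂ R δ x y : ℂ)) U 1
      (bumpConst * |a₂| / R + bumpConst * |a₁| / δ) := by
  have hb := bumpConst_pos
  have := (symOn_bump_lin a₂ b₂ x hR U).mul (symOn_bump_lin a₁ b₁ x hδ U) (by positivity)
  simpa only [cell, Complex.ofReal_mul, one_mul] using this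

/-- The slope of a segment set controls its length. -/
theorem volume_lin_slice_le {a b ρ : ℝ} (ha : a ≠ 0) {U : Set ℝ}
    (h : ∀ y ∈ U, 0 < lin a b x y ∧ lin a b x y < 4 * ρ) :
    volume U ≤ ENNReal.ofReal (4 * ρ / |a|) := by
  have hsub : U ⊆ Metric.closedBall (-(b * x) / a + 2 * ρ / a) (2 * ρ / |a|) := by
    intro y hy
    obtain ⟨h1, h2⟩ := h y hy
    rw [Metric.mem_closedBall, Real.dist_eq, le_div_iff₀ (abs_pos.mpr ha), ← abs_mul]
    rw [show (y - (-(b * x) / a + 2 * ρ / a)) * a = lin a b x y - 2 * ρ by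
      unfold lin; field_simp; ring]
    rw [abs_le]; constructor <;> linarith
  refine (measure_mono hsub).trans_eq ?_
  rw [Real.volume_closedBall]
  congr 1; ring

end

/-- The size of `|D| ^ z` where `L₁ ∼ δ`, `L₂ ∼ R`, up to a constant. -/
noncomputable def ampl (m' e' : ℕ) (α R δ : ℝ) : ℝ := (δ ^ m' * R ^ e') ^ α

theorem ampl_nonneg {m' e' : ℕ} {α R δ : ℝ} (hR : 0 < R) (hδ : 0 < δ) : 0 ≤ ampl m' e' α R δ := by
  unfold ampl; positivity

theorem rpow_le_of_comparable {u w K α : ℝ} (hw : 0 < w) (hK : 1 ≤ K) (h1 : K⁻¹ * w ≤ u)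
    (h2 : u ≤ K * w) : u ^ α ≤ K ^ |α| * w ^ α := by
  have hK0 : 0 < K := by linarith
  have hu : 0 < u := lt_of_lt_of_le (by positivity) h1
  rcases le_total 0 α with h | h
  · rw [abs_of_nonneg h, ← Real.mul_rpow hK0.le hw.le]
    exact Real.rpow_le_rpow hu.le h2 h
  · rw [abs_of_nonpos h, Real.rpow_neg hK0.le, ← Real.inv_rpow hK0.le,
      ← Real.mul_rpow (by positivity) hw.le]
    exact Real.rpow_le_rpow_of_nonpos (by positivity) h1 h

namespace OneSided

variable {S P D : ℝ → ℝ → ℝ} {a₁ b₁ a₂ b₂ : ℝ} {m e m' e' : ℕ} {C : ℝ}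

theorem abs_damp_rpow_le (h : OneSided S P D a₁ b₁ a₂ b₂ m e m' e' C) (α : ℝ) {R δ x y : ℝ}
    (hδ : 0 < δ) (hδR : δ ≤ R) (hy : y ∈ cellSlice a₁ b₁ a₂ b₂ R δ x) :
    |D x y| ^ α ≤ (C * 4 ^ (m' + e')) ^ |α| * ampl m' e' α R δ := by
  have hR : 0 < R := by linarith
  have hy' : y ∈ sectorSlice a₁ b₁ a₂ b₂ 0 0 x :=
    mem_sectorSlice_of_mem_cellSlice hδR (by positivity) (by positivity) hy
  obtain ⟨h1, h2, h3, h4⟩ := hy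
  have hC := h.one_le
  have hC0 : 0 < C := by linarith
  refine rpow_le_of_comparable (by positivity) ?_ ?_ ?_
  · exact one_le_mul_of_one_le_of_one_le hC (one_le_pow₀ (by norm_num))
  · refine le_trans ?_ (h.damp_lower x y hy')
    have g1 : 0 ≤ lin a₁ b₁ x y := by linarith
    have g2 : 0 ≤ lin a₂ b₂ x y := by linarith
    calc (C * 4 ^ (m' + e'))⁻¹ * (δ ^ m' * R ^ e') = C⁻¹ * ((δ / 4) ^ m' * (R / 4) ^ e') := by
          rw [div_pow, div_pow, pow_add]; field_simp
      _ ≤ _ := by gcongr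
  · refine (h.damp_upper x y hy').trans ?_
    have g1 : 0 < lin a₁ b₁ x y := hy'.1
    have g2 : 0 < lin a₂ b₂ x y := hy'.2.1
    calc C * (lin a₁ b₁ x y ^ m' * lin a₂ b₂ x y ^ e') ≤ C * ((4 * δ) ^ m' * (4 * R) ^ e') :=
          mul_le_mul_of_nonneg_left (mul_le_mul (pow_le_pow_left₀ g1.le h2.le _)
            (pow_le_pow_left₀ g2.le h4.le _) (by positivity) (by positivity)) hC0.le
      _ = _ := by rw [mul_pow, mul_pow, pow_add]; ring

/-- The phase `S(x, ·) - S(x', ·)` of the product of two pieces: its derivative is the integral of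
`P` over the segment from `x'` to `x`, hence at least of the size of `|x - x'| |P|` at `x`, and each
further derivative costs the reciprocal of the smaller of the two scales. -/
theorem phase_difference (h : OneSided S P D a₁ b₁ a₂ b₂ m e m' e' C) {R δ R' δ' x x' : ℝ}
    (hδ : 0 < δ) (hδR : δ ≤ R) (hδ' : 0 < δ') (hδR' : δ' ≤ R') (hx : x ≠ x') :
    ∃ Φ1 Φ2 Φ3 : ℝ → ℝ, ∀ y ∈ cellSlice a₁ b₁ a₂ b₂ R δ x ∩ cellSlice a₁ b₁ a₂ b₂ R' δ' x',
      HasDerivAt (fun y => S x y - S x' y) (Φ1 y) y ∧ HasDerivAt Φ1 (Φ2 y) y ∧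
      HasDerivAt Φ2 (Φ3 y) y ∧
      |x - x'| * (δ ^ m * R ^ e) / (2 * C * 8 ^ (m + e)) ≤ |Φ1 y| ∧
      |Φ2 y| ≤ (4 * C / if a₁ = 0 then min R R' else min δ δ') * |Φ1 y| ∧
      |Φ3 y| ≤ (4 * C / if a₁ = 0 then min R R' else min δ δ') ^ 2 * |Φ1 y| := by
  have hR : 0 < R := by linarith
  have hR' : 0 < R' := by linarith
  have hC0 : 0 < C := by linarith [h.one_le]
  set t := min δ δ' / 4 with ht
  set s := min R R' / 4 with hs
  have htp : 0 < t := by positivity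
  have hsp : 0 < s := by positivity
  obtain ⟨S1, S2, S3, P1, P2, T⟩ := h.tower
  refine ⟨fun y => S1 x y - S1 x' y, fun y => S2 x y - S2 x' y, fun y => S3 x y - S3 x' y,
    fun y hy => ⟨(T x y).1.sub (T x' y).1, (T x y).2.1.sub (T x' y).2.1,
      (T x y).2.2.1.sub (T x' y).2.2.1, ?_⟩⟩
  obtain ⟨⟨p1, p2, p3, p4⟩, ⟨q1, q2, q3, q4⟩⟩ := hy
  have hmt : t ≤ δ / 4 := by rw [ht]; linarith [min_le_left δ δ']
  have hmt' : t ≤ δ' / 4 := by rw [ht]; linarith [min_le_right δ δ']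
  have hms : s ≤ R / 4 := by rw [hs]; linarith [min_le_left R R']
  have hms' : s ≤ R' / 4 := by rw [hs]; linarith [min_le_right R R']
  -- the horizontal segment from `x'` to `x` stays in the sector
  have hseg : ∀ τ ∈ Set.Icc (0 : ℝ) 1,
      y ∈ sectorSlice a₁ b₁ a₂ b₂ t s (x + τ * (x' - x)) := by
    intro τ ⟨h0, h1⟩
    have e1 : lin a₁ b₁ (x + τ * (x' - x)) y = (1 - τ) * lin a₁ b₁ x y + τ * lin a₁ b₁ x' y := by
      unfold lin; ring
    have e2 : lin a₂ b₂ (x + τ * (x' - x)) y = (1 - τ) * lin a₂ b₂ x y + τ * lin a₂ b₂ x' y := by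
      unfold lin; ring
    simp only [sectorSlice, Set.mem_ofPred_eq]
    rw [e1, e2]
    refine ⟨?_, ?_, ?_⟩ <;> rcases h0.eq_or_lt with rfl | h0' <;> nlinarith
  have huIcc : ∀ u ∈ Set.uIcc x x', y ∈ sectorSlice a₁ b₁ a₂ b₂ t s u := by
    intro u hu
    rw [← segment_eq_uIcc, segment_eq_image'] at hu
    obtain ⟨τ, hτ, rfl⟩ := hu
    simpa using hseg τ hτ
  have hopen : ∀ u, IsOpen (sectorSlice a₁ b₁ a₂ b₂ t s u) := fun u =>
    (isOpen_lt continuous_const (continuous_lin _ _ _)).inter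
      ((isOpen_lt continuous_const (continuous_lin _ _ _)).inter
        (isOpen_lt (continuous_lin _ _ _) (continuous_const.mul (continuous_lin _ _ _))))
  set κ := 4 * C / if a₁ = 0 then min R R' else min δ δ' with hκ
  have hκ' : (C / if a₁ = 0 then s else t) = κ := by
    rw [hκ, ht, hs]; split_ifs <;> field_simp
  have hrel : ∀ u ∈ Set.uIcc x x', P u y ≠ 0 ∧ |P1 u y| ≤ κ * |P u y| ∧
      |P2 u y| ≤ κ ^ 2 * |P u y| := by
    intro u hu
    obtain ⟨F1, F2, hF⟩ := h.phase_rel u t s htp hsp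
    have hmem := huIcc u hu
    obtain ⟨d1, d2, n0, n1, n2⟩ := hF y hmem
    have e1 : ∀ w ∈ sectorSlice a₁ b₁ a₂ b₂ t s u, F1 w = P1 u w := fun w hw =>
      (hF w hw).1.unique (T u w).2.2.2.2.2.2.1
    have e2 : F2 y = P2 u y := by
      refine d2.unique ((T u y).2.2.2.2.2.2.2.congr_of_eventuallyEq ?_)
      filter_upwards [(hopen u).mem_nhds hmem] with w hw using e1 w hw
    rw [← e1 y hmem, ← e2, ← hκ']
    exact ⟨n0, n1, n2⟩
  -- on the half of the segment next to `x` the phase is bounded below by its size at `x`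
  have hhalf : ∀ u ∈ Set.uIcc x ((x + x') / 2),
      (δ ^ m * R ^ e) / (C * 8 ^ (m + e)) ≤ |P u y| := by
    intro u hu
    rw [← segment_eq_uIcc, segment_eq_image'] at hu
    obtain ⟨τ, ⟨h0, h1⟩, rfl⟩ := hu
    have hu : x + τ • ((x + x') / 2 - x) = x + (τ / 2) * (x' - x) := by
      simp only [smul_eq_mul]; ring
    simp only [hu]
    obtain ⟨g1, g2, g3⟩ := hseg (τ / 2) ⟨by linarith, by linarith⟩
    have e1 : lin a₁ b₁ (x + τ / 2 * (x' - x)) y =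
        (1 - τ / 2) * lin a₁ b₁ x y + τ / 2 * lin a₁ b₁ x' y := by unfold lin; ring
    have e2 : lin a₂ b₂ (x + τ / 2 * (x' - x)) y =
        (1 - τ / 2) * lin a₂ b₂ x y + τ / 2 * lin a₂ b₂ x' y := by unfold lin; ring
    have l1 : δ / 8 ≤ lin a₁ b₁ (x + τ / 2 * (x' - x)) y := by rw [e1]; nlinarith
    have l2 : R / 8 ≤ lin a₂ b₂ (x + τ / 2 * (x' - x)) y := by rw [e2]; nlinarith
    have k1 : 0 ≤ lin a₁ b₁ (x + τ / 2 * (x' - x)) y := by linarith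
    have k2 : 0 ≤ lin a₂ b₂ (x + τ / 2 * (x' - x)) y := by linarith
    refine le_trans ?_ (h.phase_lower _ y ⟨by linarith, by linarith, g3⟩)
    calc (δ ^ m * R ^ e) / (C * 8 ^ (m + e)) = C⁻¹ * ((δ / 8) ^ m * (R / 8) ^ e) := by
          rw [div_pow, div_pow, pow_add]; field_simp
      _ ≤ _ := by gcongr
  have hfin : |x - x'| * (δ ^ m * R ^ e) / (2 * C * 8 ^ (m + e)) ≤ |S1 x y - S1 x' y| := by
    rw [show |x - x'| * (δ ^ m * R ^ e) / (2 * C * 8 ^ (m + e)) =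
      (δ ^ m * R ^ e) / (C * 8 ^ (m + e)) * (|x - x'| / 2) by field_simp]
    rcases lt_or_gt_of_ne hx with hlt | hlt
    · rw [Set.uIcc_of_le hlt.le] at hrel
      rw [Set.uIcc_of_le (by linarith)] at hhalf
      have := mul_sub_le_abs_sub (f := fun u => S1 u y) (p := fun u => P u y) (s := x) (t := x')
        (v := x) (w := (x + x') / 2) le_rfl (by linarith) (by linarith)
        (fun u _ => (T u y).2.2.2.1) (fun u hu => (hrel u hu).1) hhalf
      rw [abs_sub_comm, abs_sub_comm (S1 x y), abs_of_pos (by linarith : 0 < x' - x)]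
      convert this using 2; ring
    · rw [Set.uIcc_of_ge hlt.le] at hrel
      rw [Set.uIcc_of_ge (by linarith)] at hhalf
      have := mul_sub_le_abs_sub (f := fun u => S1 u y) (p := fun u => P u y) (s := x') (t := x)
        (v := (x + x') / 2) (w := x) (by linarith) (by linarith) le_rfl
        (fun u _ => (T u y).2.2.2.1) (fun u hu => (hrel u hu).1) hhalf
      rw [abs_of_pos (by linarith : 0 < x - x')]
      convert this using 2; ring
  refine ⟨hfin, ?_⟩
  rcases lt_or_gt_of_ne hx with hlt | hlt
  · rw [Set.uIcc_of_le hlt.le] at hrel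
    rw [abs_sub_comm (S2 x y), abs_sub_comm (S3 x y), abs_sub_comm (S1 x y)]
    exact ⟨abs_sub_le_of_deriv_le hlt (fun u _ => (T u y).2.2.2.1)
        (fun u _ => (T u y).2.2.2.2.1) (fun u hu => (hrel u hu).1) fun u hu => (hrel u hu).2.1,
      abs_sub_le_of_deriv_le hlt (fun u _ => (T u y).2.2.2.1)
        (fun u _ => (T u y).2.2.2.2.2.1) (fun u hu => (hrel u hu).1) fun u hu => (hrel u hu).2.2⟩
  · rw [Set.uIcc_of_ge hlt.le] at hrel
    exact ⟨abs_sub_le_of_deriv_le hlt (fun u _ => (T u y).2.2.2.1)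
        (fun u _ => (T u y).2.2.2.2.1) (fun u hu => (hrel u hu).1) fun u hu => (hrel u hu).2.1,
      abs_sub_le_of_deriv_le hlt (fun u _ => (T u y).2.2.2.1)
        (fun u _ => (T u y).2.2.2.2.2.1) (fun u hu => (hrel u hu).1) fun u hu => (hrel u hu).2.2⟩

/-- The amplitude of the product of two pieces at the same height `y`. -/
noncomputable def pairAmplitude (D : ℝ → ℝ → ℝ) (a₁ b₁ a₂ b₂ : ℝ) (z : ℂ)
    (R δ R' δ' x x' y : ℝ) : ℂ :=
  ((cell a₁ b₁ a₂ b₂ R δ x y : ℂ) * ((|D x y| : ℝ) : ℂ) ^ z) *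
    ((cell a₁ b₁ a₂ b₂ R' δ' x' y : ℂ) * conj (((|D x' y| : ℝ) : ℂ) ^ z))

theorem piece_mul_conj_piece (z : ℂ) (R δ R' δ' x x' y : ℝ) :
    piece S D a₁ b₁ a₂ b₂ z R δ x y * conj (piece S D a₁ b₁ a₂ b₂ z R' δ' x' y) =
      Complex.exp (Complex.I * ((S x y - S x' y : ℝ) : ℂ)) *
        pairAmplitude D a₁ b₁ a₂ b₂ z R δ R' δ' x x' y := by
  have hexp : Complex.exp (Complex.I * ((S x y - S x' y : ℝ) : ℂ)) =
      Complex.exp (Complex.I * (S x y : ℂ)) * Complex.exp (-Complex.I * (S x' y : ℂ)) := by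
    rw [← Complex.exp_add]; push_cast; ring_nf
  simp only [hexp, piece, kernel, pairAmplitude, map_mul, Complex.conj_ofReal,
    ← Complex.exp_conj, Complex.conj_I]
  ring

/-- The amplitude varies at the smaller of the two scales; the damping factor costs `1 + ‖z‖` for
each derivative. -/
theorem symOn_pairAmplitude (h : OneSided S P D a₁ b₁ a₂ b₂ m e m' e' C) (z : ℂ)
    {R δ R' δ' x x' : ℝ} (hδ : 0 < δ) (hδR : δ ≤ R) (hδ' : 0 < δ') (hδR' : δ' ≤ R') :
    SymOn (pairAmplitude D a₁ b₁ a₂ b₂ z R δ R' δ' x x')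
      (cellSlice a₁ b₁ a₂ b₂ R δ x ∩ cellSlice a₁ b₁ a₂ b₂ R' δ' x')
      (((C * 4 ^ (m' + e')) ^ |z.re|) ^ 2 * (ampl m' e' z.re R δ * ampl m' e' z.re R' δ'))
      ((8 * C + 2 * bumpConst * (|a₁| + |a₂|)) * (1 + ‖z‖) /
        if a₁ = 0 then min R R' else min δ δ') := by
  have hR : 0 < R := by linarith
  have hR' : 0 < R' := by linarith
  have hC0 : 0 < C := by linarith [h.one_le]
  have hb := bumpConst_pos
  set hh := if a₁ = 0 then min R R' else min δ δ' with hhh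
  have hhp : 0 < hh := by rw [hhh]; split_ifs <;> positivity
  set U := cellSlice a₁ b₁ a₂ b₂ R δ x ∩ cellSlice a₁ b₁ a₂ b₂ R' δ' x' with hU
  have hUo : IsOpen U := isOpen_cellSlice.inter isOpen_cellSlice
  have hcell : ∀ {R δ x : ℝ}, 0 < δ → δ ≤ R → hh ≤ (if a₁ = 0 then R else δ) →
      SymOn (fun y => (cell a₁ b₁ a₂ b₂ R δ x y : ℂ)) U 1 (bumpConst * (|a₁| + |a₂|) / hh) := by
    intro R δ x hδ hδR hle
    have hR : 0 < R := by linarith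
    refine (symOn_cell hR hδ U).mono subset_rfl le_rfl (by positivity) ?_
    have e2 : bumpConst * |a₂| / R ≤ bumpConst * |a₂| / hh := by
      gcongr
      refine hle.trans ?_
      split_ifs
      · exact le_rfl
      · exact hδR
    have e1 : bumpConst * |a₁| / δ ≤ bumpConst * |a₁| / hh := by
      split_ifs at hle with ha
      · simp [ha]
      · gcongr
    calc _ ≤ bumpConst * |a₂| / hh + bumpConst * |a₁| / hh := add_le_add e2 e1
      _ = _ := by ring
  have hdamp : ∀ {R δ x : ℝ}, 0 < δ → δ ≤ R → hh ≤ (if a₁ = 0 then R else δ) →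
      U ⊆ cellSlice a₁ b₁ a₂ b₂ R δ x →
      SymOn (fun y => ((|D x y| : ℝ) : ℂ) ^ z) U
        ((C * 4 ^ (m' + e')) ^ |z.re| * ampl m' e' z.re R δ) ((1 + ‖z‖) * (4 * C / hh)) := by
    intro R δ x hδ hδR hle hsub
    have hrel := h.damp_rel x (δ / 4) (R / 4) (by positivity) (by linarith)
    have hp : 0 < if a₁ = 0 then R / 4 else δ / 4 := by split_ifs <;> linarith
    have hrel' : RelOn (D x) U (4 * C / hh) := by
      refine hrel.mono (fun y hy => mem_sectorSlice_of_mem_cellSlice hδR le_rfl le_rfl (hsub hy))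
        (by positivity) ?_
      rw [div_le_div_iff₀ hp hhp]
      split_ifs at hle ⊢ <;> nlinarith
    exact hrel'.symOn_cpow hUo (by positivity) z
      fun y hy => h.abs_damp_rpow_le z.re hδ hδR (hsub hy)
  have l1 : hh ≤ if a₁ = 0 then R else δ := by
    rw [hhh]; split_ifs
    · exact min_le_left _ _
    · exact min_le_left _ _
  have l2 : hh ≤ if a₁ = 0 then R' else δ' := by
    rw [hhh]; split_ifs
    · exact min_le_right _ _
    · exact min_le_right _ _
  have s1 := (hcell (x := x) hδ hδR l1).mul (hdamp hδ hδR l1 Set.inter_subset_left) (by positivity)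
  have s2 := (hcell (x := x') hδ' hδR' l2).mul
    (hdamp hδ' hδR' l2 Set.inter_subset_right).conj (by positivity)
  refine (s1.mul s2 (by positivity)).mono subset_rfl (le_of_eq (by ring)) (by positivity) ?_
  have : 0 ≤ bumpConst * (|a₁| + |a₂|) * ‖z‖ / hh := by positivity
  calc _ = (2 * bumpConst * (|a₁| + |a₂|) + 8 * C * (1 + ‖z‖)) / hh := by ring
    _ ≤ _ := by
      gcongr
      have : 0 ≤ bumpConst * (|a₁| + |a₂|) * ‖z‖ := by positivity
      nlinarith

theorem volume_pair_slice_le (h : OneSided S P D a₁ b₁ a₂ b₂ m e m' e' C)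
    {R δ R' δ' x x' : ℝ} (hδ : 0 < δ) (hδR : δ ≤ R) (hδ' : 0 < δ') (hδR' : δ' ≤ R') :
    volume (cellSlice a₁ b₁ a₂ b₂ R δ x ∩ cellSlice a₁ b₁ a₂ b₂ R' δ' x') ≤
      ENNReal.ofReal (4 / |if a₁ = 0 then a₂ else a₁| *
        if a₁ = 0 then min R R' else min δ δ') := by
  have hdet := h.det_ne
  split_ifs with ha
  · have ha2 : a₂ ≠ 0 := by rintro rfl; simp [ha] at hdet
    rw [div_mul_eq_mul_div]
    rcases min_choice R R' with hm | hm <;> rw [hm]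
    · exact volume_lin_slice_le ha2 fun y hy =>
        ⟨by linarith [hy.1.2.2.1], hy.1.2.2.2⟩
    · exact volume_lin_slice_le ha2 fun y hy =>
        ⟨by linarith [hy.2.2.2.1], hy.2.2.2.2⟩
  · rw [div_mul_eq_mul_div]
    rcases min_choice δ δ' with hm | hm <;> rw [hm]
    · exact volume_lin_slice_le ha fun y hy => ⟨by linarith [hy.1.1], hy.1.2.1⟩
    · exact volume_lin_slice_le ha fun y hy => ⟨by linarith [hy.2.1], hy.2.2.1⟩

/-- The kernel of the product of one piece with the adjoint of another: the trivial bound, and the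
gain from oscillation. -/
theorem exists_pair_kernel_bound (h : OneSided S P D a₁ b₁ a₂ b₂ m e m' e' C) (α : ℝ) :
    ∃ B : ℝ, 0 < B ∧ ∀ z : ℂ, z.re = α → ∀ R δ R' δ' x x' : ℝ, 0 < δ → δ ≤ R → 0 < δ' →
      δ' ≤ R' →
      ‖∫ y, piece S D a₁ b₁ a₂ b₂ z R δ x y * conj (piece S D a₁ b₁ a₂ b₂ z R' δ' x' y)‖ ≤
        B * (ampl m' e' α R δ * ampl m' e' α R' δ') *
          (if a₁ = 0 then min R R' else min δ δ') ∧
      (x ≠ x' →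
      ‖∫ y, piece S D a₁ b₁ a₂ b₂ z R δ x y * conj (piece S D a₁ b₁ a₂ b₂ z R' δ' x' y)‖ ≤
        B * (ampl m' e' α R δ * ampl m' e' α R' δ') *
          (if a₁ = 0 then min R R' else min δ δ') *
          ((1 + ‖z‖) / ((if a₁ = 0 then min R R' else min δ δ') * |x - x'| *
            (δ ^ m * R ^ e))) ^ 2) := by
  have hC0 : 0 < C := by linarith [h.one_le]
  have hb := bumpConst_pos
  have hdet := h.det_ne
  set ℓ := 4 / |if a₁ = 0 then a₂ else a₁| with hℓ
  have hℓ0 : 0 < ℓ := by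
    rw [hℓ]
    have : (if a₁ = 0 then a₂ else a₁) ≠ 0 := by
      split_ifs with ha
      · rintro rfl; simp [ha] at hdet
      · exact ha
    positivity
  set Ca := ((C * 4 ^ (m' + e')) ^ |α|) ^ 2 with hCa
  have hCa0 : 0 < Ca := by positivity
  set N := (4 * C + (8 * C + 2 * bumpConst * (|a₁| + |a₂|))) * (2 * C * 8 ^ (m + e)) with hN
  refine ⟨Ca * ℓ * (1 + 4 * N ^ 2), by positivity, ?_⟩
  intro z hz R δ R' δ' x x' hδ hδR hδ' hδR'
  have hR : 0 < R := by linarith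
  have hR' : 0 < R' := by linarith
  set hh := if a₁ = 0 then min R R' else min δ δ' with hhh
  have hhp : 0 < hh := by rw [hhh]; split_ifs <;> positivity
  set U := cellSlice a₁ b₁ a₂ b₂ R δ x ∩ cellSlice a₁ b₁ a₂ b₂ R' δ' x' with hU
  have hUo : IsOpen U := isOpen_cellSlice.inter isOpen_cellSlice
  set A := pairAmplitude D a₁ b₁ a₂ b₂ z R δ R' δ' x x' with hA
  have hsym := h.symOn_pairAmplitude z (x := x) (x' := x') hδ hδR hδ' hδR'
  have hvol := h.volume_pair_slice_le (x := x) (x' := x') hδ hδR hδ' hδR'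
  rw [hz, ← hCa, ← hhh, ← hU, ← hA] at hsym
  rw [← hhh, ← hU, ← hℓ] at hvol
  set ww := ampl m' e' α R δ * ampl m' e' α R' δ' with hww
  have hww0 : 0 ≤ ww := mul_nonneg (ampl_nonneg hR hδ) (ampl_nonneg hR' hδ')
  have hsupp : ∀ y ∉ U, A =ᶠ[𝓝 y] 0 := by
    intro y hy
    by_cases h1 : y ∈ cellSlice a₁ b₁ a₂ b₂ R δ x
    · filter_upwards [cell_eventually_eq_zero hR' hδ' fun h2 => hy ⟨h1, h2⟩] with w hw
      simp [hA, pairAmplitude, hw]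
    · filter_upwards [cell_eventually_eq_zero hR hδ h1] with w hw
      simp [hA, pairAmplitude, hw]
  simp only [piece_mul_conj_piece, ← hA]
  have hE : ∀ y, ‖Complex.exp (Complex.I * ((S x y - S x' y : ℝ) : ℂ))‖ = 1 := fun y => by
    rw [mul_comm, Complex.norm_exp_ofReal_mul_I]
  constructor
  · have h0 : ∀ y ∉ U, Complex.exp (Complex.I * ((S x y - S x' y : ℝ) : ℂ)) * A y = 0 := by
      intro y hy
      have : A y = 0 := by simpa using (hsupp y hy).self_of_nhds
      rw [this, mul_zero]
    rw [← setIntegral_eq_integral_of_forall_compl_eq_zero h0]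
    refine (norm_setIntegral_le_of_norm_le_const (hvol.trans_lt ENNReal.ofReal_lt_top)
      (C := Ca * ww) fun y hy => ?_).trans ?_
    · rw [norm_mul, hE, one_mul]
      obtain ⟨f1, f2, hf⟩ := hsym
      exact (hf y hy).2.2.1
    · have hv : volume.real U ≤ ℓ * hh := ENNReal.toReal_le_of_le_ofReal (by positivity) hvol
      calc Ca * ww * volume.real U ≤ Ca * ww * (ℓ * hh) := by gcongr
        _ = Ca * ℓ * (1 + 0) * ww * hh := by ring
        _ ≤ Ca * ℓ * (1 + 4 * N ^ 2) * ww * hh := by gcongr; positivity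
  · intro hx
    obtain ⟨Φ1, Φ2, Φ3, hΦ⟩ := h.phase_difference hδ hδR hδ' hδR' hx
    have hxp : 0 < |x - x'| := abs_pos.mpr (sub_ne_zero.mpr hx)
    have hosc := norm_integral_exp_mul_le (ℓ := ℓ * hh) hUo
      (Λ := |x - x'| * (δ ^ m * R ^ e) / (2 * C * 8 ^ (m + e))) (by positivity)
      (κ := 4 * C / hh) (by positivity) (by positivity) (by positivity) (by positivity)
      hΦ hsym hsupp hvol
    refine hosc.trans ?_
    have hle : (4 * C / hh + (8 * C + 2 * bumpConst * (|a₁| + |a₂|)) * (1 + ‖z‖) / hh) /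
        (|x - x'| * (δ ^ m * R ^ e) / (2 * C * 8 ^ (m + e))) ≤
        N * ((1 + ‖z‖) / (hh * |x - x'| * (δ ^ m * R ^ e))) := by
      have hz0 : 0 ≤ 4 * C * ‖z‖ := by positivity
      calc _ ≤ (4 * C * (1 + ‖z‖) / hh +
            (8 * C + 2 * bumpConst * (|a₁| + |a₂|)) * (1 + ‖z‖) / hh) /
            (|x - x'| * (δ ^ m * R ^ e) / (2 * C * 8 ^ (m + e))) := by
            have q : 4 * C / hh ≤ 4 * C * (1 + ‖z‖) / hh := by
              rw [div_le_div_iff_of_pos_right hhp]; linarith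
            exact div_le_div_of_nonneg_right (add_le_add q le_rfl) (by positivity)
        _ = _ := by rw [hN]; field_simp
    calc 4 * (Ca * ww) * ((4 * C / hh + (8 * C + 2 * bumpConst * (|a₁| + |a₂|)) * (1 + ‖z‖) / hh) /
            (|x - x'| * (δ ^ m * R ^ e) / (2 * C * 8 ^ (m + e)))) ^ 2 * (ℓ * hh)
        ≤ 4 * (Ca * ww) * (N * ((1 + ‖z‖) / (hh * |x - x'| * (δ ^ m * R ^ e)))) ^ 2 *
            (ℓ * hh) := by gcongr
      _ = Ca * ℓ * (0 + 4 * N ^ 2) * ww * hh *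
            ((1 + ‖z‖) / (hh * |x - x'| * (δ ^ m * R ^ e))) ^ 2 := by ring
      _ ≤ _ := by gcongr; norm_num

end OneSided

end DampedOIO

namespace DampedOIO

open scoped Topology ComplexConjugate ENNReal

/-! ### Norms of pieces and of their products -/

theorem lintegral_enorm_le_of_support {f : ℝ → ℂ} {B X : ℝ} (hB : 0 ≤ B)
    (h : ∀ y, ‖f y‖ ≤ B) {U : Set ℝ} (hU : ∀ y, f y ≠ 0 → y ∈ U)
    (hv : volume U ≤ ENNReal.ofReal X) : ∫⁻ y, ‖f y‖ₑ ≤ ENNReal.ofReal (B * X) := by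
  have hsub : Function.support (fun y => ‖f y‖ₑ) ⊆ toMeasurable volume U := fun y hy =>
    subset_toMeasurable _ _ (hU y (by simpa using hy))
  rw [← setLIntegral_eq_of_support_subset hsub]
  calc ∫⁻ y in toMeasurable volume U, ‖f y‖ₑ
      ≤ ∫⁻ _y in toMeasurable volume U, ENNReal.ofReal B := by
        refine lintegral_mono fun y => ?_
        rw [← ofReal_norm]
        exact ENNReal.ofReal_le_ofReal (h y)
    _ = ENNReal.ofReal B * volume U := by simp
    _ ≤ ENNReal.ofReal B * ENNReal.ofReal X := by gcongr
    _ = _ := (ENNReal.ofReal_mul hB).symm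

theorem norm_kerOp_le_of_support {K : ℝ → ℝ → ℂ} (hK : NiceKernel K) {B X Y : ℝ} (hB : 0 ≤ B)
    (hX0 : 0 ≤ X) (hY0 : 0 ≤ Y) (h : ∀ x y, ‖K x y‖ ≤ B)
    (hX : ∀ x, ∃ U, (∀ y, K x y ≠ 0 → y ∈ U) ∧ volume U ≤ ENNReal.ofReal X)
    (hY : ∀ y, ∃ U, (∀ x, K x y ≠ 0 → x ∈ U) ∧ volume U ≤ ENNReal.ofReal Y) :
    ‖kerOp K‖ ≤ B * Real.sqrt (X * Y) := by
  have h1 := norm_kerOp_le hK (X := B * X) (Y := B * Y) (by positivity) (by positivity)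
    (.of_forall fun x => by
      obtain ⟨U, hU, hv⟩ := hX x
      exact lintegral_enorm_le_of_support hB (h x) hU hv)
    (.of_forall fun y => by
      obtain ⟨U, hU, hv⟩ := hY y
      exact lintegral_enorm_le_of_support hB (fun x => h x y) hU hv)
  rwa [show B * X * (B * Y) = B ^ 2 * (X * Y) by ring, Real.sqrt_mul (by positivity),
    Real.sqrt_sq hB] at h1

theorem norm_kerOp_le_of_decay {K : ℝ → ℝ → ℂ} (hK : NiceKernel K) {B w : ℝ} (hB : 0 ≤ B)
    (hw : 0 < w) (h : ∀ x y, ‖K x y‖ ≤ B) (h2 : ∀ x y, x ≠ y → ‖K x y‖ ≤ B * (w / |x - y|) ^ 2) :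
    ‖kerOp K‖ ≤ 2 * Real.pi * B * w := by
  have hle : ∀ x y, ‖K x y‖ ≤ 2 * B * (1 + (w⁻¹ * (x - y)) ^ 2)⁻¹ := by
    intro x y
    rw [← div_eq_mul_inv, le_div_iff₀ (by positivity)]
    by_cases hxy : x = y
    · subst hxy
      have := h x x
      simp only [sub_self, mul_zero, ne_eq, OfNat.ofNat_ne_zero, not_false_eq_true, zero_pow,
        add_zero, mul_one]
      linarith
    · have hp : 0 < |x - y| := abs_pos.mpr (sub_ne_zero.mpr hxy)
      have e1 := h x y
      have e2 := h2 x y hxy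
      have e3 : (w⁻¹ * (x - y)) ^ 2 * (w / |x - y|) ^ 2 = 1 := by
        rw [← sq_abs (w⁻¹ * (x - y)), abs_mul, abs_inv, abs_of_pos hw]
        field_simp
      calc ‖K x y‖ * (1 + (w⁻¹ * (x - y)) ^ 2)
          = ‖K x y‖ + ‖K x y‖ * (w⁻¹ * (x - y)) ^ 2 := by ring
        _ ≤ B + B * (w / |x - y|) ^ 2 * (w⁻¹ * (x - y)) ^ 2 := by gcongr
        _ = B + B * ((w⁻¹ * (x - y)) ^ 2 * (w / |x - y|) ^ 2) := by ring
        _ = 2 * B := by rw [e3]; ring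
  have hint : ∀ f : ℝ → ℂ, (∃ x, ∀ y, ‖f y‖ ≤ 2 * B * (1 + (w⁻¹ * (x - y)) ^ 2)⁻¹) →
      ∫⁻ y, ‖f y‖ₑ ≤ ENNReal.ofReal (2 * Real.pi * B * w) := by
    rintro f ⟨x, hf⟩
    have hI : Integrable fun t : ℝ => (1 + (w⁻¹ * t) ^ 2)⁻¹ :=
      integrable_inv_one_add_sq.comp_mul_left' (inv_ne_zero hw.ne')
    have hI2 : Integrable fun y : ℝ => 2 * B * (1 + (w⁻¹ * (x - y)) ^ 2)⁻¹ :=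
      (hI.comp_sub_left x).const_mul (2 * B)
    calc ∫⁻ y, ‖f y‖ₑ ≤ ∫⁻ y, ENNReal.ofReal (2 * B * (1 + (w⁻¹ * (x - y)) ^ 2)⁻¹) := by
          refine lintegral_mono fun y => ?_
          rw [← ofReal_norm]
          exact ENNReal.ofReal_le_ofReal (hf y)
      _ = ENNReal.ofReal (∫ y, 2 * B * (1 + (w⁻¹ * (x - y)) ^ 2)⁻¹) :=
          (ofReal_integral_eq_lintegral_ofReal hI2 (.of_forall fun y => by
            show 0 ≤ 2 * B * (1 + (w⁻¹ * (x - y)) ^ 2)⁻¹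
            positivity)).symm
      _ = _ := by
          rw [integral_const_mul, integral_sub_left_eq_self
            (fun t : ℝ => (1 + (w⁻¹ * t) ^ 2)⁻¹) volume x,
            Measure.integral_comp_mul_left (fun t : ℝ => (1 + t ^ 2)⁻¹),
            integral_univ_inv_one_add_sq, inv_inv, abs_of_pos hw, smul_eq_mul]
          congr 1; ring
  have := norm_kerOp_le hK (X := 2 * Real.pi * B * w) (Y := 2 * Real.pi * B * w)
    (by positivity) (by positivity) (.of_forall fun x => hint _ ⟨x, hle x⟩)
    (.of_forall fun y => hint _ ⟨y, fun x => by
      have := hle x y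
      rwa [show (w⁻¹ * (x - y)) ^ 2 = (w⁻¹ * (y - x)) ^ 2 by ring] at this⟩)
  rwa [Real.sqrt_mul_self (by positivity)] at this

/-- `OneSided`, together with continuity and the geometry of the half-sector: away from the
`x`-axis its points satisfy `|y| ∼ L₂`, and a bounding line transverse to both axes carries a
positive power of `L₁`. -/
structure HalfSector (S P D : ℝ → ℝ → ℝ) (a₁ b₁ a₂ b₂ : ℝ) (m e m' e' : ℕ) (C : ℝ) : Prop
    extends OneSided S P D a₁ b₁ a₂ b₂ m e m' e' C where
  cont_phase : Continuous (Function.uncurry S)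
  cont_damp : Continuous (Function.uncurry D)
  height : b₁ ≠ 0 → ∀ x y, y ∈ sectorSlice a₁ b₁ a₂ b₂ 0 0 x →
    C⁻¹ * lin a₂ b₂ x y ≤ |y| ∧ |y| ≤ C * lin a₂ b₂ x y
  slanted : a₁ ≠ 0 → b₁ ≠ 0 → 1 ≤ m

theorem measurable_kernel {S D : ℝ → ℝ → ℝ} (hS : Continuous (Function.uncurry S))
    (hD : Continuous (Function.uncurry D)) (z : ℂ) :
    Measurable (Function.uncurry (kernel S D z)) := by
  refine Measurable.mul ?_ ?_
  · refine Complex.measurable_exp.comp (measurable_const.mul ?_)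
    exact Complex.measurable_ofReal.comp hS.measurable
  · exact (Complex.measurable_ofReal.comp (hD.measurable.abs)).pow_const z

theorem continuous_uncurry_lin (a b : ℝ) : Continuous (Function.uncurry (lin a b)) := by
  have : Function.uncurry (lin a b) = fun p : ℝ × ℝ => a * p.2 + b * p.1 := rfl
  rw [this]; fun_prop

theorem continuous_bump : Continuous bump := contDiff_bump.continuous

theorem continuous_uncurry_cell (a₁ b₁ a₂ b₂ R δ : ℝ) :
    Continuous (Function.uncurry (cell a₁ b₁ a₂ b₂ R δ)) := by
  have h1 := continuous_bump.comp ((continuous_uncurry_lin a₁ b₁).div_const δ)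
  have h2 := continuous_bump.comp ((continuous_uncurry_lin a₂ b₂).div_const R)
  exact h2.mul h1

theorem norm_kernel_of_ne {S D : ℝ → ℝ → ℝ} {z : ℂ} {x y : ℝ} (h : D x y ≠ 0) :
    ‖kernel S D z x y‖ = |D x y| ^ z.re := by
  rw [kernel, norm_mul, mul_comm Complex.I, Complex.norm_exp_ofReal_mul_I, one_mul,
    Complex.norm_cpow_eq_rpow_re_of_pos (abs_pos.mpr h)]

theorem cell_nonneg (a₁ b₁ a₂ b₂ R δ x y : ℝ) : 0 ≤ cell a₁ b₁ a₂ b₂ R δ x y :=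
  mul_nonneg (bump_nonneg _) (bump_nonneg _)

theorem cell_le_one (a₁ b₁ a₂ b₂ R δ x y : ℝ) : cell a₁ b₁ a₂ b₂ R δ x y ≤ 1 :=
  mul_le_one₀ (bump_le_one _) (bump_nonneg _) (bump_le_one _)

/-- The length of the sections of the cell `L₁ = a y + b x ∼ δ`, `L₂ ∼ R` in the direction in
which `L₁` has slope `a`. -/
noncomputable def secLen (a R δ : ℝ) : ℝ := if a = 0 then R else δ

theorem secLen_pos {a R δ : ℝ} (hR : 0 < R) (hδ : 0 < δ) : 0 < secLen a R δ := by
  unfold secLen; split_ifs <;> assumption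

/-- The oscillatory bound for the norm of a piece, up to constants and the dependence on `z`. -/
noncomputable def oscSize (m e m' e' : ℕ) (α R δ : ℝ) : ℝ :=
  ampl m' e' α R δ / Real.sqrt (δ ^ m * R ^ e)

/-- The trivial bound for the norm of a piece, up to constants. -/
noncomputable def trivSize (a₁ b₁ : ℝ) (m' e' : ℕ) (α R δ : ℝ) : ℝ :=
  ampl m' e' α R δ * Real.sqrt (secLen a₁ R δ * secLen b₁ R δ)

/-- How far apart two pairs of scales are. -/
noncomputable def scaleRatio (R δ R' δ' : ℝ) : ℝ := min (δ / δ') (δ' / δ) * min (R / R') (R' / R)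

namespace HalfSector

variable {S P D : ℝ → ℝ → ℝ} {a₁ b₁ a₂ b₂ : ℝ} {m e m' e' : ℕ} {C : ℝ}

theorem piece_ne_zero {z : ℂ} {R δ x y : ℝ} (hδ : 0 < δ) (hδR : δ ≤ R)
    (h : piece S D a₁ b₁ a₂ b₂ z R δ x y ≠ 0) : y ∈ cellSlice a₁ b₁ a₂ b₂ R δ x := by
  refine mem_cellSlice_of_cell_ne_zero (by linarith) hδ fun h0 => h ?_
  simp [piece, h0]

theorem norm_piece_le (h : OneSided S P D a₁ b₁ a₂ b₂ m e m' e' C) (z : ℂ) {R δ : ℝ} (hδ : 0 < δ)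
    (hδR : δ ≤ R) (x y : ℝ) :
    ‖piece S D a₁ b₁ a₂ b₂ z R δ x y‖ ≤
      (C * 4 ^ (m' + e')) ^ |z.re| * ampl m' e' z.re R δ := by
  have hC0 : 0 < C := by linarith [h.one_le]
  have hR : 0 < R := by linarith
  by_cases h0 : piece S D a₁ b₁ a₂ b₂ z R δ x y = 0
  · rw [h0, norm_zero]
    exact mul_nonneg (by positivity) (ampl_nonneg hR hδ)
  · have hy := piece_ne_zero hδ hδR h0
    have hlow := h.damp_lower x y
      (mem_sectorSlice_of_mem_cellSlice hδR (by positivity) (by positivity) hy)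
    have hD : D x y ≠ 0 := by
      have l1 : 0 < lin a₁ b₁ x y := by linarith [hy.1]
      have l2 : 0 < lin a₂ b₂ x y := by linarith [hy.2.2.1]
      rw [← abs_pos]
      exact lt_of_lt_of_le (by positivity) hlow
    rw [piece, norm_mul, norm_kernel_of_ne hD, Complex.norm_real, Real.norm_eq_abs,
      abs_of_nonneg (cell_nonneg ..)]
    calc _ ≤ |D x y| ^ z.re * 1 := by gcongr; exact cell_le_one ..
      _ ≤ _ := by rw [mul_one]; exact h.abs_damp_rpow_le z.re hδ hδR hy

theorem niceKernel_piece (h : HalfSector S P D a₁ b₁ a₂ b₂ m e m' e' C) (z : ℂ) {R δ : ℝ}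
    (hδ : 0 < δ) (hδR : δ ≤ R) : NiceKernel (piece S D a₁ b₁ a₂ b₂ z R δ) := by
  have hC0 : 0 < C := by linarith [h.one_le]
  have hR : 0 < R := by linarith
  have hdet := abs_pos.mpr h.det_ne
  refine ⟨(measurable_kernel h.cont_phase h.cont_damp z).mul
    (Complex.measurable_ofReal.comp (continuous_uncurry_cell ..).measurable), ?_⟩
  set B := (C * 4 ^ (m' + e')) ^ |z.re| * ampl m' e' z.re R δ with hB
  have hB0 : 0 ≤ B := mul_nonneg (by positivity) (ampl_nonneg hR hδ)
  set Q := (4 * R * (|a₁| + |a₂| + |b₁| + |b₂|)) / |a₁ * b₂ - a₂ * b₁| with hQ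
  have hQ0 : 0 ≤ Q := by positivity
  refine ⟨B + Q, by positivity, fun x y => ?_, fun x y hne => ?_⟩
  · exact (norm_piece_le h.toOneSided z hδ hδR x y).trans (by linarith)
  · obtain ⟨l1, l2, l3, l4⟩ := piece_ne_zero hδ hδR hne
    have q1 : |lin a₁ b₁ x y| ≤ 4 * R := by rw [abs_of_pos (by linarith)]; linarith
    have q2 : |lin a₂ b₂ x y| ≤ 4 * R := by rw [abs_of_pos (by linarith)]; linarith
    have key : ∀ u p q : ℝ, u * (a₁ * b₂ - a₂ * b₁) = p * lin a₁ b₁ x y + q * lin a₂ b₂ x y →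
        |p| + |q| ≤ |a₁| + |a₂| + |b₁| + |b₂| → |u| ≤ B + Q := by
      intro u p q hu hpq
      have : |u| ≤ Q := by
        rw [hQ, le_div_iff₀ hdet, ← abs_mul, hu]
        calc |p * lin a₁ b₁ x y + q * lin a₂ b₂ x y| ≤ |p| * (4 * R) + |q| * (4 * R) := by
              refine (abs_add_le _ _).trans ?_
              rw [abs_mul, abs_mul]; gcongr
          _ = 4 * R * (|p| + |q|) := by ring
          _ ≤ _ := by gcongr
      linarith
    constructor
    · refine key x (-a₂) a₁ (by unfold lin; ring) ?_
      rw [abs_neg]; linarith [abs_nonneg b₁, abs_nonneg b₂]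
    · refine key y b₂ (-b₁) (by unfold lin; ring) ?_
      rw [abs_neg]; linarith [abs_nonneg a₁, abs_nonneg a₂]

theorem volume_section_le (hdet : a₁ * b₂ - a₂ * b₁ ≠ 0) {R δ : ℝ} (hδ : 0 < δ) (hδR : δ ≤ R)
    (x : ℝ) : volume (cellSlice a₁ b₁ a₂ b₂ R δ x) ≤
      ENNReal.ofReal (4 / |if a₁ = 0 then a₂ else a₁| * secLen a₁ R δ) := by
  unfold secLen
  split_ifs with ha
  · have ha2 : a₂ ≠ 0 := by rintro rfl; simp [ha] at hdet
    rw [div_mul_eq_mul_div]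
    exact volume_lin_slice_le ha2 fun y hy => ⟨by linarith [hy.2.2.1], hy.2.2.2⟩
  · rw [div_mul_eq_mul_div]
    exact volume_lin_slice_le ha fun y hy => ⟨by linarith [hy.1], hy.2.1⟩

theorem lin_swap (a b x y : ℝ) : lin a b x y = lin b a y x := by unfold lin; ring

theorem cellSlice_swap {R δ x y : ℝ} :
    y ∈ cellSlice a₁ b₁ a₂ b₂ R δ x ↔ x ∈ cellSlice b₁ a₁ b₂ a₂ R δ y := by
  simp only [cellSlice, Set.mem_ofPred_eq, lin_swap a₁ b₁ x y, lin_swap a₂ b₂ x y]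

/-- The trivial bound for the norm of a piece. -/
theorem exists_norm_le_trivSize (h : HalfSector S P D a₁ b₁ a₂ b₂ m e m' e' C) (α : ℝ) :
    ∃ B : ℝ, 0 < B ∧ ∀ z : ℂ, z.re = α → ∀ R δ : ℝ, 0 < δ → δ ≤ R →
      ‖kerOp (piece S D a₁ b₁ a₂ b₂ z R δ)‖ ≤ B * trivSize a₁ b₁ m' e' α R δ := by
  have hC0 : 0 < C := by linarith [h.one_le]
  have hdet := h.det_ne
  set Y := 4 / |if a₁ = 0 then a₂ else a₁| with hY
  set X := 4 / |if b₁ = 0 then b₂ else b₁| with hX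
  have hY0 : 0 < Y := by
    have : (if a₁ = 0 then a₂ else a₁) ≠ 0 := by
      split_ifs with ha
      · rintro rfl; simp [ha] at hdet
      · exact ha
    positivity
  have hX0 : 0 < X := by
    have : (if b₁ = 0 then b₂ else b₁) ≠ 0 := by
      split_ifs with ha
      · rintro rfl; simp [ha] at hdet
      · exact ha
    positivity
  refine ⟨(C * 4 ^ (m' + e')) ^ |α| * Real.sqrt (Y * X), by positivity, ?_⟩
  intro z hz R δ hδ hδR
  have hR : 0 < R := by linarith
  have e1 := secLen_pos (a := a₁) hR hδ
  have e2 := secLen_pos (a := b₁) hR hδ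
  have e3 := ampl_nonneg (m' := m') (e' := e') (α := α) hR hδ
  have := norm_kerOp_le_of_support (h.niceKernel_piece z hδ hδR)
    (B := (C * 4 ^ (m' + e')) ^ |α| * ampl m' e' α R δ) (X := Y * secLen a₁ R δ)
    (Y := X * secLen b₁ R δ) (by positivity) (by positivity) (by positivity)
    (fun x y => by simpa only [hz] using norm_piece_le h.toOneSided z hδ hδR x y)
    (fun x => ⟨_, fun y hy => piece_ne_zero hδ hδR hy, volume_section_le hdet hδ hδR x⟩)
    (fun y => ⟨_, fun x hx => cellSlice_swap.mp (piece_ne_zero hδ hδR hx),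
      volume_section_le (fun h0 => hdet (by linarith)) hδ hδR y⟩)
  refine this.trans_eq ?_
  rw [trivSize, show Y * secLen a₁ R δ * (X * secLen b₁ R δ) =
    Y * X * (secLen a₁ R δ * secLen b₁ R δ) by ring, Real.sqrt_mul (by positivity)]
  ring

theorem kerOp_mul_star (h : HalfSector S P D a₁ b₁ a₂ b₂ m e m' e' C) (z : ℂ) {R δ R' δ' : ℝ}
    (hδ : 0 < δ) (hδR : δ ≤ R) (hδ' : 0 < δ') (hδR' : δ' ≤ R') :
    NiceKernel (fun x x' => ∫ y, piece S D a₁ b₁ a₂ b₂ z R δ x y *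
      conj (piece S D a₁ b₁ a₂ b₂ z R' δ' x' y)) ∧
    kerOp (piece S D a₁ b₁ a₂ b₂ z R δ) * star (kerOp (piece S D a₁ b₁ a₂ b₂ z R' δ')) =
      kerOp (fun x x' => ∫ y, piece S D a₁ b₁ a₂ b₂ z R δ x y *
        conj (piece S D a₁ b₁ a₂ b₂ z R' δ' x' y)) := by
  have h1 := h.niceKernel_piece z hδ hδR
  have h2 := h.niceKernel_piece z hδ' hδR'
  rw [star_kerOp h2, kerOp_mul h1 h2.swap.starKernel]
  exact ⟨h1.comp h2.swap.starKernel, rfl⟩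

/-- The oscillatory bound for the norm of a piece. -/
theorem exists_norm_sq_le_oscSize (h : HalfSector S P D a₁ b₁ a₂ b₂ m e m' e' C) (α : ℝ) :
    ∃ B : ℝ, 0 < B ∧ ∀ z : ℂ, z.re = α → ∀ R δ : ℝ, 0 < δ → δ ≤ R →
      ‖kerOp (piece S D a₁ b₁ a₂ b₂ z R δ)‖ ^ 2 ≤
        B * (1 + ‖z‖) * oscSize m e m' e' α R δ ^ 2 := by
  obtain ⟨B, hB, hk⟩ := h.exists_pair_kernel_bound α
  refine ⟨2 * Real.pi * B, by positivity, fun z hz R δ hδ hδR => ?_⟩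
  have hR : 0 < R := by linarith
  obtain ⟨hn, heq⟩ := h.kerOp_mul_star z hδ hδR hδ hδR
  rw [sq ‖_‖, ← CStarRing.norm_self_mul_star, heq]
  have e3 := ampl_nonneg (m' := m') (e' := e') (α := α) hR hδ
  set hh := if a₁ = 0 then min R R else min δ δ with hhh
  have hhp : 0 < hh := by rw [hhh]; split_ifs <;> simpa
  have := norm_kerOp_le_of_decay hn (B := B * (ampl m' e' α R δ * ampl m' e' α R δ) * hh)
    (w := (1 + ‖z‖) / (hh * (δ ^ m * R ^ e))) (by positivity) (by positivity)
    (fun x x' => (hk z hz R δ R δ x x' hδ hδR hδ hδR).1)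
    (fun x x' hx => by
      refine ((hk z hz R δ R δ x x' hδ hδR hδ hδR).2 hx).trans_eq ?_
      rw [div_div, ← hhh]; ring_nf)
  refine this.trans_eq ?_
  rw [oscSize, div_pow, Real.sq_sqrt (by positivity)]
  field_simp

end HalfSector

end DampedOIO

namespace DampedOIO

open scoped Topology ComplexConjugate ENNReal

/-! ### Almost orthogonality of pieces -/

namespace HalfSector

variable {S P D : ℝ → ℝ → ℝ} {a₁ b₁ a₂ b₂ : ℝ} {m e m' e' : ℕ} {C : ℝ}

theorem oscSize_nonneg {α R δ : ℝ} (hR : 0 < R) (hδ : 0 < δ) : 0 ≤ oscSize m e m' e' α R δ :=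
  div_nonneg (ampl_nonneg hR hδ) (Real.sqrt_nonneg _)

theorem trivSize_nonneg {α R δ : ℝ} (hR : 0 < R) (hδ : 0 < δ) :
    0 ≤ trivSize a₁ b₁ m' e' α R δ :=
  mul_nonneg (ampl_nonneg hR hδ) (Real.sqrt_nonneg _)

/-- Pieces that do not meet on any horizontal line. -/
theorem mul_star_eq_zero (h : HalfSector S P D a₁ b₁ a₂ b₂ m e m' e' C) (z : ℂ) {R δ R' δ' : ℝ}
    (hδ : 0 < δ) (hδR : δ ≤ R) (hδ' : 0 < δ') (hδR' : δ' ≤ R')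
    (hd : ∀ x x' y, y ∈ cellSlice a₁ b₁ a₂ b₂ R δ x → y ∉ cellSlice a₁ b₁ a₂ b₂ R' δ' x') :
    kerOp (piece S D a₁ b₁ a₂ b₂ z R δ) * star (kerOp (piece S D a₁ b₁ a₂ b₂ z R' δ')) = 0 := by
  obtain ⟨hn, heq⟩ := h.kerOp_mul_star z hδ hδR hδ' hδR'
  have h0 : ∀ x x', ∫ y, piece S D a₁ b₁ a₂ b₂ z R δ x y *
      conj (piece S D a₁ b₁ a₂ b₂ z R' δ' x' y) = 0 := by
    intro x x'
    refine integral_eq_zero_of_ae (.of_forall fun y => ?_)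
    by_contra hne
    have h1 : piece S D a₁ b₁ a₂ b₂ z R δ x y ≠ 0 := left_ne_zero_of_mul hne
    have h2 : piece S D a₁ b₁ a₂ b₂ z R' δ' x' y ≠ 0 := fun h0 => hne (by simp [h0])
    exact hd x x' y (piece_ne_zero hδ hδR h1) (piece_ne_zero hδ' hδR' h2)
  rw [heq, ← norm_le_zero_iff]
  have := norm_kerOp_le_of_support hn (B := 0) (X := 0) (Y := 0) le_rfl le_rfl le_rfl
    (fun x x' => by rw [h0, norm_zero]) (fun x => ⟨∅, fun y hy => absurd (h0 x y) hy, by simp⟩)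
    (fun y => ⟨∅, fun x hx => absurd (h0 x y) hx, by simp⟩)
  simpa using this

/-- Two pieces whose supports are horizontally separated by `ρ`: one integration by parts gains
`ρ⁻¹`. -/
theorem exists_norm_mul_star_le_of_separated (h : HalfSector S P D a₁ b₁ a₂ b₂ m e m' e' C)
    (α : ℝ) : ∃ B : ℝ, 0 < B ∧ ∀ z : ℂ, z.re = α → ∀ R δ R' δ' ρ X Y : ℝ, 0 < δ → δ ≤ R →
      0 < δ' → δ' ≤ R' → 0 < ρ → 0 ≤ X → 0 ≤ Y →
      (∀ x x' y, y ∈ cellSlice a₁ b₁ a₂ b₂ R δ x → y ∈ cellSlice a₁ b₁ a₂ b₂ R' δ' x' →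
        ρ ≤ |x - x'|) →
      (∀ x, ∃ U, (∀ x' y, y ∈ cellSlice a₁ b₁ a₂ b₂ R δ x →
        y ∈ cellSlice a₁ b₁ a₂ b₂ R' δ' x' → x' ∈ U) ∧ volume U ≤ ENNReal.ofReal X) →
      (∀ x', ∃ U, (∀ x y, y ∈ cellSlice a₁ b₁ a₂ b₂ R δ x →
        y ∈ cellSlice a₁ b₁ a₂ b₂ R' δ' x' → x ∈ U) ∧ volume U ≤ ENNReal.ofReal Y) →
      ‖kerOp (piece S D a₁ b₁ a₂ b₂ z R δ) * star (kerOp (piece S D a₁ b₁ a₂ b₂ z R' δ'))‖ ≤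
        B * (1 + ‖z‖) * (ampl m' e' α R δ * ampl m' e' α R' δ' / (ρ * (δ ^ m * R ^ e))) *
          Real.sqrt (X * Y) := by
  obtain ⟨B, hB, hk⟩ := h.exists_pair_kernel_bound α
  refine ⟨B, hB, fun z hz R δ R' δ' ρ X Y hδ hδR hδ' hδR' hρ hX hY hsep hU hV => ?_⟩
  have hR : 0 < R := by linarith
  have hR' : 0 < R' := by linarith
  obtain ⟨hn, heq⟩ := h.kerOp_mul_star z hδ hδR hδ' hδR'
  have e1 := ampl_nonneg (m' := m') (e' := e') (α := α) hR hδ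
  have e2 := ampl_nonneg (m' := m') (e' := e') (α := α) hR' hδ'
  have hex : ∀ x x', ∫ y, piece S D a₁ b₁ a₂ b₂ z R δ x y *
      conj (piece S D a₁ b₁ a₂ b₂ z R' δ' x' y) ≠ 0 →
      ∃ y, y ∈ cellSlice a₁ b₁ a₂ b₂ R δ x ∧ y ∈ cellSlice a₁ b₁ a₂ b₂ R' δ' x' := by
    intro x x' hne
    by_contra! hall
    refine hne (integral_eq_zero_of_ae (.of_forall fun y => ?_))
    by_contra hne'
    have h1 : piece S D a₁ b₁ a₂ b₂ z R δ x y ≠ 0 := left_ne_zero_of_mul hne'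
    have h2 : piece S D a₁ b₁ a₂ b₂ z R' δ' x' y ≠ 0 := fun h0 => hne' (by simp [h0])
    exact hall y (piece_ne_zero hδ hδR h1) (piece_ne_zero hδ' hδR' h2)
  rw [heq]
  refine norm_kerOp_le_of_support hn (by positivity) hX hY (fun x x' => ?_) (fun x => ?_)
    (fun x' => ?_)
  · by_cases h0 : ∫ y, piece S D a₁ b₁ a₂ b₂ z R δ x y *
      conj (piece S D a₁ b₁ a₂ b₂ z R' δ' x' y) = 0
    · rw [h0, norm_zero]; positivity
    · obtain ⟨y, hy, hy'⟩ := hex x x' h0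
      have hs := hsep x x' y hy hy'
      have hp : 0 < |x - x'| := hρ.trans_le hs
      have hxx : x ≠ x' := sub_ne_zero.mp (abs_pos.mp hp)
      obtain ⟨k1, k2⟩ := hk z hz R δ R' δ' x x' hδ hδR hδ' hδR'
      have k2 := k2 hxx
      set hh := if a₁ = 0 then min R R' else min δ δ' with hhh
      have hhp : 0 < hh := by rw [hhh]; split_ifs <;> positivity
      set ww := ampl m' e' α R δ * ampl m' e' α R' δ' with hww
      have hww0 : 0 ≤ ww := mul_nonneg e1 e2
      set t := (1 + ‖z‖) / (hh * |x - x'| * (δ ^ m * R ^ e)) with ht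
      have ht0 : 0 ≤ t := by positivity
      -- `min 1 (t ^ 2) ≤ t`
      have k3 : ‖∫ y, piece S D a₁ b₁ a₂ b₂ z R δ x y *
          conj (piece S D a₁ b₁ a₂ b₂ z R' δ' x' y)‖ ≤ B * ww * hh * t := by
        have hc : 0 ≤ B * ww * hh := by positivity
        rcases le_total t 1 with h1 | h1
        · exact k2.trans (mul_le_mul_of_nonneg_left (by nlinarith) hc)
        · exact k1.trans (le_mul_of_one_le_right hc h1)
      refine k3.trans ?_
      calc B * ww * hh * t = B * (1 + ‖z‖) * (ww / (|x - x'| * (δ ^ m * R ^ e))) := by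
            rw [ht]; field_simp
        _ ≤ _ := by gcongr
  · obtain ⟨U, hU1, hU2⟩ := hU x
    refine ⟨U, fun x' hne => ?_, hU2⟩
    obtain ⟨y, hy, hy'⟩ := hex x x' hne
    exact hU1 x' y hy hy'
  · obtain ⟨U, hU1, hU2⟩ := hV x'
    refine ⟨U, fun x hne => ?_, hU2⟩
    obtain ⟨y, hy, hy'⟩ := hex x x' hne
    exact hU1 x y hy hy'

theorem norm_mul_star_comm (A B : L2 →L[ℂ] L2) : ‖A * star B‖ = ‖B * star A‖ := by
  rw [← norm_star (A * star B), star_mul, star_star]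

theorem scaleRatio_comm (R δ R' δ' : ℝ) : scaleRatio R δ R' δ' = scaleRatio R' δ' R δ := by
  unfold scaleRatio; rw [min_comm (δ / δ'), min_comm (R / R')]

theorem scaleRatio_pos {R δ R' δ' : ℝ} (hR : 0 < R) (hδ : 0 < δ) (hR' : 0 < R') (hδ' : 0 < δ') :
    0 < scaleRatio R δ R' δ' := by
  unfold scaleRatio; positivity

/-- Two pieces at comparable scales: the gain is bounded below, and the bounds for the two norms
suffice. -/
theorem exists_norm_mul_star_le_of_near (h : HalfSector S P D a₁ b₁ a₂ b₂ m e m' e' C) (α K : ℝ)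
    (hK : 0 < K) : ∃ B : ℝ, 0 < B ∧ ∀ z : ℂ, z.re = α → ∀ R δ R' δ' : ℝ, 0 < δ → δ ≤ R →
      0 < δ' → δ' ≤ R' → 1 ≤ K * scaleRatio R δ R' δ' →
      ‖kerOp (piece S D a₁ b₁ a₂ b₂ z R δ) * star (kerOp (piece S D a₁ b₁ a₂ b₂ z R' δ'))‖ ≤
        B * (1 + ‖z‖) * (oscSize m e m' e' α R δ * oscSize m e m' e' α R' δ') *
          Real.sqrt (scaleRatio R δ R' δ') := by
  obtain ⟨B, hB, hn⟩ := h.exists_norm_sq_le_oscSize α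
  refine ⟨B * Real.sqrt K, by positivity, fun z hz R δ R' δ' hδ hδR hδ' hδR' hs => ?_⟩
  have hR : 0 < R := by linarith
  have hR' : 0 < R' := by linarith
  have o1 := oscSize_nonneg (m := m) (e := e) (m' := m') (e' := e') (α := α) hR hδ
  have o2 := oscSize_nonneg (m := m) (e := e) (m' := m') (e' := e') (α := α) hR' hδ'
  have n1 := hn z hz R δ hδ hδR
  have n2 := hn z hz R' δ' hδ' hδR'
  have hs1 : 1 ≤ Real.sqrt K * Real.sqrt (scaleRatio R δ R' δ') := by
    rw [← Real.sqrt_mul hK.le]; exact Real.one_le_sqrt.mpr hs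
  have hpos : 0 ≤ B * (1 + ‖z‖) * (oscSize m e m' e' α R δ * oscSize m e m' e' α R' δ') := by
    positivity
  calc _ ≤ ‖kerOp (piece S D a₁ b₁ a₂ b₂ z R δ)‖ * ‖kerOp (piece S D a₁ b₁ a₂ b₂ z R' δ')‖ := by
        exact (norm_mul_le _ _).trans_eq (congrArg _ (norm_star (kerOp _)))
    _ ≤ B * (1 + ‖z‖) * (oscSize m e m' e' α R δ * oscSize m e m' e' α R' δ') := by
        refine le_of_sq_le_sq ?_ hpos
        rw [mul_pow]
        calc _ ≤ (B * (1 + ‖z‖) * oscSize m e m' e' α R δ ^ 2) *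
              (B * (1 + ‖z‖) * oscSize m e m' e' α R' δ' ^ 2) :=
              mul_le_mul n1 n2 (by positivity) (by positivity)
          _ = _ := by ring
    _ ≤ B * (1 + ‖z‖) * (oscSize m e m' e' α R δ * oscSize m e m' e' α R' δ') *
          (Real.sqrt K * Real.sqrt (scaleRatio R δ R' δ')) := le_mul_of_one_le_right hpos hs1
    _ = _ := by ring

/-- Passing from the bound by amplitudes to the bound by oscillatory sizes. -/
theorem ampl_mul_div_le_oscSize {α R δ R' δ' q K σ : ℝ} (hR : 0 < R) (hδ : 0 < δ) (hR' : 0 < R')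
    (hδ' : 0 < δ') (hK : 0 ≤ K)
    (h : (δ' ^ m * R' ^ e) / (δ ^ m * R ^ e) * q ≤ K * σ) :
    ampl m' e' α R δ * ampl m' e' α R' δ' / (δ ^ m * R ^ e) * Real.sqrt q ≤
      Real.sqrt K * (oscSize m e m' e' α R δ * oscSize m e m' e' α R' δ') * Real.sqrt σ := by
  have e1 := ampl_nonneg (m' := m') (e' := e') (α := α) hR hδ
  have e2 := ampl_nonneg (m' := m') (e' := e') (α := α) hR' hδ'
  have hμ : 0 < δ ^ m * R ^ e := by positivity
  have hμ' : 0 < δ' ^ m * R' ^ e := by positivity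
  obtain ⟨μ, hμe⟩ : ∃ μ, μ = δ ^ m * R ^ e := ⟨_, rfl⟩
  obtain ⟨μ', hμe'⟩ : ∃ μ', μ' = δ' ^ m * R' ^ e := ⟨_, rfl⟩
  rw [← hμe, ← hμe'] at h
  rw [← hμe] at hμ ⊢
  rw [← hμe'] at hμ'
  calc _ = ampl m' e' α R δ * ampl m' e' α R' δ' / (Real.sqrt μ * Real.sqrt μ') *
        Real.sqrt (μ' / μ * q) := by
        rw [Real.sqrt_mul (show 0 ≤ μ' / μ by positivity) q, Real.sqrt_div hμ'.le]
        have s1 : 0 < Real.sqrt μ := Real.sqrt_pos.mpr hμ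
        have s2 : 0 < Real.sqrt μ' := Real.sqrt_pos.mpr hμ'
        nth_rewrite 1 [← Real.mul_self_sqrt hμ.le]
        field_simp
    _ ≤ ampl m' e' α R δ * ampl m' e' α R' δ' / (Real.sqrt μ * Real.sqrt μ') *
        Real.sqrt (K * σ) := by gcongr
    _ = _ := by
        rw [Real.sqrt_mul hK, oscSize, oscSize, ← hμe, ← hμe']
        field_simp

/-- Almost orthogonality near a line that is transverse to the horizontal direction: the factor
gained is the square root of the ratio of the distances to the line. -/
theorem exists_norm_mul_star_le_of_transverse (h : HalfSector S P D a₁ b₁ a₂ b₂ m e m' e' C)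
    (hb : b₁ ≠ 0) (α G : ℝ) (hG : 1 ≤ G) :
    ∃ B : ℝ, 0 < B ∧ ∀ z : ℂ, z.re = α → ∀ R δ R' δ' : ℝ, 0 < δ → δ ≤ R →
      0 < δ' → δ' ≤ R' → R ≤ G * R' → R' ≤ G * R → 32 * δ' < δ →
      ‖kerOp (piece S D a₁ b₁ a₂ b₂ z R δ) * star (kerOp (piece S D a₁ b₁ a₂ b₂ z R' δ'))‖ ≤
        B * (1 + ‖z‖) * (oscSize m e m' e' α R δ * oscSize m e m' e' α R' δ') *
          Real.sqrt (scaleRatio R δ R' δ') := by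
  obtain ⟨B, hB, hn⟩ := h.exists_norm_mul_star_le_of_separated α
  refine ⟨B * 64 * Real.sqrt (G ^ (e + 1)), by positivity,
    fun z hz R δ R' δ' hδ hδR hδ' hδR' hRR' hR'R hfar => ?_⟩
  have hR : 0 < R := by linarith
  have hR' : 0 < R' := by linarith
  have hbp : 0 < |b₁| := abs_pos.mpr hb
  have hdiff : ∀ x x' y, lin a₁ b₁ x y - lin a₁ b₁ x' y = b₁ * (x - x') := fun x x' y => by
    unfold lin; ring
  set X := if a₁ = 0 then δ' else δ with hX
  have hX0 : 0 < X := by rw [hX]; split_ifs <;> assumption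
  have hclose : ∀ x x' y, y ∈ cellSlice a₁ b₁ a₂ b₂ R δ x →
      y ∈ cellSlice a₁ b₁ a₂ b₂ R' δ' x' → |x - x'| ≤ 4 * δ / |b₁| := by
    intro x x' y hy hy'
    rw [le_div_iff₀ hbp, ← abs_mul, mul_comm (x - x'), ← hdiff x x' y, abs_le]
    constructor <;> linarith [hy.1, hy.2.1, hy'.1, hy'.2.1]
  have hball : ∀ x : ℝ, volume (Metric.closedBall x (4 * δ / |b₁|)) ≤
      ENNReal.ofReal (8 * δ / |b₁|) := fun x => by
    rw [Real.volume_closedBall]; apply le_of_eq; congr 1; ring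
  have key := hn z hz R δ R' δ' (δ / (8 * |b₁|)) (8 * X / |b₁|) (8 * δ / |b₁|) hδ hδR hδ' hδR'
    (by positivity) (by positivity) (by positivity)
    (fun x x' y hy hy' => by
      rw [div_le_iff₀ (by positivity), mul_comm 8, ← mul_assoc, ← abs_mul, mul_comm (x - x'),
        ← hdiff x x' y]
      have : δ / 8 ≤ lin a₁ b₁ x y - lin a₁ b₁ x' y := by linarith [hy.1, hy'.2.1]
      linarith [le_abs_self (lin a₁ b₁ x y - lin a₁ b₁ x' y)])
    (fun x => by
      by_cases ha : a₁ = 0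
      · refine ⟨{x' | 0 < lin b₁ a₁ 0 x' ∧ lin b₁ a₁ 0 x' < 4 * δ'}, fun x' y _ hy' => ?_, ?_⟩
        · have : lin b₁ a₁ 0 x' = lin a₁ b₁ x' y := by unfold lin; rw [ha]; ring
          simp only [Set.mem_ofPred_eq, this]
          exact ⟨by linarith [hy'.1], hy'.2.1⟩
        · refine (volume_lin_slice_le hb (x := 0) (b := a₁) (ρ := δ') fun x' hx' => hx').trans ?_
          refine ENNReal.ofReal_le_ofReal ?_
          rw [hX, if_pos ha]; gcongr; norm_num
      · refine ⟨Metric.closedBall x (4 * δ / |b₁|), fun x' y hy hy' => ?_, ?_⟩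
        · rw [Metric.mem_closedBall, dist_comm, Real.dist_eq]; exact hclose x x' y hy hy'
        · rw [hX, if_neg ha]; exact hball x)
    (fun x' => ⟨Metric.closedBall x' (4 * δ / |b₁|), fun x y hy hy' => by
      rw [Metric.mem_closedBall, Real.dist_eq]; exact hclose x x' y hy hy', hball x'⟩)
  have hsr : δ' / δ / G ≤ scaleRatio R δ R' δ' := by
    unfold scaleRatio
    have h1 : δ' / δ ≤ min (δ / δ') (δ' / δ) := by
      refine le_min ?_ le_rfl
      rw [div_le_div_iff₀ hδ hδ']; nlinarith
    have h2 : G⁻¹ ≤ min (R / R') (R' / R) := by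
      refine le_min ?_ ?_ <;> rw [inv_le_iff_one_le_mul₀ (by positivity), div_mul_eq_mul_div,
        one_le_div (by positivity)] <;> linarith
    rw [div_eq_mul_inv _ G]
    exact mul_le_mul h1 h2 (by positivity) (by positivity)
  have hratio : (δ' ^ m * R' ^ e) / (δ ^ m * R ^ e) * (X / δ) ≤
      G ^ (e + 1) * scaleRatio R δ R' δ' := by
    have hle1 : δ' / δ ≤ 1 := by rw [div_le_one hδ]; linarith
    have h0 : 0 ≤ δ' / δ := by positivity
    have h1 : (δ' / δ) ^ m * (X / δ) ≤ δ' / δ := by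
      by_cases ha : a₁ = 0
      · rw [hX, if_pos ha]
        exact mul_le_of_le_one_left h0 (pow_le_one₀ h0 hle1)
      · rw [hX, if_neg ha, div_self hδ.ne', mul_one]
        obtain ⟨k, rfl⟩ := Nat.exists_eq_add_of_le (h.slanted ha hb)
        rw [pow_add, pow_one]
        exact mul_le_of_le_one_right h0 (pow_le_one₀ h0 hle1)
    have h2 : (R' / R) ^ e ≤ G ^ e := by
      gcongr; rw [div_le_iff₀ hR]; linarith
    calc _ = ((δ' / δ) ^ m * (X / δ)) * (R' / R) ^ e := by rw [div_pow, div_pow]; field_simp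
      _ ≤ (δ' / δ) * G ^ e := mul_le_mul h1 h2 (by positivity) h0
      _ = G ^ (e + 1) * (δ' / δ / G) := by rw [pow_succ]; field_simp
      _ ≤ _ := by gcongr
  have hfin := ampl_mul_div_le_oscSize (m' := m') (e' := e') (α := α) hR hδ hR' hδ'
    (by positivity) hratio
  refine key.trans ?_
  have hsq : Real.sqrt (8 * X / |b₁| * (8 * δ / |b₁|)) =
      8 * δ / |b₁| * Real.sqrt (X / δ) := by
    rw [show 8 * X / |b₁| * (8 * δ / |b₁|) = (8 * δ / |b₁|) ^ 2 * (X / δ) by field_simp,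
      Real.sqrt_mul (by positivity), Real.sqrt_sq (by positivity)]
  rw [hsq]
  calc _ = B * 64 * (1 + ‖z‖) * (ampl m' e' α R δ * ampl m' e' α R' δ' / (δ ^ m * R ^ e) *
        Real.sqrt (X / δ)) := by field_simp; ring
    _ ≤ B * 64 * (1 + ‖z‖) * (Real.sqrt (G ^ (e + 1)) * (oscSize m e m' e' α R δ *
        oscSize m e m' e' α R' δ') * Real.sqrt (scaleRatio R δ R' δ')) := by gcongr
    _ = _ := by ring

/-- Almost orthogonality near the line `y = 0`: the factor gained is the square root of the ratio
of the abscissae. -/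
theorem exists_norm_mul_star_le_of_horizontal (h : HalfSector S P D a₁ b₁ a₂ b₂ m e m' e' C)
    (hb : b₁ = 0) (α : ℝ) :
    ∃ B : ℝ, 0 < B ∧ ∀ z : ℂ, z.re = α → ∀ R δ R' δ' : ℝ, 0 < δ → δ ≤ R →
      0 < δ' → δ' ≤ R' → δ ≤ 16 * δ' → δ' ≤ 16 * δ → 32 * R' < R →
      ‖kerOp (piece S D a₁ b₁ a₂ b₂ z R δ) * star (kerOp (piece S D a₁ b₁ a₂ b₂ z R' δ'))‖ ≤
        B * (1 + ‖z‖) * (oscSize m e m' e' α R δ * oscSize m e m' e' α R' δ') *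
          Real.sqrt (scaleRatio R δ R' δ') := by
  have hdet := h.det_ne
  have ha1 : a₁ ≠ 0 := by rintro rfl; simp [hb] at hdet
  have hb2 : b₂ ≠ 0 := by rintro rfl; simp [hb] at hdet
  have hap : 0 < |a₁| := abs_pos.mpr ha1
  have hbp : 0 < |b₂| := abs_pos.mpr hb2
  obtain ⟨B, hB, hn⟩ := h.exists_norm_mul_star_le_of_separated α
  set c := 4 * (1 + |a₂| / |a₁|) / |b₂| with hc
  have hc0 : 0 < c := by positivity
  refine ⟨B * (16 * |b₂| * c) * Real.sqrt (16 ^ (m + 1)), by positivity,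
    fun z hz R δ R' δ' hδ hδR hδ' hδR' hδδ' hδ'δ hfar => ?_⟩
  have hR : 0 < R := by linarith
  have hR' : 0 < R' := by linarith
  have hdiff : ∀ x x' y, lin a₂ b₂ x y - lin a₂ b₂ x' y = b₂ * (x - x') := fun x x' y => by
    unfold lin; ring
  have hbound : ∀ {R δ x y : ℝ}, 0 < δ → δ ≤ R → y ∈ cellSlice a₁ b₁ a₂ b₂ R δ x →
      x ∈ Metric.closedBall (0 : ℝ) (c * R) := by
    intro R δ x y hδ hδR hy
    have e1 : |y| ≤ 4 * R / |a₁| := by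
      rw [le_div_iff₀ hap, ← abs_mul, show y * a₁ = lin a₁ b₁ x y by rw [hb]; unfold lin; ring,
        abs_of_pos (by linarith [hy.1])]
      linarith [hy.2.1]
    rw [mem_closedBall_zero_iff, Real.norm_eq_abs, hc, div_mul_eq_mul_div, le_div_iff₀ hbp,
      ← abs_mul, show x * b₂ = lin a₂ b₂ x y - a₂ * y by unfold lin; ring]
    calc |lin a₂ b₂ x y - a₂ * y| ≤ 4 * R + |a₂| * (4 * R / |a₁|) := by
          refine (abs_sub _ _).trans (add_le_add ?_ ?_)
          · rw [abs_of_pos (by linarith [hy.2.2.1])]; exact hy.2.2.2.le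
          · rw [abs_mul]; gcongr
      _ = _ := by field_simp
  have hball : ∀ R : ℝ, volume (Metric.closedBall (0 : ℝ) (c * R)) ≤
      ENNReal.ofReal (2 * c * R) := fun x => by
    rw [Real.volume_closedBall]; apply le_of_eq; congr 1; ring
  have key := hn z hz R δ R' δ' (R / (8 * |b₂|)) (2 * c * R') (2 * c * R) hδ hδR hδ' hδR'
    (by positivity) (by positivity) (by positivity)
    (fun x x' y hy hy' => by
      rw [div_le_iff₀ (by positivity), mul_comm 8, ← mul_assoc, ← abs_mul, mul_comm (x - x'),
        ← hdiff x x' y]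
      have : R / 8 ≤ lin a₂ b₂ x y - lin a₂ b₂ x' y := by linarith [hy.2.2.1, hy'.2.2.2]
      linarith [le_abs_self (lin a₂ b₂ x y - lin a₂ b₂ x' y)])
    (fun x => ⟨_, fun x' y _ hy' => hbound hδ' hδR' hy', hball R'⟩)
    (fun x' => ⟨_, fun x y hy _ => hbound hδ hδR hy, hball R⟩)
  have hsr : R' / R / 16 ≤ scaleRatio R δ R' δ' := by
    unfold scaleRatio
    have h1 : R' / R ≤ min (R / R') (R' / R) := by
      refine le_min ?_ le_rfl
      rw [div_le_div_iff₀ hR hR']; nlinarith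
    have h2 : (16 : ℝ)⁻¹ ≤ min (δ / δ') (δ' / δ) := by
      refine le_min ?_ ?_ <;> rw [inv_le_iff_one_le_mul₀ (by positivity), div_mul_eq_mul_div,
        one_le_div (by positivity)] <;> linarith
    rw [div_eq_mul_inv _ (16 : ℝ), mul_comm]
    exact mul_le_mul h2 h1 (by positivity) (by positivity)
  have hratio : (δ' ^ m * R' ^ e) / (δ ^ m * R ^ e) * (R' / R) ≤
      16 ^ (m + 1) * scaleRatio R δ R' δ' := by
    have h1 : (R' / R) ^ e ≤ 1 := pow_le_one₀ (by positivity) (by rw [div_le_one hR]; linarith)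
    have h2 : (δ' / δ) ^ m ≤ 16 ^ m := by
      gcongr; rw [div_le_iff₀ hδ]; linarith
    calc _ = ((δ' / δ) ^ m * (R' / R) ^ e) * (R' / R) := by rw [div_pow, div_pow]; field_simp
      _ ≤ (16 ^ m * 1) * (R' / R) := by gcongr
      _ = 16 ^ (m + 1) * (R' / R / 16) := by rw [pow_succ]; ring
      _ ≤ _ := by gcongr
  have hfin := ampl_mul_div_le_oscSize (m' := m') (e' := e') (α := α) hR hδ hR' hδ'
    (by positivity) hratio
  refine key.trans ?_
  have hsq : Real.sqrt (2 * c * R' * (2 * c * R)) = 2 * c * R * Real.sqrt (R' / R) := by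
    rw [show 2 * c * R' * (2 * c * R) = (2 * c * R) ^ 2 * (R' / R) by field_simp,
      Real.sqrt_mul (by positivity), Real.sqrt_sq (by positivity)]
  rw [hsq]
  calc _ = B * (16 * |b₂| * c) * (1 + ‖z‖) * (ampl m' e' α R δ * ampl m' e' α R' δ' /
        (δ ^ m * R ^ e) * Real.sqrt (R' / R)) := by field_simp; ring
    _ ≤ B * (16 * |b₂| * c) * (1 + ‖z‖) * (Real.sqrt (16 ^ (m + 1)) * (oscSize m e m' e' α R δ *
        oscSize m e m' e' α R' δ') * Real.sqrt (scaleRatio R δ R' δ')) := by gcongr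
    _ = _ := by ring

/-- Almost orthogonality of the pieces of a half-sector, in terms of their oscillatory sizes. -/
theorem exists_norm_mul_star_le (h : HalfSector S P D a₁ b₁ a₂ b₂ m e m' e' C) (α : ℝ) :
    ∃ B : ℝ, 0 < B ∧ ∀ z : ℂ, z.re = α → ∀ R δ R' δ' : ℝ, 0 < δ → δ ≤ R → 0 < δ' → δ' ≤ R' →
      ‖kerOp (piece S D a₁ b₁ a₂ b₂ z R δ) * star (kerOp (piece S D a₁ b₁ a₂ b₂ z R' δ'))‖ ≤
        B * (1 + ‖z‖) * (oscSize m e m' e' α R δ * oscSize m e m' e' α R' δ') *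
          Real.sqrt (scaleRatio R δ R' δ') := by
  have hC0 : 0 < C := by linarith [h.one_le]
  have hone := h.one_le
  set G := 16 * C ^ 2 with hG
  have hG1 : 1 ≤ G := by nlinarith
  have hge : ∀ {u v K : ℝ}, 0 < u → 0 < v → 0 < K → u ≤ K * v → v ≤ K * u →
      K⁻¹ ≤ min (u / v) (v / u) := by
    intro u v K hu hv hK h1 h2
    refine le_min ?_ ?_ <;> rw [inv_le_iff_one_le_mul₀ (by positivity), div_mul_eq_mul_div,
      one_le_div (by positivity)] <;> linarith
  have hnear : ∀ {R δ R' δ' K L : ℝ}, 0 < R → 0 < δ → 0 < R' → 0 < δ' → 0 < K → 0 < L →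
      δ ≤ K * δ' → δ' ≤ K * δ → R ≤ L * R' → R' ≤ L * R → 1 ≤ K * L * scaleRatio R δ R' δ' := by
    intro R δ R' δ' K L hR hδ hR' hδ' hK hL h1 h2 h3 h4
    have := mul_le_mul (hge hδ hδ' hK h1 h2) (hge hR hR' hL h3 h4) (by positivity) (by positivity)
    calc 1 = K * L * (K⁻¹ * L⁻¹) := by field_simp
      _ ≤ _ := by unfold scaleRatio; gcongr
  obtain ⟨B1, hB1, hn1⟩ := h.exists_norm_mul_star_le_of_near α (32 * G) (by positivity)
  obtain ⟨B3, hB3, hn3⟩ := h.exists_norm_mul_star_le_of_near α (16 * 32) (by positivity)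
  have hmono : ∀ {B B' M o s : ℝ}, B ≤ B' → 0 ≤ M → 0 ≤ o → B * (1 + M) * o * Real.sqrt s ≤
      B' * (1 + M) * o * Real.sqrt s := by
    intro B B' M o s h1 h2 h3; gcongr
  by_cases hb : b₁ = 0
  · obtain ⟨B2, hB2, hn2⟩ := h.exists_norm_mul_star_le_of_horizontal hb α
    refine ⟨B3 + B2, by positivity, fun z hz R δ R' δ' hδ hδR hδ' hδR' => ?_⟩
    wlog hle : R' ≤ R generalizing R δ R' δ'
    · rw [norm_mul_star_comm, scaleRatio_comm, mul_comm (oscSize m e m' e' α R δ)]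
      exact this R' δ' R δ hδ' hδR' hδ hδR (le_of_not_ge hle)
    have hR : 0 < R := by linarith
    have hR' : 0 < R' := by linarith
    have o1 := oscSize_nonneg (m := m) (e := e) (m' := m') (e' := e') (α := α) hR hδ
    have o2 := oscSize_nonneg (m := m) (e := e) (m' := m') (e' := e') (α := α) hR' hδ'
    by_cases hδδ : δ ≤ 16 * δ' ∧ δ' ≤ 16 * δ
    · rcases le_or_gt R (32 * R') with hRR | hRR
      · exact (hn3 z hz R δ R' δ' hδ hδR hδ' hδR' (hnear hR hδ hR' hδ' (by norm_num) (by norm_num)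
          hδδ.1 hδδ.2 hRR (by linarith))).trans
          (hmono (by linarith) (norm_nonneg z) (mul_nonneg o1 o2))
      · exact (hn2 z hz R δ R' δ' hδ hδR hδ' hδR' hδδ.1 hδδ.2 hRR).trans
          (hmono (by linarith) (norm_nonneg z) (mul_nonneg o1 o2))
    · rw [h.mul_star_eq_zero z hδ hδR hδ' hδR', norm_zero]
      · positivity
      · intro x x' y hy hy'
        have : lin a₁ b₁ x y = lin a₁ b₁ x' y := by rw [hb]; unfold lin; ring
        refine hδδ ⟨?_, ?_⟩ <;> linarith [hy.1, hy.2.1, hy'.1, hy'.2.1]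
  · obtain ⟨B2, hB2, hn2⟩ := h.exists_norm_mul_star_le_of_transverse hb α G hG1
    refine ⟨B1 + B2, by positivity, fun z hz R δ R' δ' hδ hδR hδ' hδR' => ?_⟩
    wlog hle : δ' ≤ δ generalizing R δ R' δ'
    · rw [norm_mul_star_comm, scaleRatio_comm, mul_comm (oscSize m e m' e' α R δ)]
      exact this R' δ' R δ hδ' hδR' hδ hδR (le_of_not_ge hle)
    have hR : 0 < R := by linarith
    have hR' : 0 < R' := by linarith
    have o1 := oscSize_nonneg (m := m) (e := e) (m' := m') (e' := e') (α := α) hR hδ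
    have o2 := oscSize_nonneg (m := m) (e := e) (m' := m') (e' := e') (α := α) hR' hδ'
    by_cases hRR : R ≤ G * R' ∧ R' ≤ G * R
    · rcases le_or_gt δ (32 * δ') with hδδ | hδδ
      · exact (hn1 z hz R δ R' δ' hδ hδR hδ' hδR' (hnear hR hδ hR' hδ' (by norm_num) (by positivity)
          hδδ (by linarith) hRR.1 hRR.2)).trans
          (hmono (by linarith) (norm_nonneg z) (mul_nonneg o1 o2))
      · exact (hn2 z hz R δ R' δ' hδ hδR hδ' hδR' hRR.1 hRR.2 hδδ).trans
          (hmono (by linarith) (norm_nonneg z) (mul_nonneg o1 o2))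
    · rw [h.mul_star_eq_zero z hδ hδR hδ' hδR', norm_zero]
      · positivity
      · intro x x' y hy hy'
        have g1 := h.height hb x y (mem_sectorSlice_of_mem_cellSlice hδR (by positivity)
          (by positivity) hy)
        have g2 := h.height hb x' y (mem_sectorSlice_of_mem_cellSlice hδR' (by positivity)
          (by positivity) hy')
        have hcmp : ∀ {u v w : ℝ}, C⁻¹ * u ≤ w → w ≤ C * v → u ≤ C ^ 2 * v := by
          intro u v w h1 h2
          have := h1.trans h2
          rw [inv_mul_le_iff₀ hC0] at this
          linarith
        have k1 := hcmp g1.1 g2.2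
        have k2 := hcmp g2.1 g1.2
        have hC2 : 0 < C ^ 2 := by positivity
        refine hRR ⟨?_, ?_⟩ <;> rw [hG] <;>
          nlinarith [hy.2.2.1, hy.2.2.2, hy'.2.2.1, hy'.2.2.2]

/-- The trivial bound for products of pieces. -/
theorem exists_norm_mul_star_le_trivSize (h : HalfSector S P D a₁ b₁ a₂ b₂ m e m' e' C) (α : ℝ) :
    ∃ B : ℝ, 0 < B ∧ ∀ z : ℂ, z.re = α → ∀ R δ R' δ' : ℝ, 0 < δ → δ ≤ R → 0 < δ' → δ' ≤ R' →
      ‖kerOp (piece S D a₁ b₁ a₂ b₂ z R δ) * star (kerOp (piece S D a₁ b₁ a₂ b₂ z R' δ'))‖ ≤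
        B * (trivSize a₁ b₁ m' e' α R δ * trivSize a₁ b₁ m' e' α R' δ') := by
  obtain ⟨B, hB, hn⟩ := h.exists_norm_le_trivSize α
  refine ⟨B ^ 2, by positivity, fun z hz R δ R' δ' hδ hδR hδ' hδR' => ?_⟩
  refine (norm_mul_le _ _).trans ?_
  rw [norm_star (kerOp (piece S D a₁ b₁ a₂ b₂ z R' δ'))]
  have t1 := trivSize_nonneg (a₁ := a₁) (b₁ := b₁) (m' := m') (e' := e') (α := α)
    (by linarith : 0 < R) hδ
  calc _ ≤ (B * trivSize a₁ b₁ m' e' α R δ) * (B * trivSize a₁ b₁ m' e' α R' δ') :=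
        mul_le_mul (hn z hz R δ hδ hδR) (hn z hz R' δ' hδ' hδR') (norm_nonneg _) (by positivity)
    _ = _ := by ring

end HalfSector

end DampedOIO

namespace DampedOIO

open scoped Topology ComplexConjugate ENNReal

/-! ### Summation over the cells of a half-sector -/

/-- Swapping the variables and conjugating turns a piece into a piece for `-S`. -/
theorem conj_piece (S D : ℝ → ℝ → ℝ) (a₁ b₁ a₂ b₂ : ℝ) (z : ℂ) (R δ x y : ℝ) :
    conj (piece S D a₁ b₁ a₂ b₂ z R δ y x) =
      piece (fun x y => -S y x) (fun x y => D y x) b₁ a₁ b₂ a₂ (conj z) R δ x y := by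
  have h1 : conj (((|D y x| : ℝ) : ℂ) ^ z) = ((|D y x| : ℝ) : ℂ) ^ (conj z) := by
    rw [Complex.cpow_conj, Complex.conj_ofReal]
    rw [Complex.arg_ofReal_of_nonneg (abs_nonneg _)]
    exact Real.pi_pos.ne
  simp only [piece, kernel, cell, map_mul, h1, ← Complex.exp_conj, Complex.conj_I,
    Complex.conj_ofReal, HalfSector.lin_swap a₁ b₁ y x, HalfSector.lin_swap a₂ b₂ y x]
  push_cast
  ring_nf

theorem scaleRatio_zpow_two (j k j' k' : ℤ) :
    scaleRatio ((2 : ℝ) ^ j) (2 ^ k) (2 ^ j') (2 ^ k') =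
      (2⁻¹ : ℝ) ^ ((j - j').natAbs + (k - k').natAbs) := by
  have key : ∀ a b : ℤ, min ((2 : ℝ) ^ a / 2 ^ b) (2 ^ b / 2 ^ a) = (2⁻¹ : ℝ) ^ (a - b).natAbs := by
    intro a b
    rw [← zpow_sub₀ two_ne_zero, ← zpow_sub₀ two_ne_zero, ← zpow_natCast, inv_zpow',
      Int.natCast_natAbs]
    rcases le_total a b with h | h
    · rw [abs_of_nonpos (by omega), neg_neg, min_eq_left]
      exact zpow_le_zpow_right₀ one_le_two (by omega)
    · rw [abs_of_nonneg (by omega), neg_sub, min_eq_right]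
      exact zpow_le_zpow_right₀ one_le_two (by omega)
  rw [scaleRatio, key, key, add_comm, pow_add]

/-- Interpolation between the two bounds for a product of pieces. -/
theorem le_of_interpolation {T u v p q o o' t t' θ σ : ℝ} (hθ : 0 ≤ θ) (hθ1 : θ ≤ 1)
    (hT : 0 ≤ T) (hu : 1 ≤ u) (hv : 1 ≤ v) (ho : 0 ≤ o) (ho' : 0 ≤ o') (ht : 0 ≤ t) (ht' : 0 ≤ t')
    (hσ : 0 ≤ σ) (h1 : T ≤ u * (o * o') * Real.sqrt σ) (h2 : T ≤ v * (t * t'))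
    (hp : p = o ^ θ * t ^ (1 - θ)) (hq : q = o' ^ θ * t' ^ (1 - θ)) (hp1 : p ≤ 1) (hq1 : q ≤ 1) :
    T ≤ u * v * σ ^ (θ / 2) := by
  have h3 : T = T ^ θ * T ^ (1 - θ) := by
    rw [← Real.rpow_add_of_nonneg hT hθ (by linarith)]; simp
  have hu0 : 0 ≤ u := by linarith
  have hv0 : 0 ≤ v := by linarith
  rw [h3]
  calc T ^ θ * T ^ (1 - θ) ≤ (u * (o * o') * Real.sqrt σ) ^ θ * (v * (t * t')) ^ (1 - θ) := by
        gcongr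
    _ = u ^ θ * v ^ (1 - θ) * (p * q) * σ ^ (θ / 2) := by
        rw [Real.mul_rpow (by positivity) (by positivity), Real.mul_rpow hu0 (by positivity),
          Real.mul_rpow ho ho', Real.mul_rpow hv0 (by positivity), Real.mul_rpow ht ht',
          Real.sqrt_eq_rpow, ← Real.rpow_mul hσ, hp, hq, one_div_mul_eq_div]
        ring
    _ ≤ u * v * 1 * σ ^ (θ / 2) := by
        have e1 : u ^ θ ≤ u := by simpa using Real.rpow_le_rpow_of_exponent_le hu hθ1
        have e2 : v ^ (1 - θ) ≤ v := by
          simpa using Real.rpow_le_rpow_of_exponent_le hv (by linarith : 1 - θ ≤ 1)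
        have hp0 : 0 ≤ p := by rw [hp]; positivity
        have hq0 : 0 ≤ q := by rw [hq]; positivity
        have e3 : p * q ≤ 1 := mul_le_one₀ hp1 hq0 hq1
        gcongr
    _ = _ := by ring

theorem summable_pow_natAbs {r : ℝ} (h0 : 0 ≤ r) (h1 : r < 1) :
    Summable fun n : ℤ => r ^ n.natAbs := by
  refine Summable.of_nat_of_neg ?_ ?_ <;> simpa using summable_geometric_of_lt_one h0 h1

theorem sum_pow_natAbs_le {r : ℝ} (h0 : 0 ≤ r) (h1 : r < 1) (p : ℤ × ℤ) (s : Finset (ℤ × ℤ)) :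
    ∑ q ∈ s, r ^ ((p.1 - q.1).natAbs + (p.2 - q.2).natAbs) ≤ (∑' n : ℤ, r ^ n.natAbs) ^ 2 := by
  have hs := summable_pow_natAbs h0 h1
  have hsum : ∀ (a : ℤ) (s : Finset ℤ), ∑ b ∈ s, r ^ (a - b).natAbs ≤ ∑' n : ℤ, r ^ n.natAbs := by
    intro a s
    have h2 := hs.comp_injective (Equiv.subLeft a).injective
    rw [← (Equiv.subLeft a).tsum_eq]
    exact h2.sum_le_tsum s fun _ _ => pow_nonneg h0 _
  classical
  calc _ ≤ ∑ q ∈ s.image Prod.fst ×ˢ s.image Prod.snd,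
        r ^ ((p.1 - q.1).natAbs + (p.2 - q.2).natAbs) :=
        Finset.sum_le_sum_of_subset_of_nonneg Finset.subset_product fun _ _ _ => by positivity
    _ = (∑ b ∈ s.image Prod.fst, r ^ (p.1 - b).natAbs) *
        ∑ b ∈ s.image Prod.snd, r ^ (p.2 - b).natAbs := by
        simp only [pow_add, Finset.sum_mul_sum, Finset.sum_product]
    _ ≤ _ := by
        rw [sq]
        exact mul_le_mul (hsum _ _) (hsum _ _) (Finset.sum_nonneg fun _ _ => by positivity)
          (tsum_nonneg fun _ => by positivity)

/-- Uniform bound for finite sums of pieces of a half-sector, by almost orthogonality. The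
hypothesis `hm` says that the geometric mean with weights `θ`, `1 - θ` of the oscillatory and of
the trivial bound for one piece is bounded. -/
theorem exists_norm_sum_piece_le {S P P' D : ℝ → ℝ → ℝ} {a₁ b₁ a₂ b₂ : ℝ} {m e m' e' : ℕ}
    {C C' α θ : ℝ} (h : HalfSector S P D a₁ b₁ a₂ b₂ m e m' e' C)
    (h' : HalfSector (fun x y => -S y x) P' (fun x y => D y x) b₁ a₁ b₂ a₂ m e m' e' C')
    (hθ : 0 < θ) (hθ1 : θ ≤ 1)
    (hm : ∀ R δ : ℝ, 0 < δ → δ ≤ R →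
      oscSize m e m' e' α R δ ^ θ * trivSize a₁ b₁ m' e' α R δ ^ (1 - θ) ≤ 1) :
    ∃ B : ℝ, 0 < B ∧ ∀ z : ℂ, z.re = α → ∀ s : Finset (ℤ × ℤ), (∀ p ∈ s, p.2 ≤ p.1) →
      ‖kerOp fun x y => ∑ p ∈ s, piece S D a₁ b₁ a₂ b₂ z (2 ^ p.1) (2 ^ p.2) x y‖ ≤
        B * (1 + ‖z‖) := by
  classical
  obtain ⟨B1, hB1, hn1⟩ := h.exists_norm_mul_star_le α
  obtain ⟨B2, hB2, hn2⟩ := h.exists_norm_mul_star_le_trivSize α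
  obtain ⟨B3, hB3, hn3⟩ := h'.exists_norm_mul_star_le α
  obtain ⟨B4, hB4, hn4⟩ := h'.exists_norm_mul_star_le_trivSize α
  set u := 1 + B1 + B3 with hu
  set v := 1 + B2 + B4 with hv
  -- a quarter of `θ`: interpolation leaves `scaleRatio ^ (θ / 2)`, and the Cotlar–Stein lemma
  -- takes another square root
  set r : ℝ := (2⁻¹ : ℝ) ^ (θ / 4) with hr
  have hr0 : 0 < r := by positivity
  have hr1 : r < 1 := Real.rpow_lt_one (by norm_num) (by norm_num) (by positivity)
  set G := (∑' n : ℤ, r ^ n.natAbs) ^ 2 with hG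
  have huv : 0 < u * v := by positivity
  refine ⟨u * v * (G + 1), by positivity, fun z hz s hs => ?_⟩
  set M := 1 + ‖z‖ with hM
  have hM1 : 1 ≤ M := by rw [hM]; linarith [norm_nonneg z]
  have hpos : ∀ p : ℤ × ℤ, (0 : ℝ) < 2 ^ p.2 := fun p => by positivity
  have hle : ∀ p ∈ s, (2 : ℝ) ^ p.2 ≤ 2 ^ p.1 := fun p hp =>
    zpow_le_zpow_right₀ one_le_two (hs p hp)
  have hnice : ∀ p : s, NiceKernel (piece S D a₁ b₁ a₂ b₂ z (2 ^ p.1.1) (2 ^ p.1.2)) :=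
    fun p => h.niceKernel_piece z (hpos _) (hle _ p.2)
  have hsum : (kerOp fun x y => ∑ p ∈ s, piece S D a₁ b₁ a₂ b₂ z (2 ^ p.1) (2 ^ p.2) x y) =
      ∑ p : s, kerOp (piece S D a₁ b₁ a₂ b₂ z (2 ^ p.1.1) (2 ^ p.1.2)) := by
    rw [kerOp_sum Finset.univ hnice]
    congr 1
    funext x y
    exact (Finset.sum_coe_sort s fun p => piece S D a₁ b₁ a₂ b₂ z (2 ^ p.1) (2 ^ p.2) x y).symm
  have hswap : ∀ p : s, star (kerOp (piece S D a₁ b₁ a₂ b₂ z (2 ^ p.1.1) (2 ^ p.1.2))) =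
      kerOp (piece (fun x y => -S y x) (fun x y => D y x) b₁ a₁ b₂ a₂ (conj z)
        (2 ^ p.1.1) (2 ^ p.1.2)) := by
    intro p
    rw [star_kerOp (hnice p)]
    congr 1
    funext x y
    exact conj_piece ..
  have hzc : (conj z).re = α := by simpa using hz
  have htriv : ∀ R δ, trivSize b₁ a₁ m' e' α R δ = trivSize a₁ b₁ m' e' α R δ := fun R δ => by
    rw [trivSize, trivSize, mul_comm (secLen b₁ R δ)]
  have hgamma : ∀ p q : ℤ × ℤ, (Real.sqrt (u * v * M) *
      r ^ ((p.1 - q.1).natAbs + (p.2 - q.2).natAbs)) ^ 2 =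
      (u * M) * v * scaleRatio (2 ^ p.1) (2 ^ p.2) (2 ^ q.1) (2 ^ q.2) ^ (θ / 2) := by
    intro p q
    rw [mul_pow, Real.sq_sqrt (by positivity), scaleRatio_zpow_two, ← pow_mul, hr,
      ← Real.rpow_natCast, ← Real.rpow_natCast, ← Real.rpow_mul (by norm_num),
      ← Real.rpow_mul (by norm_num)]
    push_cast
    ring_nf
  rw [hsum]
  have hfin := norm_sum_le_of_almostOrthogonal
    (T := fun p : s => kerOp (piece S D a₁ b₁ a₂ b₂ z (2 ^ p.1.1) (2 ^ p.1.2)))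
    (γ := fun p q : s => Real.sqrt (u * v * M) *
      r ^ ((p.1.1 - q.1.1).natAbs + (p.1.2 - q.1.2).natAbs)) (B := Real.sqrt (u * v * M) * G)
    (fun _ _ => by positivity) (by positivity) (fun p q => ?_) (fun p q => ?_) (fun p => ?_)
  · refine hfin.trans ?_
    have h1 : Real.sqrt (u * v * M) ≤ u * v * M := by
      refine Real.sqrt_le_iff.mpr ⟨by positivity, ?_⟩
      have : 1 ≤ u * v * M := by
        have : 1 ≤ u := by linarith
        have : 1 ≤ v := by linarith
        exact one_le_mul_of_one_le_of_one_le (one_le_mul_of_one_le_of_one_le ‹_› ‹_›) hM1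
      nlinarith
    have hG0 : 0 ≤ G := by positivity
    calc _ ≤ u * v * M * (G + 1) := mul_le_mul h1 (by linarith) hG0 (by positivity)
      _ = _ := by ring
  · rw [hgamma]
    have hp := hle _ p.2
    have hq := hle _ q.2
    refine le_of_interpolation (p := _) (q := _) hθ.le hθ1 (norm_nonneg _)
      (one_le_mul_of_one_le_of_one_le (by linarith) hM1) (by linarith)
      (HalfSector.oscSize_nonneg (by positivity) (hpos _))
      (HalfSector.oscSize_nonneg (by positivity) (hpos _))
      (HalfSector.trivSize_nonneg (by positivity) (hpos _))
      (HalfSector.trivSize_nonneg (by positivity) (hpos _))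
      (HalfSector.scaleRatio_pos (by positivity) (hpos _) (by positivity) (hpos _)).le
      ((hn1 z hz _ _ _ _ (hpos _) hp (hpos _) hq).trans ?_)
      ((hn2 z hz _ _ _ _ (hpos _) hp (hpos _) hq).trans ?_) rfl rfl (hm _ _ (hpos _) hp)
      (hm _ _ (hpos _) hq)
    · have o1 := HalfSector.oscSize_nonneg (m := m) (e := e) (m' := m') (e' := e') (α := α)
        (show (0 : ℝ) < 2 ^ p.1.1 by positivity) (hpos p.1)
      have o2 := HalfSector.oscSize_nonneg (m := m) (e := e) (m' := m') (e' := e') (α := α)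
        (show (0 : ℝ) < 2 ^ q.1.1 by positivity) (hpos q.1)
      gcongr; linarith
    · have o1 := HalfSector.trivSize_nonneg (a₁ := a₁) (b₁ := b₁) (m' := m') (e' := e') (α := α)
        (show (0 : ℝ) < 2 ^ p.1.1 by positivity) (hpos p.1)
      have o2 := HalfSector.trivSize_nonneg (a₁ := a₁) (b₁ := b₁) (m' := m') (e' := e') (α := α)
        (show (0 : ℝ) < 2 ^ q.1.1 by positivity) (hpos q.1)
      gcongr; linarith
  · rw [hgamma]
    have hp := hle _ p.2
    have hq := hle _ q.2
    -- the products `T* T'` are products `T T'*` for the pieces with `x` and `y` exchanged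
    rw [hswap p, ← star_star (kerOp (piece S D a₁ b₁ a₂ b₂ z (2 ^ q.1.1) (2 ^ q.1.2))), hswap q]
    have k1 := hn3 (conj z) hzc _ _ _ _ (hpos p.1) hp (hpos q.1) hq
    have k2 := hn4 (conj z) hzc _ _ _ _ (hpos p.1) hp (hpos q.1) hq
    rw [RCLike.norm_conj] at k1
    rw [htriv, htriv] at k2
    refine le_of_interpolation (p := _) (q := _) hθ.le hθ1 (norm_nonneg _)
      (one_le_mul_of_one_le_of_one_le (by linarith) hM1) (by linarith)
      (HalfSector.oscSize_nonneg (by positivity) (hpos _))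
      (HalfSector.oscSize_nonneg (by positivity) (hpos _))
      (HalfSector.trivSize_nonneg (by positivity) (hpos _))
      (HalfSector.trivSize_nonneg (by positivity) (hpos _))
      (HalfSector.scaleRatio_pos (by positivity) (hpos _) (by positivity) (hpos _)).le
      (k1.trans ?_) (k2.trans ?_) rfl rfl (hm _ _ (hpos _) hp) (hm _ _ (hpos _) hq)
    · have o1 := HalfSector.oscSize_nonneg (m := m) (e := e) (m' := m') (e' := e') (α := α)
        (show (0 : ℝ) < 2 ^ p.1.1 by positivity) (hpos p.1)
      have o2 := HalfSector.oscSize_nonneg (m := m) (e := e) (m' := m') (e' := e') (α := α)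
        (show (0 : ℝ) < 2 ^ q.1.1 by positivity) (hpos q.1)
      gcongr; linarith
    · have o1 := HalfSector.trivSize_nonneg (a₁ := a₁) (b₁ := b₁) (m' := m') (e' := e') (α := α)
        (show (0 : ℝ) < 2 ^ p.1.1 by positivity) (hpos p.1)
      have o2 := HalfSector.trivSize_nonneg (a₁ := a₁) (b₁ := b₁) (m' := m') (e' := e') (α := α)
        (show (0 : ℝ) < 2 ^ q.1.1 by positivity) (hpos q.1)
      gcongr; linarith
  · rw [← Finset.mul_sum]
    refine mul_le_mul_of_nonneg_left ?_ (Real.sqrt_nonneg _)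
    rw [Finset.sum_coe_sort s fun q : ℤ × ℤ =>
      r ^ ((p.1.1 - q.1).natAbs + (p.1.2 - q.2).natAbs)]
    exact sum_pow_natAbs_le hr0.le hr1 p.1 s

/-- The geometric mean of the two bounds for a piece, in logarithmic coordinates. -/
theorem oscSize_rpow_mul_trivSize_rpow_le {a₁ b₁ α θ R δ : ℝ} {m e m' e' : ℕ} (hR : 0 < R)
    (hδ : 0 < δ)
    (h : α * (m' * Real.log δ + e' * Real.log R) -
        θ * ((m * Real.log δ + e * Real.log R) / 2) + (1 - θ) *
          (((if a₁ = 0 then Real.log R else Real.log δ) +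
            (if b₁ = 0 then Real.log R else Real.log δ)) / 2) ≤ 0) :
    oscSize m e m' e' α R δ ^ θ * trivSize a₁ b₁ m' e' α R δ ^ (1 - θ) ≤ 1 := by
  have hsec : ∀ a, secLen a R δ = Real.exp (if a = 0 then Real.log R else Real.log δ) := fun a => by
    unfold secLen; split_ifs <;> rw [Real.exp_log (by assumption)]
  have hpow : ∀ i j : ℕ, δ ^ i * R ^ j = Real.exp (i * Real.log δ + j * Real.log R) := fun i j => by
    rw [Real.exp_add, Real.exp_nat_mul, Real.exp_nat_mul, Real.exp_log hδ, Real.exp_log hR]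
  rw [oscSize, trivSize, ampl, hpow, hpow, hsec, hsec, ← Real.exp_add, ← Real.exp_half,
    ← Real.exp_half, ← Real.exp_mul, ← Real.exp_sub, ← Real.exp_add, ← Real.exp_mul,
    ← Real.exp_mul, ← Real.exp_add, Real.exp_le_one_iff]
  refine le_trans (le_of_eq ?_) h
  ring

end DampedOIO

namespace DampedOIO

open scoped Topology ComplexConjugate ENNReal
open Filter

/-! ### `L²` bounds for unbounded kernels -/

/-- Bounded measurable functions with bounded support. -/
def TestFun (f : ℝ → ℂ) : Prop :=
  Measurable f ∧ ∃ R : ℝ, ∀ y, ‖f y‖ ≤ R ∧ (f y ≠ 0 → |y| ≤ R)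

/-- The integral operator with kernel `K` is defined on bounded measurable functions with bounded
support, and bounded by `B` in `L²`. -/
structure L2Bounded (K : ℝ → ℝ → ℂ) (B : ℝ) : Prop where
  meas : Measurable (Function.uncurry K)
  int : ∀ᵐ x : ℝ, ∀ f, TestFun f → Integrable fun y => K x y * f y
  le : ∀ f, TestFun f →
    eLpNorm (fun x => ∫ y, K x y * f y) 2 volume ≤ ENNReal.ofReal B * eLpNorm f 2 volume

namespace TestFun

variable {f g : ℝ → ℂ}

theorem memLp (hf : TestFun f) : MemLp f 2 volume := by
  obtain ⟨h1, R, h2⟩ := hf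
  have hs : f = (Set.Icc (-R) R).indicator f := by
    funext y
    by_cases h : y ∈ Set.Icc (-R) R
    · rw [Set.indicator_of_mem h]
    · rw [Set.indicator_of_notMem h]
      by_contra h0
      exact h (by simpa [Set.mem_Icc, abs_le] using (h2 y).2 h0)
  rw [hs, memLp_indicator_iff_restrict measurableSet_Icc]
  exact MemLp.of_bound h1.aestronglyMeasurable R (.of_forall fun y => (h2 y).1)

theorem integrable_mul (hf : TestFun f) {k : ℝ → ℂ} (hk : LocallyIntegrable k) :
    Integrable fun y => k y * f y := by
  obtain ⟨h1, R, h2⟩ := hf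
  have hk' : Integrable ((Set.Icc (-R) R).indicator k) :=
    (hk.integrableOn_isCompact isCompact_Icc).integrable_indicator measurableSet_Icc
  refine (hk'.mul_bdd (c := R) h1.aestronglyMeasurable (.of_forall fun y => (h2 y).1)).congr
    (.of_forall fun y => ?_)
  by_cases h : f y = 0
  · simp [h]
  · have : y ∈ Set.Icc (-R) R := by simpa [Set.mem_Icc, abs_le] using (h2 y).2 h
    simp [this]

theorem mul_left (hf : TestFun f) {k : ℝ → ℂ} (hk : Measurable k) {C : ℝ} (hC : ∀ y, ‖k y‖ ≤ C) :
    TestFun fun y => k y * f y := by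
  obtain ⟨h1, R, h2⟩ := hf
  have hC0 : 0 ≤ C := (norm_nonneg _).trans (hC 0)
  have hR0 : 0 ≤ R := (norm_nonneg _).trans (h2 0).1
  refine ⟨hk.mul h1, (C + 1) * R, fun y => ⟨?_, fun h => ?_⟩⟩
  · rw [norm_mul]
    have := mul_le_mul (hC y) (h2 y).1 (norm_nonneg _) hC0
    linarith
  · have := (h2 y).2 (right_ne_zero_of_mul h)
    nlinarith

theorem add (hf : TestFun f) (hg : TestFun g) : TestFun (f + g) := by
  obtain ⟨h1, R, h2⟩ := hf
  obtain ⟨h3, R', h4⟩ := hg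
  have hR0 : 0 ≤ R := (norm_nonneg _).trans (h2 0).1
  have hR0' : 0 ≤ R' := (norm_nonneg _).trans (h4 0).1
  refine ⟨h1.add h3, R + R', fun y => ⟨(norm_add_le _ _).trans (add_le_add (h2 y).1 (h4 y).1),
    fun h => ?_⟩⟩
  by_cases h0 : f y = 0
  · have := (h4 y).2 (by simpa [h0] using h)
    linarith
  · have := (h2 y).2 h0
    linarith

theorem const_smul (hf : TestFun f) (c : ℂ) : TestFun (c • f) :=
  hf.mul_left (k := fun _ => c) measurable_const (C := ‖c‖) fun _ => le_rfl

theorem of_continuous (hf : Continuous f) (hs : HasCompactSupport f) : TestFun f := by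
  obtain ⟨R, hR⟩ := hs.isCompact.isBounded.exists_norm_le
  obtain ⟨R', hR'⟩ := hf.bounded_above_of_compact_support hs
  refine ⟨hf.measurable, max R R', fun y => ⟨(hR' y).trans (le_max_right _ _), fun h => ?_⟩⟩
  exact (hR y (subset_tsupport f h)).trans (le_max_left _ _)

end TestFun

namespace L2Bounded

variable {K G : ℝ → ℝ → ℂ} {B B' : ℝ}

theorem mono (hK : L2Bounded K B) (h : B ≤ B') : L2Bounded K B' :=
  ⟨hK.meas, hK.int, fun f hf => (hK.le f hf).trans (by gcongr)⟩

theorem add (hK : L2Bounded K B) (hG : L2Bounded G B') (hB : 0 ≤ B) (hB' : 0 ≤ B') :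
    L2Bounded (fun x y => K x y + G x y) (B + B') := by
  refine ⟨hK.meas.add hG.meas, ?_, fun f hf => ?_⟩
  · filter_upwards [hK.int, hG.int] with x h1 h2 f hf
    simp only [add_mul]
    exact (h1 f hf).add (h2 f hf)
  · have heq : (fun x => ∫ y, (K x y + G x y) * f y) =ᵐ[volume]
        (fun x => ∫ y, K x y * f y) + fun x => ∫ y, G x y * f y := by
      filter_upwards [hK.int, hG.int] with x h1 h2
      simp only [add_mul, Pi.add_apply]
      exact integral_add (h1 f hf) (h2 f hf)
    have m1 : AEStronglyMeasurable (fun x => ∫ y, K x y * f y) volume :=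
      ((hK.meas.mul (hf.1.comp measurable_snd)).stronglyMeasurable.integral_prod_right'
        (ν := (volume : Measure ℝ))).aestronglyMeasurable
    have m2 : AEStronglyMeasurable (fun x => ∫ y, G x y * f y) volume :=
      ((hG.meas.mul (hf.1.comp measurable_snd)).stronglyMeasurable.integral_prod_right'
        (ν := (volume : Measure ℝ))).aestronglyMeasurable
    rw [eLpNorm_congr_ae heq, ENNReal.ofReal_add hB hB', add_mul]
    exact (eLpNorm_add_le m1 m2 (by norm_num)).trans (add_le_add (hK.le f hf) (hG.le f hf))

theorem congr (hK : L2Bounded K B) (hG : Measurable (Function.uncurry G))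
    (h : ∀ᵐ x : ℝ, K x =ᵐ[volume] G x) : L2Bounded G B := by
  refine ⟨hG, ?_, fun f hf => ?_⟩
  · filter_upwards [hK.int, h] with x h1 h2 f hf
    exact (h1 f hf).congr (h2.mono fun y hy => by simp only [hy])
  · refine le_trans (le_of_eq (eLpNorm_congr_ae ?_)) (hK.le f hf)
    filter_upwards [h] with x h2
    exact integral_congr_ae (h2.mono fun y hy => by simp only [hy])

/-- Multiplication of the kernel by a function of `x` bounded by `1`. -/
theorem mul_left (hK : L2Bounded K B) {w : ℝ → ℂ} (hw : Measurable w) (h1 : ∀ x, ‖w x‖ ≤ 1) :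
    L2Bounded (fun x y => w x * K x y) B := by
  refine ⟨(hw.comp measurable_fst).mul hK.meas, ?_, fun f hf => ?_⟩
  · filter_upwards [hK.int] with x h f hf
    simpa only [mul_assoc] using (h f hf).const_mul (w x)
  · refine le_trans (eLpNorm_mono fun x => ?_) (hK.le f hf)
    simp only [mul_assoc]
    rw [integral_const_mul, norm_mul]
    exact mul_le_of_le_one_left (norm_nonneg _) (h1 x)

/-- Multiplication of the kernel by a function of `y` bounded by `1`. -/
theorem mul_right (hK : L2Bounded K B) {w : ℝ → ℂ} (hw : Measurable w) (h1 : ∀ x, ‖w x‖ ≤ 1) :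
    L2Bounded (fun x y => K x y * w y) B := by
  refine ⟨hK.meas.mul (hw.comp measurable_snd), ?_, fun f hf => ?_⟩
  · filter_upwards [hK.int] with x h f hf
    simpa only [mul_assoc] using h _ (hf.mul_left hw h1)
  · simp only [mul_assoc]
    refine (hK.le _ (hf.mul_left hw h1)).trans ?_
    gcongr
    refine eLpNorm_mono fun y => ?_
    rw [norm_mul]
    exact mul_le_of_le_one_left (norm_nonneg _) (h1 y)

theorem of_kerOp (hK : NiceKernel K) (h : ‖kerOp K‖ ≤ B) : L2Bounded K B := by
  refine ⟨hK.meas, .of_forall fun x f hf =>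
    hK.integrable_mul x (hf.memLp.locallyIntegrable (by norm_num)), fun f hf => ?_⟩
  set F := hf.memLp.toLp f with hF
  have h1 : eLpNorm (fun x => ∫ y, K x y * f y) 2 volume = ‖kerOp K F‖ₑ := by
    rw [Lp.enorm_def]
    refine eLpNorm_congr_ae ((kerOp_apply hK F).trans (.of_forall fun x => ?_)).symm
    refine integral_congr_ae ?_
    filter_upwards [hf.memLp.coeFn_toLp] with y hy
    rw [hy]
  have h2 : eLpNorm f 2 volume = ‖F‖ₑ := by
    rw [Lp.enorm_def]
    exact (eLpNorm_congr_ae hf.memLp.coeFn_toLp).symm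
  have h3 : ‖kerOp K F‖ ≤ B * ‖F‖ := (kerOp K).le_of_opNorm_le h F
  rw [h1, h2, ← ofReal_norm, ← ofReal_norm, ← ENNReal.ofReal_mul ((norm_nonneg _).trans h)]
  exact ENNReal.ofReal_le_ofReal h3

/-- Passage to the limit along kernels dominated by the limit kernel. -/
theorem of_tendsto {G : ℕ → ℝ → ℝ → ℂ} (hK : Measurable (Function.uncurry K))
    (hint : ∀ᵐ x : ℝ, ∀ f, TestFun f → Integrable fun y => K x y * f y)
    (hG : ∀ N, L2Bounded (G N) B) (hdom : ∀ N x y, ‖G N x y‖ ≤ ‖K x y‖)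
    (hlim : ∀ x y, Tendsto (fun N => G N x y) atTop (𝓝 (K x y))) : L2Bounded K B := by
  refine ⟨hK, hint, fun f hf => ?_⟩
  refine Lp.eLpNorm_le_of_ae_tendsto (u := atTop) (f := fun N x => ∫ y, G N x y * f y)
    (.of_forall fun N => (hG N).le f hf) (fun N => ?_) ?_
  · exact (((hG N).meas.mul (hf.1.comp measurable_snd)).stronglyMeasurable.integral_prod_right'
        (ν := (volume : Measure ℝ))).aestronglyMeasurable
  · filter_upwards [hint] with x hx
    refine tendsto_integral_of_dominated_convergence (fun y => ‖K x y * f y‖) (fun N => ?_)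
      (hx f hf).norm (fun N => .of_forall fun y => ?_) (.of_forall fun y => ?_)
    · exact (((hG N).meas.comp measurable_prodMk_left).mul hf.1).aestronglyMeasurable
    · rw [norm_mul, norm_mul]; gcongr; exact hdom N x y
    · exact (hlim x y).mul_const _

/-- The functions of `TestFun` as a vector space. -/
def testSpace : Submodule ℂ (ℝ → ℂ) where
  carrier := {f | TestFun f}
  add_mem' hf hg := hf.add hg
  zero_mem' := ⟨measurable_const, 0, by simp⟩
  smul_mem' c _ hf := hf.const_smul c

theorem extendsToL2 (hK : L2Bounded K B) (hB : 0 ≤ B) : ExtendsToL2WithNormLE K B := by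
  have hmem : ∀ f, TestFun f → MemLp (fun x => ∫ y, K x y * f y) 2 volume := fun f hf =>
    ⟨(((hK.meas).mul (hf.1.comp measurable_snd)).stronglyMeasurable.integral_prod_right'
        (ν := (volume : Measure ℝ))).aestronglyMeasurable,
      (hK.le f hf).trans_lt (ENNReal.mul_lt_top ENNReal.ofReal_lt_top hf.memLp.2)⟩
  let e : testSpace →ₗ[ℂ] L2 :=
    { toFun := fun f => (show TestFun f.1 from f.2).memLp.toLp f.1
      map_add' := fun f g => rfl
      map_smul' := fun c f => rfl }
  let F : testSpace →ₗ[ℂ] L2 :=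
    { toFun := fun f => (hmem f.1 f.2).toLp _
      map_add' := fun f g => by
        rw [← MemLp.toLp_add, MemLp.toLp_eq_toLp_iff]
        filter_upwards [hK.int] with x hx
        simp only [Submodule.coe_add, Pi.add_apply, mul_add]
        exact integral_add (hx _ f.2) (hx _ g.2)
      map_smul' := fun c f => by
        rw [RingHom.id_apply, ← MemLp.toLp_const_smul, MemLp.toLp_eq_toLp_iff]
        refine .of_forall fun x => ?_
        simp only [Submodule.coe_smul, Pi.smul_apply, smul_eq_mul]
        rw [← integral_const_mul]
        congr 1; funext y; ring }
  have hdense : DenseRange e := by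
    intro g
    rw [Metric.mem_closure_iff]
    intro ε hε
    obtain ⟨f, hf1, hf2, hf3, hf4⟩ := (Lp.memLp g).exists_hasCompactSupport_eLpNorm_sub_le
      (by norm_num) (ε := ENNReal.ofReal (ε / 2)) (by simpa using hε)
    refine ⟨_, ⟨⟨f, TestFun.of_continuous hf3 hf1⟩, rfl⟩, ?_⟩
    have : dist g (hf4.toLp f) ≤ ε / 2 := by
      rw [← ENNReal.ofReal_le_ofReal_iff (by positivity), ← edist_dist, Lp.edist_def]
      refine le_trans (le_of_eq (eLpNorm_congr_ae ?_)) hf2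
      exact EventuallyEq.rfl.sub hf4.coeFn_toLp
    exact this.trans_lt (by linarith)
  have hbound : ∀ f, ‖F f‖ ≤ B * ‖e f‖ := by
    intro f
    have h1 : ‖F f‖ₑ = eLpNorm (fun x => ∫ y, K x y * f.1 y) 2 volume := by
      rw [Lp.enorm_def]; exact eLpNorm_congr_ae (hmem f.1 f.2).coeFn_toLp
    have h2 : ‖e f‖ₑ = eLpNorm f.1 2 volume := by
      rw [Lp.enorm_def]; exact eLpNorm_congr_ae (show TestFun f.1 from f.2).memLp.coeFn_toLp
    have h3 := hK.le f.1 f.2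
    rwa [← h1, ← h2, ← ofReal_norm, ← ofReal_norm, ← ENNReal.ofReal_mul hB,
      ENNReal.ofReal_le_ofReal_iff (by positivity)] at h3
  refine ⟨F.extendOfNorm e, LinearMap.opNorm_extendOfNorm_le hdense hB hbound, ?_⟩
  intro f hf1 hf2 hf
  have hT : TestFun f := TestFun.of_continuous hf1.continuous hf2
  refine ⟨hK.int.mono fun x hx => hx f hT, ?_⟩
  have : (F.extendOfNorm e) (hf.toLp f) = F ⟨f, hT⟩ :=
    LinearMap.extendOfNorm_eq hdense ⟨B, hbound⟩ ⟨f, hT⟩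
  rw [this]
  exact (hmem f hT).coeFn_toLp

end L2Bounded

end DampedOIO

namespace DampedOIO

open scoped Topology ComplexConjugate ENNReal
open Filter

/-! ### From dyadic sums to a sector -/

/-- The integers from `-N` to `N - 1`. -/
def dyadicRange (N : ℕ) : Finset ℤ :=
  (Finset.range (2 * N)).map ⟨fun i : ℕ => (i : ℤ) - N, fun i j h => by simpa using h⟩

theorem sum_bump_dyadicRange (N : ℕ) (s : ℝ) : ∑ j ∈ dyadicRange N, bump (s / 2 ^ j) =
    step (s / 2 ^ ((N : ℤ) - 1)) - step (s / 2 ^ (-(N : ℤ) - 1)) := by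
  have h := Finset.sum_range_sub (fun i : ℕ => step (s / 2 ^ ((i : ℤ) - N - 1))) (2 * N)
  rw [dyadicRange, Finset.sum_map]
  convert h using 1
  · refine Finset.sum_congr rfl fun i _ => ?_
    show bump (s / 2 ^ ((i : ℤ) - N)) = _
    rw [bump, show ((i + 1 : ℕ) : ℤ) - N - 1 = (i : ℤ) - N by push_cast; ring,
      zpow_sub_one₀ two_ne_zero ((i : ℤ) - N)]
    congr 2
    field_simp
  · push_cast; ring_nf

theorem sum_bump_nonneg (N : ℕ) (s : ℝ) : 0 ≤ ∑ j ∈ dyadicRange N, bump (s / 2 ^ j) :=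
  Finset.sum_nonneg fun _ _ => bump_nonneg _

theorem sum_bump_le_one (N : ℕ) (s : ℝ) : ∑ j ∈ dyadicRange N, bump (s / 2 ^ j) ≤ 1 := by
  rw [sum_bump_dyadicRange]
  linarith [step_le_one (s / 2 ^ ((N : ℤ) - 1)), step_nonneg (s / 2 ^ (-(N : ℤ) - 1))]

theorem eventually_sum_bump_eq (s : ℝ) :
    ∀ᶠ N in atTop, ∑ j ∈ dyadicRange N, bump (s / 2 ^ j) = if 0 < s then 1 else 0 := by
  split_ifs with hs
  · have h1 : ∀ᶠ N : ℕ in atTop, 2 * s ≤ (2 : ℝ) ^ N :=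
      (tendsto_pow_atTop_atTop_of_one_lt one_lt_two).eventually_ge_atTop _
    have h2 : ∀ᶠ N : ℕ in atTop, s⁻¹ ≤ (2 : ℝ) ^ N :=
      (tendsto_pow_atTop_atTop_of_one_lt one_lt_two).eventually_ge_atTop _
    filter_upwards [h1, h2] with N h1 h2
    rw [sum_bump_dyadicRange, step_of_le, step_of_ge, sub_zero]
    · rw [zpow_sub_one₀ two_ne_zero, zpow_neg, zpow_natCast, le_div_iff₀ (by positivity)]
      rw [inv_le_iff_one_le_mul₀ hs] at h2
      field_simp; linarith
    · rw [zpow_sub_one₀ two_ne_zero, zpow_natCast, div_le_one (by positivity)]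
      linarith
  · refine .of_forall fun N => Finset.sum_eq_zero fun j _ => bump_of_le ?_
    exact (div_nonpos_of_nonpos_of_nonneg (not_lt.mp hs) (by positivity)).trans (by norm_num)

/-- Uniform boundedness of the finite sums of pieces with `L₁ ∼ 2 ^ k`, `L₂ ∼ 2 ^ j`, `k ≤ j`. -/
def HalfSummable (S D : ℝ → ℝ → ℝ) (a₁ b₁ a₂ b₂ α : ℝ) : Prop :=
  ∃ B : ℝ, 0 < B ∧ ∀ z : ℂ, z.re = α → ∀ s : Finset (ℤ × ℤ), (∀ p ∈ s, p.2 ≤ p.1) →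
    NiceKernel (fun x y => ∑ p ∈ s, piece S D a₁ b₁ a₂ b₂ z (2 ^ p.1) (2 ^ p.2) x y) ∧
    ‖kerOp fun x y => ∑ p ∈ s, piece S D a₁ b₁ a₂ b₂ z (2 ^ p.1) (2 ^ p.2) x y‖ ≤ B * (1 + ‖z‖)

theorem piece_swap_forms (S D : ℝ → ℝ → ℝ) (a₁ b₁ a₂ b₂ : ℝ) (z : ℂ) (R δ x y : ℝ) :
    piece S D a₁ b₁ a₂ b₂ z R δ x y = piece S D a₂ b₂ a₁ b₁ z δ R x y := by
  simp only [piece, cell, mul_comm (bump (lin a₂ b₂ x y / R))]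

open Classical in
/-- The restriction of a kernel to the sector `0 < L₁`, `0 < L₂`. -/
noncomputable def restrictSector (a₁ b₁ a₂ b₂ : ℝ) (K : ℝ → ℝ → ℂ) (x y : ℝ) : ℂ :=
  if 0 < lin a₁ b₁ x y ∧ 0 < lin a₂ b₂ x y then K x y else 0

theorem measurableSet_sector (a₁ b₁ a₂ b₂ : ℝ) :
    MeasurableSet {p : ℝ × ℝ | 0 < lin a₁ b₁ p.1 p.2 ∧ 0 < lin a₂ b₂ p.1 p.2} :=
  ((isOpen_lt continuous_const (continuous_uncurry_lin a₁ b₁)).inter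
    (isOpen_lt continuous_const (continuous_uncurry_lin a₂ b₂))).measurableSet

theorem measurable_restrictSector {K : ℝ → ℝ → ℂ} (hK : Measurable (Function.uncurry K))
    (a₁ b₁ a₂ b₂ : ℝ) : Measurable (Function.uncurry (restrictSector a₁ b₁ a₂ b₂ K)) :=
  Measurable.ite (measurableSet_sector a₁ b₁ a₂ b₂) hK measurable_const

theorem restrictSector_eq_mul (a₁ b₁ a₂ b₂ : ℝ) (K : ℝ → ℝ → ℂ) (x y : ℝ) :
    restrictSector a₁ b₁ a₂ b₂ K x y = K x y * (((if 0 < lin a₂ b₂ x y then 1 else 0 : ℝ) *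
      (if 0 < lin a₁ b₁ x y then 1 else 0 : ℝ) : ℝ) : ℂ) := by
  unfold restrictSector
  by_cases h1 : 0 < lin a₁ b₁ x y <;> by_cases h2 : 0 < lin a₂ b₂ x y <;> simp [h1, h2]

theorem integrable_restrictSector {K : ℝ → ℝ → ℂ} (a₁ b₁ a₂ b₂ : ℝ) {x : ℝ}
    (h : ∀ f, TestFun f → Integrable fun y => K x y * f y) (f : ℝ → ℂ) (hf : TestFun f) :
    Integrable fun y => restrictSector a₁ b₁ a₂ b₂ K x y * f y := by
  have hm : Measurable fun y => (((if 0 < lin a₂ b₂ x y then 1 else 0 : ℝ) *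
      (if 0 < lin a₁ b₁ x y then 1 else 0 : ℝ) : ℝ) : ℂ) := by
    refine Complex.measurable_ofReal.comp (Measurable.mul ?_ ?_)
    · exact Measurable.ite (isOpen_lt continuous_const (continuous_lin a₂ b₂ x)).measurableSet
        measurable_const measurable_const
    · exact Measurable.ite (isOpen_lt continuous_const (continuous_lin a₁ b₁ x)).measurableSet
        measurable_const measurable_const
  simpa only [restrictSector_eq_mul, mul_assoc] using h _ (hf.mul_left hm (C := 1) fun y => by
    split_ifs <;> simp)

/-- A sector is the union of its two halves. -/
theorem exists_l2Bounded_restrictSector {S D : ℝ → ℝ → ℝ} {a₁ b₁ a₂ b₂ α : ℝ}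
    (hS : Continuous (Function.uncurry S)) (hD : Continuous (Function.uncurry D))
    (hint : ∀ z : ℂ, z.re = α →
      ∀ᵐ x : ℝ, ∀ f, TestFun f → Integrable fun y => kernel S D z x y * f y)
    (h1 : HalfSummable S D a₁ b₁ a₂ b₂ α) (h2 : HalfSummable S D a₂ b₂ a₁ b₁ α) :
    ∃ B : ℝ, 0 < B ∧ ∀ z : ℂ, z.re = α →
      L2Bounded (restrictSector a₁ b₁ a₂ b₂ (kernel S D z)) (B * (1 + ‖z‖)) := by
  obtain ⟨B1, hB1, h1⟩ := h1
  obtain ⟨B2, hB2, h2⟩ := h2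
  refine ⟨B1 + B2, by positivity, fun z hz => ?_⟩
  set box : ℕ → Finset (ℤ × ℤ) := fun N => dyadicRange N ×ˢ dyadicRange N with hbox
  set G : ℕ → ℝ → ℝ → ℂ := fun N x y =>
    ∑ p ∈ box N, piece S D a₁ b₁ a₂ b₂ z (2 ^ p.1) (2 ^ p.2) x y with hG
  have hfac : ∀ N x y, G N x y = kernel S D z x y *
      (((∑ j ∈ dyadicRange N, bump (lin a₂ b₂ x y / 2 ^ j)) *
        ∑ k ∈ dyadicRange N, bump (lin a₁ b₁ x y / 2 ^ k) : ℝ) : ℂ) := by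
    intro N x y
    simp only [hG, hbox, piece, cell, ← Finset.mul_sum, ← Complex.ofReal_sum,
      Finset.sum_product, Finset.sum_mul_sum]
  -- the cells with `L₁ ≤ L₂` and those with `L₂ < L₁`, where the two forms change roles
  have hGb : ∀ N, L2Bounded (G N) ((B1 + B2) * (1 + ‖z‖)) := by
    intro N
    obtain ⟨k1, l1⟩ := h1 z hz ((box N).filter fun p => p.2 ≤ p.1) fun p hp =>
      (Finset.mem_filter.mp hp).2
    obtain ⟨k2, l2⟩ := h2 z hz (((box N).filter fun p => ¬ p.2 ≤ p.1).map
      (Equiv.prodComm ℤ ℤ).toEmbedding) fun p hp => by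
        obtain ⟨q, hq, rfl⟩ := Finset.mem_map.mp hp
        have := (Finset.mem_filter.mp hq).2
        simp only [Equiv.coe_toEmbedding, Equiv.prodComm_apply, Prod.fst_swap, Prod.snd_swap]
        omega
    have := (L2Bounded.of_kerOp k1 l1).add (L2Bounded.of_kerOp k2 l2) (by positivity)
      (by positivity)
    rw [← add_mul] at this
    refine this.congr ?_ (.of_forall fun x => .of_forall fun y => ?_)
    · have heq : Function.uncurry (G N) = Function.uncurry (kernel S D z) * fun p =>
          (((∑ j ∈ dyadicRange N, bump (lin a₂ b₂ p.1 p.2 / 2 ^ j)) *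
          ∑ k ∈ dyadicRange N, bump (lin a₁ b₁ p.1 p.2 / 2 ^ k) : ℝ) : ℂ) := by
        funext p; exact hfac N p.1 p.2
      rw [heq]
      refine (measurable_kernel hS hD z).mul (Complex.measurable_ofReal.comp
        (Continuous.measurable ?_))
      refine Continuous.mul (continuous_finsetSum _ fun j _ => ?_)
        (continuous_finsetSum _ fun j _ => ?_)
      · exact continuous_bump.comp ((continuous_uncurry_lin a₂ b₂).div_const _)
      · exact continuous_bump.comp ((continuous_uncurry_lin a₁ b₁).div_const _)
    · simp only [hG, Finset.sum_map, Equiv.coe_toEmbedding, Equiv.prodComm_apply, Prod.fst_swap,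
        Prod.snd_swap]
      rw [← Finset.sum_filter_add_sum_filter_not (box N) fun p => p.2 ≤ p.1]
      congr 1
      exact Finset.sum_congr rfl fun p _ => piece_swap_forms ..
  refine L2Bounded.of_tendsto (measurable_restrictSector (measurable_kernel hS hD z) ..)
    ((hint z hz).mono fun x hx => integrable_restrictSector _ _ _ _ hx) hGb (fun N x y => ?_)
    fun x y => ?_
  · rw [hfac, restrictSector_eq_mul, norm_mul, norm_mul]
    refine mul_le_mul_of_nonneg_left ?_ (norm_nonneg _)
    have n1 := sum_bump_nonneg N (lin a₁ b₁ x y)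
    have n2 := sum_bump_nonneg N (lin a₂ b₂ x y)
    have n3 := sum_bump_le_one N (lin a₁ b₁ x y)
    have n4 := sum_bump_le_one N (lin a₂ b₂ x y)
    have z0 : ∀ s : ℝ, ¬ 0 < s → ∑ j ∈ dyadicRange N, bump (s / 2 ^ j) = 0 := fun s hs =>
      Finset.sum_eq_zero fun j _ => bump_of_le
        ((div_nonpos_of_nonpos_of_nonneg (not_lt.mp hs) (by positivity)).trans (by norm_num))
    rw [Complex.norm_real, Complex.norm_real, Real.norm_eq_abs, Real.norm_eq_abs,
      abs_of_nonneg (mul_nonneg n2 n1)]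
    by_cases p1 : 0 < lin a₁ b₁ x y
    · by_cases p2 : 0 < lin a₂ b₂ x y
      · simp only [p1, p2, if_true, mul_one, abs_one]
        exact mul_le_one₀ n4 n1 n3
      · rw [z0 _ p2, zero_mul]; positivity
    · rw [z0 _ p1, mul_zero]; positivity
  · refine Filter.Tendsto.congr' ?_ tendsto_const_nhds
    filter_upwards [eventually_sum_bump_eq (lin a₁ b₁ x y),
      eventually_sum_bump_eq (lin a₂ b₂ x y)] with N e1 e2
    rw [hfac, e1, e2, restrictSector_eq_mul]

/-! ### Smooth cutoffs -/

/-- Multiplying the kernel by a smooth compactly supported function preserves `L²` bounds: the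
cutoff is a superposition of functions of `x` times half-lines in `y`. -/
theorem exists_l2Bounded_mul_smooth {φ : ℝ × ℝ → ℂ} (hφ : ContDiff ℝ ∞ φ)
    (hs : HasCompactSupport φ) : ∃ C : ℝ, 0 < C ∧ ∀ K B, 0 ≤ B → L2Bounded K B →
      L2Bounded (fun x y => K x y * φ (x, y)) (C * B) := by
  -- the partial derivative in the second variable
  set ψ : ℝ × ℝ → ℂ := fun p => fderiv ℝ φ p (0, 1) with hψ
  have hψc : Continuous ψ := (hφ.continuous_fderiv (by simp)).clm_apply continuous_const
  have hψs : HasCompactSupport ψ := (hs.fderiv (𝕜 := ℝ)).comp_left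
    (g := fun A : ℝ × ℝ →L[ℝ] ℂ => A (0, 1)) (by simp)
  obtain ⟨M, hM⟩ := hψc.bounded_above_of_compact_support hψs
  obtain ⟨R, hR⟩ := hψs.isCompact.isBounded.exists_norm_le
  obtain ⟨M', hM'⟩ := hφ.continuous.bounded_above_of_compact_support hs
  have hM0 : 0 ≤ M := (norm_nonneg _).trans (hM 0)
  set R1 := |R| with hR1
  have hψR : ∀ x v, ψ (x, v) ≠ 0 → |v| ≤ R1 := fun x v h => by
    have := hR (x, v) (subset_tsupport ψ h)
    exact ((le_max_right _ _).trans this).trans (le_abs_self _)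
  have hrep : ∀ x y, φ (x, y) = ∫ v, (if v ≤ y then ψ (x, v) else 0) := by
    intro x y
    have hd : ∀ v, HasDerivAt (fun v => φ (x, v)) (ψ (x, v)) v := fun v =>
      ((hφ.differentiable (by simp)) (x, v)).hasFDerivAt.comp_hasDerivAt v
        ((hasDerivAt_const v x).prodMk (hasDerivAt_id v))
    have hd' : deriv (fun v => φ (x, v)) = fun v => ψ (x, v) := funext fun v => (hd v).deriv
    have hc : HasCompactSupport fun v => φ (x, v) := by
      obtain ⟨R', hR'⟩ := hs.isCompact.isBounded.exists_norm_le
      refine HasCompactSupport.intro (isCompact_closedBall (0 : ℝ) R') fun v hv => ?_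
      by_contra h
      refine hv (mem_closedBall_zero_iff.mpr ?_)
      exact (le_max_right _ _).trans (hR' (x, v) (subset_tsupport φ h))
    have h1 : ContDiff ℝ 1 fun v => φ (x, v) :=
      (hφ.of_le (by simp)).comp (contDiff_const.prodMk contDiff_id)
    have := hc.integral_Iic_deriv_eq h1 y
    rw [hd'] at this
    rw [← this, ← integral_indicator measurableSet_Iic]
    rfl
  set k : ℝ → ℝ≥0∞ := (Set.Icc (-R1) R1).indicator fun _ => ENNReal.ofReal M with hk
  have hkm : Measurable k := measurable_const.indicator measurableSet_Icc
  have hkint : ∫⁻ v, k v = ENNReal.ofReal (2 * R1 * M) := by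
    rw [hk, lintegral_indicator measurableSet_Icc, setLIntegral_const, Real.volume_Icc,
      ← ENNReal.ofReal_mul hM0]
    congr 1; ring
  have hψk : ∀ x v, ‖ψ (x, v)‖ₑ ≤ k v := fun x v => by
    by_cases h : ψ (x, v) = 0
    · simp [h]
    · rw [hk, Set.indicator_of_mem (by simpa [Set.mem_Icc, abs_le] using hψR x v h), ← ofReal_norm]
      exact ENNReal.ofReal_le_ofReal (hM _)
  refine ⟨2 * R1 * M + 1, by positivity, fun K B hB hK => ?_⟩
  have hφm : ∀ x, Measurable fun y => φ (x, y) := fun x =>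
    hφ.continuous.measurable.comp measurable_prodMk_left
  refine ⟨hK.meas.mul (hφ.continuous.measurable.comp (measurable_fst.prodMk measurable_snd)),
    ?_, fun f hf => ?_⟩
  · filter_upwards [hK.int] with x hx f hf
    simpa only [mul_assoc] using hx _ (hf.mul_left (hφm x) fun y => hM' (x, y))
  set fv : ℝ → ℝ → ℂ := fun v y => (if v ≤ y then 1 else 0) * f y with hfv
  have hite : ∀ v, Measurable fun y : ℝ => (if v ≤ y then 1 else 0 : ℂ) := fun v =>
    Measurable.ite measurableSet_Ici measurable_const measurable_const
  have hite1 : ∀ v y : ℝ, ‖(if v ≤ y then 1 else 0 : ℂ)‖ ≤ 1 := fun v y => by split_ifs <;> simp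
  have hfvT : ∀ v, TestFun (fv v) := fun v => hf.mul_left (hite v) (hite1 v)
  have hfvle : ∀ v, eLpNorm (fv v) 2 volume ≤ eLpNorm f 2 volume := fun v =>
    eLpNorm_mono fun y => by
      rw [hfv, norm_mul]; exact mul_le_of_le_one_left (norm_nonneg _) (hite1 v y)
  set g : ℝ → ℝ → ℂ := fun x v => ∫ y, K x y * fv v y with hg
  have hgm : Measurable (Function.uncurry g) := by
    have : StronglyMeasurable fun q : (ℝ × ℝ) × ℝ => K q.1.1 q.2 * fv q.1.2 q.2 := by
      refine Measurable.stronglyMeasurable (Measurable.mul (hK.meas.comp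
        (measurable_fst.fst.prodMk measurable_snd)) (Measurable.mul ?_ (hf.1.comp measurable_snd)))
      exact Measurable.ite (measurableSet_le measurable_fst.snd measurable_snd) measurable_const
        measurable_const
    exact (this.integral_prod_right' (ν := (volume : Measure ℝ))).measurable
  have hpt : ∀ᵐ x : ℝ, ‖∫ y, K x y * φ (x, y) * f y‖ₑ ^ 2 ≤
      ENNReal.ofReal (2 * R1 * M) * ∫⁻ v, k v * ‖g x v‖ₑ ^ 2 := by
    filter_upwards [hK.int] with x hx
    have hψi : Integrable fun v => ψ (x, v) := by
      refine (Continuous.comp hψc (by fun_prop : Continuous fun v : ℝ => (x, v))).integrable_of_hasCompactSupport ?_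
      refine HasCompactSupport.intro (isCompact_Icc (a := -R1) (b := R1)) fun v hv => ?_
      by_contra h
      exact hv (by simpa [Set.mem_Icc, abs_le] using hψR x v h)
    have hprod : Integrable (Function.uncurry fun y v => K x y * fv v y * ψ (x, v))
        (volume.prod volume) := by
      have h0 := (hx f hf).mul_prod hψi
      have h1 : Measurable fun p : ℝ × ℝ => (if p.2 ≤ p.1 then 1 else 0 : ℂ) :=
        Measurable.ite (measurableSet_le measurable_snd measurable_fst) measurable_const
          measurable_const
      refine (h0.bdd_mul (c := 1) h1.aestronglyMeasurable
        (.of_forall fun p => hite1 p.2 p.1)).congr (.of_forall fun p => ?_)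
      simp only [Function.uncurry, hfv]
      ring
    have hswap : ∫ y, K x y * φ (x, y) * f y = ∫ v, g x v * ψ (x, v) := by
      calc _ = ∫ y, ∫ v, K x y * fv v y * ψ (x, v) := by
            refine integral_congr_ae (.of_forall fun y => ?_)
            simp only
            rw [hrep, mul_right_comm, ← integral_const_mul]
            refine integral_congr_ae (.of_forall fun v => ?_)
            simp only [hfv]
            split_ifs <;> ring
        _ = ∫ v, ∫ y, K x y * fv v y * ψ (x, v) := integral_integral_swap hprod
        _ = _ := by
            refine integral_congr_ae (.of_forall fun v => ?_)
            simp only [hg]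
            rw [integral_mul_const]
    rw [hswap, ← hkint]
    have hgx : Measurable (g x) := hgm.comp measurable_prodMk_left
    refine le_trans ?_ (lintegral_mul_sq_le (μ := volume) hkm.aemeasurable
      (g := fun v => ‖g x v‖ₑ) hgx.enorm.aemeasurable)
    gcongr
    refine (enorm_integral_le_lintegral_enorm _).trans (lintegral_mono fun v => ?_)
    rw [enorm_mul, mul_comm]
    gcongr
    exact hψk x v
  rw [← ENNReal.pow_le_pow_left_iff (n := 2) two_ne_zero]
  calc eLpNorm (fun x => ∫ y, K x y * φ (x, y) * f y) 2 volume ^ 2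
      = ∫⁻ x, ‖∫ y, K x y * φ (x, y) * f y‖ₑ ^ 2 := eLpNorm_two_sq
    _ ≤ ∫⁻ x, ENNReal.ofReal (2 * R1 * M) * ∫⁻ v, k v * ‖g x v‖ₑ ^ 2 := lintegral_mono_ae hpt
    _ = ENNReal.ofReal (2 * R1 * M) * ∫⁻ v, ∫⁻ x, k v * ‖g x v‖ₑ ^ 2 := by
        rw [lintegral_const_mul' _ _ ENNReal.ofReal_ne_top, lintegral_lintegral_swap]
        exact ((hkm.comp measurable_snd).mul (hgm.enorm.pow_const 2)).aemeasurable
    _ ≤ ENNReal.ofReal (2 * R1 * M) * ∫⁻ v, k v * (ENNReal.ofReal B * eLpNorm f 2 volume) ^ 2 := by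
        gcongr with v
        have hgv : Measurable fun x => g x v := hgm.comp measurable_prodMk_right
        rw [lintegral_const_mul _ (hgv.enorm.pow_const 2), ← eLpNorm_two_sq]
        gcongr
        exact (hK.le _ (hfvT v)).trans (by gcongr; exact hfvle v)
    _ = (ENNReal.ofReal (2 * R1 * M) * (ENNReal.ofReal B * eLpNorm f 2 volume)) ^ 2 := by
        rw [lintegral_mul_const _ hkm, hkint]; ring
    _ ≤ (ENNReal.ofReal ((2 * R1 * M + 1) * B) * eLpNorm f 2 volume) ^ 2 := by
        rw [← mul_assoc, ← ENNReal.ofReal_mul (by positivity)]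
        gcongr
        linarith

end DampedOIO

namespace DampedOIO

open scoped Topology

/-! ### Homogeneous factors in a half-sector -/

/-- In the half-sector `0 < L₁ < 16 L₂` the function `F` is comparable to `L₁ ^ i L₂ ^ j`, and a
derivative in `y` costs `1 / L₁`, or `1 / L₂` if `L₁` does not depend on `y`. -/
structure Tame (F : ℝ → ℝ → ℝ) (a₁ b₁ a₂ b₂ : ℝ) (i j : ℕ) (C : ℝ) : Prop where
  one_le : 1 ≤ C
  lower : ∀ x y, y ∈ sectorSlice a₁ b₁ a₂ b₂ 0 0 x →
    C⁻¹ * (lin a₁ b₁ x y ^ i * lin a₂ b₂ x y ^ j) ≤ |F x y|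
  upper : ∀ x y, y ∈ sectorSlice a₁ b₁ a₂ b₂ 0 0 x →
    |F x y| ≤ C * (lin a₁ b₁ x y ^ i * lin a₂ b₂ x y ^ j)
  rel : ∀ x t s, 0 < t → 0 < s →
    RelOn (F x) (sectorSlice a₁ b₁ a₂ b₂ t s x) (C / if a₁ = 0 then s else t)

namespace Tame

variable {F G : ℝ → ℝ → ℝ} {a₁ b₁ a₂ b₂ : ℝ} {i j i' j' : ℕ} {C C' : ℝ}

theorem scale_pos {t s : ℝ} (ht : 0 < t) (hs : 0 < s) : 0 < if a₁ = 0 then s else t := by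
  split_ifs <;> assumption

theorem scale_le {t s x y : ℝ} (hs : 0 < s) (hy : y ∈ sectorSlice a₁ b₁ a₂ b₂ t s x) :
    (if a₁ = 0 then s else t) ≤ 16 * lin a₂ b₂ x y := by
  obtain ⟨h1, h2, h3⟩ := hy
  split_ifs <;> linarith

theorem sectorSlice_subset {t s x : ℝ} (ht : 0 < t) (hs : 0 < s) :
    sectorSlice a₁ b₁ a₂ b₂ t s x ⊆ sectorSlice a₁ b₁ a₂ b₂ 0 0 x :=
  fun _ hy => ⟨ht.trans hy.1, hs.trans hy.2.1, hy.2.2⟩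

theorem mono (hF : Tame F a₁ b₁ a₂ b₂ i j C) (h : C ≤ C') : Tame F a₁ b₁ a₂ b₂ i j C' := by
  have hC := hF.one_le
  have hC0 : 0 < C := by linarith
  refine ⟨hC.trans h, fun x y hy => le_trans ?_ (hF.lower x y hy),
    fun x y hy => (hF.upper x y hy).trans ?_, fun x t s ht hs =>
      (hF.rel x t s ht hs).mono subset_rfl (div_nonneg hC0.le (scale_pos ht hs).le) ?_⟩
  · have g1 : 0 < lin a₁ b₁ x y := hy.1
    have g2 : 0 < lin a₂ b₂ x y := hy.2.1
    gcongr
  · have g1 : 0 < lin a₁ b₁ x y := hy.1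
    have g2 : 0 < lin a₂ b₂ x y := hy.2.1
    gcongr
  · have := scale_pos (a₁ := a₁) ht hs
    gcongr

theorem mul (hF : Tame F a₁ b₁ a₂ b₂ i j C) (hG : Tame G a₁ b₁ a₂ b₂ i' j' C') :
    Tame (fun x y => F x y * G x y) a₁ b₁ a₂ b₂ (i + i') (j + j') (2 * (C * C')) := by
  have hC := hF.one_le
  have hC' := hG.one_le
  have hC0 : 0 < C := by linarith
  have hC0' : 0 < C' := by linarith
  have hCC : 1 ≤ C * C' := one_le_mul_of_one_le_of_one_le hC hC'
  have hCC2 : C * C' ≤ 2 * (C * C') := by linarith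
  refine ⟨by linarith, fun x y hy => ?_, fun x y hy => ?_, fun x t s ht hs => ?_⟩
  · have g1 : 0 < lin a₁ b₁ x y := hy.1
    have g2 : 0 < lin a₂ b₂ x y := hy.2.1
    rw [abs_mul]
    refine le_trans ?_ (mul_le_mul (hF.lower x y hy) (hG.lower x y hy) (by positivity)
      (abs_nonneg _))
    calc (2 * (C * C'))⁻¹ * (lin a₁ b₁ x y ^ (i + i') * lin a₂ b₂ x y ^ (j + j'))
        ≤ (C * C')⁻¹ * (lin a₁ b₁ x y ^ (i + i') * lin a₂ b₂ x y ^ (j + j')) :=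
          mul_le_mul_of_nonneg_right (inv_anti₀ (by positivity) hCC2) (by positivity)
      _ = _ := by rw [mul_inv, pow_add, pow_add]; ring
  · have g1 : 0 < lin a₁ b₁ x y := hy.1
    have g2 : 0 < lin a₂ b₂ x y := hy.2.1
    rw [abs_mul]
    refine (mul_le_mul (hF.upper x y hy) (hG.upper x y hy) (abs_nonneg _) (by positivity)).trans ?_
    calc _ = (C * C') * (lin a₁ b₁ x y ^ (i + i') * lin a₂ b₂ x y ^ (j + j')) := by
          rw [pow_add, pow_add]; ring
      _ ≤ _ := mul_le_mul_of_nonneg_right hCC2 (by positivity)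
  · have hp := scale_pos (a₁ := a₁) ht hs
    refine ((hF.rel x t s ht hs).mul (hG.rel x t s ht hs) (by positivity)).mono subset_rfl
      (by positivity) ?_
    rw [← add_div]
    gcongr
    nlinarith

theorem const {c : ℝ} (hc : c ≠ 0) : ∃ C, Tame (fun _ _ => c) a₁ b₁ a₂ b₂ 0 0 C := by
  have hp : 0 < |c| := abs_pos.mpr hc
  refine ⟨1 + |c| + |c|⁻¹, ?_, fun x y _ => ?_, fun x y _ => ?_, fun x t s ht hs => ?_⟩
  · have : 0 < |c|⁻¹ := by positivity
    linarith
  · rw [pow_zero, pow_zero, mul_one, mul_one]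
    refine inv_le_of_inv_le₀ hp ?_
    linarith
  · rw [pow_zero, pow_zero, mul_one, mul_one]
    have : 0 < |c|⁻¹ := by positivity
    linarith
  · have hs := scale_pos (a₁ := a₁) ht hs
    exact (RelOn.const hc _).mono subset_rfl le_rfl (by positivity)

theorem pow (hF : Tame F a₁ b₁ a₂ b₂ i j C) (k : ℕ) :
    ∃ C', Tame (fun x y => F x y ^ k) a₁ b₁ a₂ b₂ (k * i) (k * j) C' := by
  induction k with
  | zero => simpa using Tame.const one_ne_zero
  | succ k ih =>
    obtain ⟨C', h⟩ := ih
    exact ⟨_, by simpa only [pow_succ, Nat.succ_mul] using h.mul hF⟩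

theorem prod {ι : Type*} (s : Finset ι) {F : ι → ℝ → ℝ → ℝ} {i j : ι → ℕ}
    (hF : ∀ k ∈ s, ∃ C, Tame (F k) a₁ b₁ a₂ b₂ (i k) (j k) C) :
    ∃ C, Tame (fun x y => ∏ k ∈ s, F k x y) a₁ b₁ a₂ b₂ (∑ k ∈ s, i k) (∑ k ∈ s, j k) C := by
  classical
  induction s using Finset.induction_on with
  | empty => simpa using Tame.const one_ne_zero
  | insert k s hk ih =>
    obtain ⟨C, h1⟩ := ih fun k' hk' => hF k' (Finset.mem_insert_of_mem hk')
    obtain ⟨C', h2⟩ := hF k (Finset.mem_insert_self k s)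
    exact ⟨_, by simpa only [Finset.prod_insert hk, Finset.sum_insert hk] using h2.mul h1⟩

/-- The form vanishing on the bounding line `L₁ = 0`. -/
theorem lin_left {p : ℝ} (hp : p ≠ 0) :
    ∃ C, Tame (lin (p * a₁) (p * b₁)) a₁ b₁ a₂ b₂ 1 0 C := by
  have hp0 : 0 < |p| := abs_pos.mpr hp
  have heq : ∀ x y, lin (p * a₁) (p * b₁) x y = p * lin a₁ b₁ x y := fun x y => by
    unfold lin; ring
  refine ⟨1 + |p| + |p|⁻¹ + |a₁|, ?_, fun x y hy => ?_, fun x y hy => ?_, fun x t s ht hs => ?_⟩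
  · have : 0 < |p|⁻¹ := by positivity
    linarith [abs_nonneg a₁]
  · have g1 : 0 < lin a₁ b₁ x y := hy.1
    rw [heq, abs_mul, abs_of_pos g1, pow_zero, mul_one, pow_one]
    gcongr
    refine inv_le_of_inv_le₀ hp0 ?_
    linarith [abs_nonneg a₁]
  · have g1 : 0 < lin a₁ b₁ x y := hy.1
    rw [heq, abs_mul, abs_of_pos g1, pow_zero, mul_one, pow_one]
    gcongr
    have : 0 < |p|⁻¹ := by positivity
    linarith [abs_nonneg a₁]
  · have hsc := scale_pos (a₁ := a₁) ht hs
    refine ⟨fun _ => p * a₁, fun _ => 0, fun y hy => ⟨?_, hasDerivAt_const _ _, ?_, ?_, ?_⟩⟩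
    · exact (((hasDerivAt_id y).const_mul (p * a₁)).add_const _).congr_deriv (by simp)
    · rw [heq]; exact mul_ne_zero hp (ht.trans hy.1).ne'
    · rw [heq, abs_mul, abs_mul, abs_of_pos (ht.trans hy.1), div_mul_eq_mul_div,
        le_div_iff₀ hsc]
      split_ifs with h
      · rw [h, abs_zero, mul_zero, zero_mul]
        have := ht.trans hy.1
        exact mul_nonneg (by positivity) (mul_nonneg (abs_nonneg p) (h ▸ this.le))
      · have h1 : t ≤ lin a₁ b₁ x y := hy.1.le
        have : |a₁| ≤ 1 + |p| + |p|⁻¹ + |a₁| := by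
          have : 0 < |p|⁻¹ := by positivity
          linarith
        calc |p| * |a₁| * t = |a₁| * (|p| * t) := by ring
          _ ≤ _ := by gcongr
    · rw [abs_zero]; positivity

/-- A form that does not vanish in the sector or on the bounding line `L₁ = 0`. -/
theorem lin_right {p q A B : ℝ} (hq : q ≠ 0) (hpq : 0 ≤ p * q)
    (h : ∀ x y, lin A B x y = p * lin a₁ b₁ x y + q * lin a₂ b₂ x y) :
    ∃ C, Tame (lin A B) a₁ b₁ a₂ b₂ 0 1 C := by
  have hq0 : 0 < |q| := abs_pos.mpr hq
  have habs : ∀ x y, y ∈ sectorSlice a₁ b₁ a₂ b₂ 0 0 x →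
      |lin A B x y| = |p| * lin a₁ b₁ x y + |q| * lin a₂ b₂ x y := by
    intro x y hy
    have g1 : 0 < lin a₁ b₁ x y := hy.1
    have g2 : 0 < lin a₂ b₂ x y := hy.2.1
    have h1 : 0 ≤ (p * lin a₁ b₁ x y) * (q * lin a₂ b₂ x y) := by
      rw [mul_mul_mul_comm]; positivity
    rw [h, (abs_add_eq_add_abs_iff _ _).mpr (mul_nonneg_iff.mp h1), abs_mul, abs_mul,
      abs_of_pos g1, abs_of_pos g2]
  have hlow : ∀ x y, y ∈ sectorSlice a₁ b₁ a₂ b₂ 0 0 x →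
      |q| * lin a₂ b₂ x y ≤ |lin A B x y| := by
    intro x y hy
    have g1 : 0 < lin a₁ b₁ x y := hy.1
    rw [habs x y hy]
    nlinarith [abs_nonneg p]
  set C := 1 + |q|⁻¹ + (16 * |p| + |q|) + 16 * |A| / |q| with hC
  have hi : 0 < |q|⁻¹ := by positivity
  have hA : 0 ≤ 16 * |A| / |q| := by positivity
  have hpp := abs_nonneg p
  refine ⟨C, ?_, fun x y hy => ?_, fun x y hy => ?_, fun x t s ht hs => ?_⟩
  · linarith
  · have g2 : 0 < lin a₂ b₂ x y := hy.2.1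
    rw [pow_zero, pow_one, one_mul]
    refine le_trans ?_ (hlow x y hy)
    gcongr
    exact inv_le_of_inv_le₀ hq0 (by linarith)
  · have g2 : 0 < lin a₂ b₂ x y := hy.2.1
    rw [pow_zero, pow_one, one_mul, habs x y hy]
    have h3 := hy.2.2
    calc _ ≤ |p| * (16 * lin a₂ b₂ x y) + |q| * lin a₂ b₂ x y := by gcongr
      _ = (16 * |p| + |q|) * lin a₂ b₂ x y := by ring
      _ ≤ _ := by gcongr; linarith
  · have hsc := scale_pos (a₁ := a₁) ht hs
    have hC0 : 0 < C := by linarith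
    refine ⟨fun _ => A, fun _ => 0, fun y hy => ⟨?_, hasDerivAt_const _ _, ?_, ?_, ?_⟩⟩
    · exact (((hasDerivAt_id y).const_mul A).add_const _).congr_deriv (by simp)
    · have h1 := hlow x y (sectorSlice_subset ht hs hy)
      have : 0 < |q| * lin a₂ b₂ x y := mul_pos hq0 (hs.trans hy.2.1)
      exact abs_pos.mp (this.trans_le h1)
    · rw [div_mul_eq_mul_div, le_div_iff₀ hsc]
      have h1 := hlow x y (sectorSlice_subset ht hs hy)
      calc |A| * (if a₁ = 0 then s else t) ≤ |A| * (16 * lin a₂ b₂ x y) := by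
            gcongr; exact scale_le hs hy
        _ = 16 * |A| / |q| * (|q| * lin a₂ b₂ x y) := by field_simp
        _ ≤ C * |lin A B x y| := mul_le_mul (by linarith) h1
            (mul_nonneg hq0.le (hs.trans hy.2.1).le) hC0.le
    · rw [abs_zero]; positivity

theorem exists_quad_comparable (hdet : a₁ * b₂ - a₂ * b₁ ≠ 0) {u v w : ℝ} (hu : 0 < u)
    (huv : v ^ 2 < 4 * u * w) : ∃ K : ℝ, 1 ≤ K ∧ ∀ x y, y ∈ sectorSlice a₁ b₁ a₂ b₂ 0 0 x →
      K⁻¹ * lin a₂ b₂ x y ^ 2 ≤ u * y ^ 2 + v * x * y + w * x ^ 2 ∧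
      u * y ^ 2 + v * x * y + w * x ^ 2 ≤ K * lin a₂ b₂ x y ^ 2 ∧
      x ^ 2 + y ^ 2 ≤ K * lin a₂ b₂ x y ^ 2 := by
  have hw : 0 < w := by nlinarith [sq_nonneg v]
  set Δ := a₁ * b₂ - a₂ * b₁ with hΔ
  have hΔ2 : 0 < Δ ^ 2 := by positivity
  -- coercivity with respect to the Euclidean norm
  obtain ⟨k, hk, hlow⟩ : ∃ k, 0 < k ∧ ∀ x y : ℝ,
      k * (x ^ 2 + y ^ 2) ≤ u * y ^ 2 + v * x * y + w * x ^ 2 := by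
    refine ⟨(4 * u * w - v ^ 2) / (4 * (u + w)), div_pos (by linarith) (by positivity), ?_⟩
    intro x y
    rw [div_mul_eq_mul_div, div_le_iff₀ (by positivity)]
    nlinarith [sq_nonneg (2 * u * y + v * x), sq_nonneg (2 * w * x + v * y)]
  have hup : ∀ x y : ℝ, u * y ^ 2 + v * x * y + w * x ^ 2 ≤ (u + |v| + w) * (x ^ 2 + y ^ 2) := by
    intro x y
    have : v * (x * y) ≤ |v| * (x ^ 2 + y ^ 2) := by
      refine (le_abs_self _).trans ?_
      rw [abs_mul]
      gcongr
      rw [abs_le]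
      constructor <;> nlinarith [sq_nonneg (x + y), sq_nonneg (x - y)]
    nlinarith [sq_nonneg x, sq_nonneg y]
  -- the Euclidean norm is comparable to `L₂`
  set E := a₁ ^ 2 + b₁ ^ 2 + a₂ ^ 2 + b₂ ^ 2 with hE
  have hE0 : 0 < E := by
    by_contra hcon
    have ha1 : a₁ = 0 := by nlinarith [sq_nonneg a₁, sq_nonneg b₁, sq_nonneg a₂, sq_nonneg b₂]
    have ha2 : a₂ = 0 := by nlinarith [sq_nonneg a₁, sq_nonneg b₁, sq_nonneg a₂, sq_nonneg b₂]
    exact hdet (by rw [hΔ, ha1, ha2]; ring)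
  have hN1 : ∀ x y, lin a₂ b₂ x y ^ 2 ≤ E * (x ^ 2 + y ^ 2) := by
    intro x y
    unfold lin
    nlinarith [sq_nonneg (a₂ * x - b₂ * y), sq_nonneg a₁, sq_nonneg b₁, sq_nonneg x, sq_nonneg y,
      mul_nonneg (add_nonneg (sq_nonneg a₁) (sq_nonneg b₁)) (add_nonneg (sq_nonneg x) (sq_nonneg y))]
  have hN2 : ∀ x y, y ∈ sectorSlice a₁ b₁ a₂ b₂ 0 0 x →
      x ^ 2 + y ^ 2 ≤ 514 * E / Δ ^ 2 * lin a₂ b₂ x y ^ 2 := by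
    intro x y hy
    rw [div_mul_eq_mul_div, le_div_iff₀ hΔ2]
    have e1 : x * Δ = a₁ * lin a₂ b₂ x y - a₂ * lin a₁ b₁ x y := by unfold lin; ring
    have e2 : y * Δ = b₂ * lin a₁ b₁ x y - b₁ * lin a₂ b₂ x y := by unfold lin; ring
    have g1 : 0 < lin a₁ b₁ x y := hy.1
    have g2 : 0 < lin a₂ b₂ x y := hy.2.1
    have g3 := hy.2.2
    have hl : lin a₁ b₁ x y ^ 2 ≤ 256 * lin a₂ b₂ x y ^ 2 := by nlinarith
    have h2 : ∀ p q l l' : ℝ, (p * l - q * l') ^ 2 ≤ 2 * (p ^ 2 * l ^ 2 + q ^ 2 * l' ^ 2) :=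
      fun p q l l' => by nlinarith [sq_nonneg (p * l + q * l')]
    calc (x ^ 2 + y ^ 2) * Δ ^ 2 = (x * Δ) ^ 2 + (y * Δ) ^ 2 := by ring
      _ ≤ 2 * (a₁ ^ 2 * lin a₂ b₂ x y ^ 2 + a₂ ^ 2 * lin a₁ b₁ x y ^ 2) +
          2 * (b₂ ^ 2 * lin a₁ b₁ x y ^ 2 + b₁ ^ 2 * lin a₂ b₂ x y ^ 2) := by
          rw [e1, e2]; exact add_le_add (h2 ..) (h2 ..)
      _ ≤ 2 * (a₁ ^ 2 * lin a₂ b₂ x y ^ 2 + a₂ ^ 2 * (256 * lin a₂ b₂ x y ^ 2)) +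
          2 * (b₂ ^ 2 * (256 * lin a₂ b₂ x y ^ 2) + b₁ ^ 2 * lin a₂ b₂ x y ^ 2) := by gcongr
      _ ≤ 514 * E * lin a₂ b₂ x y ^ 2 := by
          rw [hE]
          have h0 := sq_nonneg (lin a₂ b₂ x y)
          nlinarith [mul_nonneg (sq_nonneg a₁) h0, mul_nonneg (sq_nonneg a₂) h0,
            mul_nonneg (sq_nonneg b₁) h0, mul_nonneg (sq_nonneg b₂) h0]
  have hlow2 : ∀ x y, k / E * lin a₂ b₂ x y ^ 2 ≤ u * y ^ 2 + v * x * y + w * x ^ 2 := by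
    intro x y
    refine le_trans ?_ (hlow x y)
    rw [div_mul_eq_mul_div, div_le_iff₀ hE0]
    nlinarith [hN1 x y]
  have p1 : 0 < E / k := by positivity
  have p2 : 0 ≤ (u + |v| + w) * (514 * E / Δ ^ 2) := by positivity
  have p3 : 0 ≤ 514 * E / Δ ^ 2 := by positivity
  refine ⟨1 + E / k + (u + |v| + w) * (514 * E / Δ ^ 2) + 514 * E / Δ ^ 2, by linarith,
    fun x y hy => ⟨le_trans ?_ (hlow2 x y), ?_, ?_⟩⟩
  · have h1 : E / k ≤ 1 + E / k + (u + |v| + w) * (514 * E / Δ ^ 2) + 514 * E / Δ ^ 2 := by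
      linarith
    exact mul_le_mul_of_nonneg_right ((inv_anti₀ p1 h1).trans_eq (inv_div ..)) (sq_nonneg _)
  · calc _ ≤ (u + |v| + w) * (x ^ 2 + y ^ 2) := hup x y
      _ ≤ (u + |v| + w) * (514 * E / Δ ^ 2 * lin a₂ b₂ x y ^ 2) := by gcongr; exact hN2 x y hy
      _ = ((u + |v| + w) * (514 * E / Δ ^ 2)) * lin a₂ b₂ x y ^ 2 := by ring
      _ ≤ _ := mul_le_mul_of_nonneg_right (by linarith) (sq_nonneg _)
  · exact (hN2 x y hy).trans (mul_le_mul_of_nonneg_right (by linarith) (sq_nonneg _))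

/-- A positive definite quadratic form. -/
theorem quad (hdet : a₁ * b₂ - a₂ * b₁ ≠ 0) {u v w : ℝ} (hu : 0 < u) (huv : v ^ 2 < 4 * u * w) :
    ∃ C, Tame (fun x y => u * y ^ 2 + v * x * y + w * x ^ 2) a₁ b₁ a₂ b₂ 0 2 C := by
  obtain ⟨K, hK1, hK⟩ := exists_quad_comparable hdet hu huv
  have hK0 : 0 < K := by linarith
  set C2 := 16 * (2 * u + |v|) * (1 + K) * K with hC2
  set C3 := 512 * u * K with hC3
  have p2 : 0 ≤ C2 := by positivity
  have p3 : 0 ≤ C3 := by positivity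
  refine ⟨K + C2 + C3, by linarith, fun x y hy => ?_, fun x y hy => ?_, fun x t s ht hs => ?_⟩
  · rw [pow_zero, one_mul]
    refine le_trans ?_ ((hK x y hy).1.trans (le_abs_self _))
    exact mul_le_mul_of_nonneg_right (inv_anti₀ hK0 (by linarith)) (sq_nonneg _)
  · rw [pow_zero, one_mul, abs_of_nonneg (le_trans (by positivity) (hK x y hy).1)]
    exact (hK x y hy).2.1.trans (mul_le_mul_of_nonneg_right (by linarith) (sq_nonneg _))
  · have hsc := scale_pos (a₁ := a₁) ht hs
    obtain ⟨σ, hσ⟩ : ∃ σ, σ = if a₁ = 0 then s else t := ⟨_, rfl⟩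
    rw [← hσ] at hsc ⊢
    refine ⟨fun y => 2 * u * y + v * x, fun _ => 2 * u, fun y hy => ?_⟩
    have hy0 := sectorSlice_subset ht hs hy
    have hσl : σ ≤ 16 * lin a₂ b₂ x y := hσ ▸ scale_le hs hy
    have g2 : 0 < lin a₂ b₂ x y := hy0.2.1
    obtain ⟨hq, -, hN⟩ := hK x y hy0
    have hd : HasDerivAt (fun y => u * y ^ 2 + v * x * y + w * x ^ 2) (2 * u * y + v * x) y := by
      refine ((((hasDerivAt_id y).pow 2).const_mul u).add
        ((hasDerivAt_id y).const_mul (v * x))).add_const (w * x ^ 2) |>.congr_deriv ?_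
      simp; ring
    obtain ⟨F, hF⟩ : ∃ F, F = u * y ^ 2 + v * x * y + w * x ^ 2 := ⟨_, rfl⟩
    obtain ⟨l, hl⟩ : ∃ l, l = lin a₂ b₂ x y := ⟨_, rfl⟩
    rw [← hl] at hσl g2 hq hN
    rw [← hF] at hq
    have hq0 : 0 < F := lt_of_lt_of_le (by positivity) hq
    have hL : l ^ 2 ≤ K * F := by rwa [inv_mul_le_iff₀ hK0] at hq
    refine ⟨hd, ?_, ?_, ?_, ?_⟩
    · exact (((hasDerivAt_id y).const_mul (2 * u)).add_const _).congr_deriv (by simp)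
    · simp only [← hF]; exact hq0.ne'
    · simp only [← hF]
      rw [div_mul_eq_mul_div, le_div_iff₀ hsc, abs_of_pos hq0]
      have hab : ∀ r : ℝ, r ^ 2 ≤ x ^ 2 + y ^ 2 → |r| * l ≤ (1 + K) * l ^ 2 := by
        intro r hr
        nlinarith [sq_nonneg (|r| - l), sq_abs r, sq_nonneg l]
      have hx := hab x (by nlinarith [sq_nonneg y])
      have hy' := hab y (by nlinarith [sq_nonneg x])
      calc |2 * u * y + v * x| * σ ≤ (2 * u * |y| + |v| * |x|) * (16 * l) := by
            refine mul_le_mul ?_ hσl hsc.le (by positivity)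
            refine (abs_add_le _ _).trans_eq ?_
            rw [abs_mul, abs_mul, abs_mul, abs_of_pos hu, abs_two]
        _ = 16 * (2 * u * (|y| * l) + |v| * (|x| * l)) := by ring
        _ ≤ 16 * (2 * u * ((1 + K) * l ^ 2) + |v| * ((1 + K) * l ^ 2)) := by gcongr
        _ = 16 * (2 * u + |v|) * (1 + K) * l ^ 2 := by ring
        _ ≤ 16 * (2 * u + |v|) * (1 + K) * (K * F) := by gcongr
        _ = C2 * F := by rw [hC2]; ring
        _ ≤ _ := mul_le_mul_of_nonneg_right (by linarith) hq0.le
    · simp only [← hF]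
      rw [div_pow, div_mul_eq_mul_div, le_div_iff₀ (by positivity), abs_of_pos hq0,
        abs_of_pos (by positivity)]
      calc 2 * u * σ ^ 2 ≤ 2 * u * (16 * l) ^ 2 := by gcongr
        _ = 512 * u * l ^ 2 := by ring
        _ ≤ 512 * u * (K * F) := by gcongr
        _ = C3 * F := by rw [hC3]; ring
        _ ≤ _ := mul_le_mul_of_nonneg_right (by nlinarith) hq0.le

end Tame

end DampedOIO

namespace DampedOIO

open scoped Topology ComplexConjugate ENNReal
open Filter

/-! ### Phases with factored mixed derivative -/

/-- The derivative `∂_x ^ i ∂_y ^ j` of the polynomial `∑ₖ cₖ x ^ pₖ y ^ qₖ`. -/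
def monoSum (s : Finset ℕ) (c : ℕ → ℝ) (p q : ℕ → ℕ) (i j : ℕ) (x y : ℝ) : ℝ :=
  ∑ k ∈ s, c k * (((p k).descFactorial i : ℝ) * x ^ (p k - i)) *
    (((q k).descFactorial j : ℝ) * y ^ (q k - j))

theorem hasDerivAt_descFactorial_mul_pow (q j : ℕ) (y : ℝ) :
    HasDerivAt (fun y : ℝ => (q.descFactorial j : ℝ) * y ^ (q - j))
      ((q.descFactorial (j + 1) : ℝ) * y ^ (q - (j + 1))) y := by
  refine ((hasDerivAt_pow (q - j) y).const_mul _).congr_deriv ?_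
  rw [Nat.descFactorial_succ, Nat.sub_sub]
  push_cast
  ring

section monoSum

variable (s : Finset ℕ) (c : ℕ → ℝ) (p q : ℕ → ℕ)

theorem hasDerivAt_monoSum_right (i j : ℕ) (x y : ℝ) :
    HasDerivAt (fun y => monoSum s c p q i j x y) (monoSum s c p q i (j + 1) x y) y :=
  HasDerivAt.fun_sum fun _ _ => (hasDerivAt_descFactorial_mul_pow _ j y).const_mul _

theorem hasDerivAt_monoSum_left (i j : ℕ) (x y : ℝ) :
    HasDerivAt (fun x => monoSum s c p q i j x y) (monoSum s c p q (i + 1) j x y) x :=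
  HasDerivAt.fun_sum fun _ _ =>
    ((hasDerivAt_descFactorial_mul_pow _ i x).const_mul _).mul_const _

theorem neg_monoSum_swap (i j : ℕ) (x y : ℝ) :
    -monoSum s c p q i j y x = monoSum s (fun k => -c k) q p j i x y := by
  unfold monoSum
  rw [← Finset.sum_neg_distrib]
  exact Finset.sum_congr rfl fun k _ => by ring

theorem continuous_monoSum (i j : ℕ) : Continuous (Function.uncurry (monoSum s c p q i j)) := by
  have : Function.uncurry (monoSum s c p q i j) = fun t : ℝ × ℝ => monoSum s c p q i j t.1 t.2 := rfl
  rw [this]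
  unfold monoSum
  fun_prop

end monoSum

/-- A polynomial phase `S` whose mixed derivative is
`P = c ∏ᵢ (Aᵢ y + Bᵢ x) ^ νᵢ ∏ₖ (uₖ y² + vₖ x y + wₖ x²)`, with pairwise distinct lines, among them
both axes, and definite quadratic factors; `D` has the same factors with exponents `ν'`. -/
structure PhaseModel {ι κ : Type*} [Fintype ι] [Fintype κ] (S P D : ℝ → ℝ → ℝ) (A B : ι → ℝ)
    (ν ν' : ι → ℕ) (u v w : κ → ℝ) (c : ℝ) : Prop where
  phase_eq : ∃ (s : Finset ℕ) (c : ℕ → ℝ) (p q : ℕ → ℕ),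
    S = monoSum s c p q 0 0 ∧ P = monoSum s c p q 1 1
  const_ne : c ≠ 0
  mixed_eq : ∀ x y, P x y = c * (∏ i, lin (A i) (B i) x y ^ ν i) *
    ∏ k, (u k * y ^ 2 + v k * x * y + w k * x ^ 2)
  damp_eq : ∀ x y, D x y = (∏ i, lin (A i) (B i) x y ^ ν' i) *
    ∏ k, (u k * y ^ 2 + v k * x * y + w k * x ^ 2)
  lines : ∀ i j, i ≠ j → A i * B j - A j * B i ≠ 0
  quad : ∀ k, 0 < u k ∧ v k ^ 2 < 4 * u k * w k
  axis_x : ∃ i, A i = 0 ∧ B i = 1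
  axis_y : ∃ i, A i = 1 ∧ B i = 0
  slanted : ∀ i, A i ≠ 0 → B i ≠ 0 → 1 ≤ ν i

namespace PhaseModel

variable {ι κ : Type*} [Fintype ι] [Fintype κ] {S P D : ℝ → ℝ → ℝ} {A B : ι → ℝ} {ν ν' : ι → ℕ}
  {u v w : κ → ℝ} {c : ℝ}

theorem swap_neg (M : PhaseModel S P D A B ν ν' u v w c) :
    PhaseModel (fun x y => -S y x) (fun x y => -P y x) (fun x y => D y x) B A ν ν' w v u (-c) := by
  obtain ⟨s, k, p, q, rfl, rfl⟩ := M.phase_eq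
  refine ⟨⟨s, fun j => -k j, q, p, ?_, ?_⟩, neg_ne_zero.mpr M.const_ne, fun x y => ?_,
    fun x y => ?_, fun i j h h0 => M.lines i j h (by linarith), fun j => ?_, ?_, ?_,
    fun i h1 h2 => M.slanted i h2 h1⟩
  · funext x y; exact neg_monoSum_swap ..
  · funext x y; exact neg_monoSum_swap ..
  · rw [M.mixed_eq y x]
    simp only [HalfSector.lin_swap _ _ y x]
    rw [← neg_mul, ← neg_mul]
    congr 1
    exact Finset.prod_congr rfl fun k _ => by ring
  · rw [M.damp_eq y x]
    simp only [HalfSector.lin_swap _ _ y x]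
    congr 1
    exact Finset.prod_congr rfl fun k _ => by ring
  · obtain ⟨h1, h2⟩ := M.quad j
    refine ⟨by nlinarith [sq_nonneg (v j)], by linarith⟩
  · obtain ⟨i, h1, h2⟩ := M.axis_y; exact ⟨i, h2, h1⟩
  · obtain ⟨i, h1, h2⟩ := M.axis_x; exact ⟨i, h2, h1⟩

theorem continuous_phase (M : PhaseModel S P D A B ν ν' u v w c) :
    Continuous (Function.uncurry S) := by
  obtain ⟨s, k, p, q, rfl, -⟩ := M.phase_eq
  exact continuous_monoSum ..

theorem continuous_damp (M : PhaseModel S P D A B ν ν' u v w c) :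
    Continuous (Function.uncurry D) := by
  have : Function.uncurry D = fun t : ℝ × ℝ => (∏ i, (A i * t.2 + B i * t.1) ^ ν' i) *
      ∏ k, (u k * t.2 ^ 2 + v k * t.1 * t.2 + w k * t.1 ^ 2) := by
    funext t; exact M.damp_eq t.1 t.2
  rw [this]
  fun_prop

/-- In a sector free of lines of the family every other linear factor is tame. The hypothesis `hint`
says that each `Aᵢ y + Bᵢ x` is a combination of `L₁` and `L₂` with coefficients of the same sign, so
that its zeros are not inside the sector. -/
theorem exists_tame_lin (M : PhaseModel S P D A B ν ν' u v w c) {i₁ : ι} {σ a₂ b₂ : ℝ}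
    (hσ : σ ≠ 0) (hdet : σ * A i₁ * b₂ - a₂ * (σ * B i₁) ≠ 0)
    (hint : ∀ i, 0 ≤ (A i * b₂ - B i * a₂) * (σ * A i₁ * B i - σ * B i₁ * A i)) {i : ι}
    (hi : i ≠ i₁) :
    ∃ C, Tame (lin (A i) (B i)) (σ * A i₁) (σ * B i₁) a₂ b₂ 0 1 C := by
  set Δ := σ * A i₁ * b₂ - a₂ * (σ * B i₁) with hΔ
  refine Tame.lin_right (p := (A i * b₂ - B i * a₂) / Δ)
    (q := (σ * A i₁ * B i - σ * B i₁ * A i) / Δ) ?_ ?_ fun x y => ?_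
  · refine div_ne_zero ?_ hdet
    rw [show σ * A i₁ * B i - σ * B i₁ * A i = σ * (A i₁ * B i - A i * B i₁) by ring]
    exact mul_ne_zero hσ (M.lines i₁ i hi.symm)
  · rw [div_mul_div_comm]
    exact div_nonneg (hint i) (mul_self_nonneg _)
  · rw [div_mul_eq_mul_div, div_mul_eq_mul_div, ← add_div, eq_div_iff hdet, hΔ]
    unfold lin; ring

/-- A product with the factors of the model, whatever the exponents `ν`; the exponent `e` of `L₂` is
the total degree of the factors other than `L₁`. -/
theorem exists_tame (M : PhaseModel S P D A B ν ν' u v w c) {i₁ : ι} {σ a₂ b₂ : ℝ}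
    (hσ : σ ≠ 0) (hdet : σ * A i₁ * b₂ - a₂ * (σ * B i₁) ≠ 0)
    (hint : ∀ i, 0 ≤ (A i * b₂ - B i * a₂) * (σ * A i₁ * B i - σ * B i₁ * A i)) {c : ℝ}
    (hc : c ≠ 0) (ν : ι → ℕ) {e : ℕ} (he : ν i₁ + e = ∑ i, ν i + 2 * Fintype.card κ) :
    ∃ C, Tame (fun x y => c * (∏ i, lin (A i) (B i) x y ^ ν i) *
      ∏ k, (u k * y ^ 2 + v k * x * y + w k * x ^ 2)) (σ * A i₁) (σ * B i₁) a₂ b₂ (ν i₁) e C := by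
  classical
  have h1 : ∀ i, ∃ C, Tame (fun x y => lin (A i) (B i) x y ^ ν i) (σ * A i₁) (σ * B i₁) a₂ b₂
      (if i = i₁ then ν i else 0) (if i = i₁ then 0 else ν i) C := by
    intro i
    split_ifs with h
    · obtain ⟨C, hC⟩ := Tame.lin_left (a₁ := σ * A i₁) (b₁ := σ * B i₁) (a₂ := a₂) (b₂ := b₂)
        (inv_ne_zero hσ)
      rw [inv_mul_cancel_left₀ hσ, inv_mul_cancel_left₀ hσ, ← h] at hC
      simpa [h] using hC.pow (ν i)
    · obtain ⟨C, hC⟩ := M.exists_tame_lin hσ hdet hint h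
      simpa using hC.pow (ν i)
  obtain ⟨C1, hC1⟩ := Tame.prod Finset.univ fun i _ => h1 i
  obtain ⟨C2, hC2⟩ := Tame.prod Finset.univ fun k _ =>
    Tame.quad (u := u k) (v := v k) (w := w k) hdet (M.quad k).1 (M.quad k).2
  obtain ⟨C3, hC3⟩ := Tame.const (a₁ := σ * A i₁) (b₁ := σ * B i₁) (a₂ := a₂) (b₂ := b₂) hc
  have h2 : ∑ i, (if i = i₁ then ν i else 0) + ∑ i, (if i = i₁ then 0 else ν i) = ∑ i, ν i := by
    rw [← Finset.sum_add_distrib]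
    exact Finset.sum_congr rfl fun i _ => by split_ifs <;> simp
  have h3 : ∑ i, (if i = i₁ then ν i else 0) = ν i₁ := by simp
  have h4 := (hC3.mul hC1).mul hC2
  have e1 : 0 + ∑ i, (if i = i₁ then ν i else 0) + ∑ _k : κ, 0 = ν i₁ := by simp
  have e2 : 0 + ∑ i, (if i = i₁ then 0 else ν i) + ∑ _k : κ, 2 = e := by
    simp only [Finset.sum_const, Finset.card_univ, smul_eq_mul]
    omega
  rw [e1, e2] at h4
  exact ⟨_, h4⟩

theorem exists_halfSector (M : PhaseModel S P D A B ν ν' u v w c) {i₁ : ι} {σ a₂ b₂ : ℝ}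
    (hσ : σ ≠ 0) (hdet : σ * A i₁ * b₂ - a₂ * (σ * B i₁) ≠ 0)
    (hint : ∀ i, 0 ≤ (A i * b₂ - B i * a₂) * (σ * A i₁ * B i - σ * B i₁ * A i)) {e e' : ℕ}
    (he : ν i₁ + e = ∑ i, ν i + 2 * Fintype.card κ)
    (he' : ν' i₁ + e' = ∑ i, ν' i + 2 * Fintype.card κ) :
    ∃ C, HalfSector S P D (σ * A i₁) (σ * B i₁) a₂ b₂ (ν i₁) e (ν' i₁) e' C := by
  obtain ⟨C1, h1⟩ := M.exists_tame hσ hdet hint M.const_ne ν he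
  obtain ⟨C2, h2⟩ := M.exists_tame hσ hdet hint one_ne_zero ν' he'
  have h1 : Tame P (σ * A i₁) (σ * B i₁) a₂ b₂ (ν i₁) e C1 := by
    convert h1 using 3 with x y; exact M.mixed_eq x y
  have h2 : Tame D (σ * A i₁) (σ * B i₁) a₂ b₂ (ν' i₁) e' C2 := by
    convert h2 using 3 with x y; rw [one_mul]; exact M.damp_eq x y
  obtain ⟨iy, hy1, hy2⟩ := M.axis_y
  obtain ⟨C3, h3⟩ : ∃ C3, 1 ≤ C3 ∧ (σ * B i₁ ≠ 0 →
      Tame (lin 1 0) (σ * A i₁) (σ * B i₁) a₂ b₂ 0 1 C3) := by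
    by_cases hb : σ * B i₁ = 0
    · exact ⟨1, le_rfl, fun h => absurd hb h⟩
    · have hne : iy ≠ i₁ := by rintro rfl; exact hb (by rw [hy2, mul_zero])
      obtain ⟨C3, h3⟩ := M.exists_tame_lin hσ hdet hint hne
      rw [hy1, hy2] at h3
      exact ⟨C3, h3.one_le, fun _ => h3⟩
  have o1 := h1.one_le
  have o2 := h2.one_le
  have g1 := h1.mono (C' := C1 + C2 + C3) (by linarith)
  have g2 := h2.mono (C' := C1 + C2 + C3) (by linarith)
  refine ⟨C1 + C2 + C3, ⟨g1.one_le, hdet, ?_, g1.lower, g1.rel, g2.lower, g2.upper, g2.rel⟩,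
    M.continuous_phase, M.continuous_damp, fun hb x y hy => ?_, fun ha hb => ?_⟩
  · obtain ⟨s, k, p, q, rfl, rfl⟩ := M.phase_eq
    exact ⟨_, _, _, _, _, fun x y => ⟨hasDerivAt_monoSum_right .., hasDerivAt_monoSum_right ..,
      hasDerivAt_monoSum_right .., hasDerivAt_monoSum_left .., hasDerivAt_monoSum_left ..,
      hasDerivAt_monoSum_left .., hasDerivAt_monoSum_right .., hasDerivAt_monoSum_right ..⟩⟩
  · have g3 := (h3.2 hb).mono (C' := C1 + C2 + C3) (by linarith)
    have l1 := g3.lower x y hy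
    have l2 := g3.upper x y hy
    have hl : lin 1 0 x y = y := by unfold lin; ring
    rw [hl, pow_zero, one_mul, pow_one] at l1 l2
    exact ⟨l1, l2⟩
  · exact M.slanted i₁ (right_ne_zero_of_mul ha) (right_ne_zero_of_mul hb)

end PhaseModel

/-- A `PhaseModel` in which `D` is the mixed derivative deprived of its factor `y ^ β` and has
degree `d > 0`. -/
structure CriticalModel {ι κ : Type*} [Fintype ι] [Fintype κ] (S P D : ℝ → ℝ → ℝ) (A B : ι → ℝ)
    (ν ν' : ι → ℕ) (u v w : κ → ℝ) (c : ℝ) (β d : ℕ) : Prop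
    extends PhaseModel S P D A B ν ν' u v w c where
  degree_pos : 0 < d
  degree_damp : ∑ i, ν' i + 2 * Fintype.card κ = d
  degree_mixed : ∑ i, ν i + 2 * Fintype.card κ = d + β
  exponent_y : ∀ i, B i = 0 → ν i = β ∧ ν' i = 0
  exponent_ne : ∀ i, B i ≠ 0 → ν' i = ν i

/-- The critical exponent in terms of the degree `d` of the damping factor. -/
noncomputable def critExp (β d : ℕ) : ℝ := (1 - (β : ℝ) / d) / (2 * ((β : ℝ) + 1))

namespace CriticalModel

variable {ι κ : Type*} [Fintype ι] [Fintype κ] {S P D : ℝ → ℝ → ℝ} {A B : ι → ℝ} {ν ν' : ι → ℕ}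
  {u v w : κ → ℝ} {c : ℝ} {β d : ℕ}

/-- At the critical exponent the geometric mean of the oscillatory and of the trivial bound, with
weights `1 / (β + 1)` and `β / (β + 1)`, is bounded; it is constant along the line `y = 0`. -/
theorem mean_le_one (M : CriticalModel S P D A B ν ν' u v w c β d) {i : ι} {σ : ℝ} (hσ : σ ≠ 0)
    {e e' : ℕ} (he : ν i + e = d + β) (he' : ν' i + e' = d) {R δ : ℝ} (hδ : 0 < δ) (hδR : δ ≤ R) :
    oscSize (ν i) e (ν' i) e' (critExp β d) R δ ^ (1 / ((β : ℝ) + 1)) *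
      trivSize (σ * A i) (σ * B i) (ν' i) e' (critExp β d) R δ ^ (1 - 1 / ((β : ℝ) + 1)) ≤ 1 := by
  have hR : 0 < R := by linarith
  refine oscSize_rpow_mul_trivSize_rpow_le hR hδ ?_
  have hXY : Real.log δ ≤ Real.log R := Real.log_le_log hδ hδR
  obtain ⟨X, hX⟩ : ∃ X, X = Real.log R := ⟨_, rfl⟩
  obtain ⟨Y, hY⟩ : ∃ Y, Y = Real.log δ := ⟨_, rfl⟩
  rw [← hX, ← hY] at hXY ⊢
  have hd : (0 : ℝ) < d := by exact_mod_cast M.degree_pos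
  have hb : (0 : ℝ) < (β : ℝ) + 1 := by positivity
  -- the exponent, multiplied by `2 d (β + 1)`
  set T := (if σ * A i = 0 then X else Y) + (if σ * B i = 0 then X else Y) with hT
  suffices h : ((d : ℝ) - β) * (ν' i * Y + e' * X) - d * (ν i * Y + e * X) + d * β * T ≤ 0 by
    have heq : critExp β d * (ν' i * Y + e' * X) - 1 / ((β : ℝ) + 1) * ((ν i * Y + e * X) / 2) +
        (1 - 1 / ((β : ℝ) + 1)) * (T / 2) =
        (((d : ℝ) - β) * (ν' i * Y + e' * X) - d * (ν i * Y + e * X) + d * β * T) /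
          (2 * d * (β + 1)) := by
      unfold critExp; field_simp; ring
    rw [heq]
    exact div_nonpos_of_nonpos_of_nonneg h (by positivity)
  have he1 : (e : ℝ) = d + β - ν i := by
    have : ((ν i + e : ℕ) : ℝ) = ((d + β : ℕ) : ℝ) := by rw [he]
    push_cast at this; linarith
  have he2 : (e' : ℝ) = d - ν' i := by
    have : ((ν' i + e' : ℕ) : ℝ) = (d : ℝ) := by rw [he']
    push_cast at this; linarith
  have hβ0 : (0 : ℝ) ≤ β := by positivity
  have hle : (ν' i : ℝ) ≤ d := by
    have h0 : (0 : ℝ) ≤ e' := by positivity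
    linarith
  rw [he1, he2, hT]
  by_cases hB : B i = 0
  · have hA : A i ≠ 0 := by
      intro hA
      obtain ⟨j, hj1, hj2⟩ := M.axis_x
      have hij : i ≠ j := by rintro rfl; rw [hB] at hj2; exact zero_ne_one hj2
      exact M.lines i j hij (by rw [hA, hB]; ring)
    obtain ⟨h1, h2⟩ := M.exponent_y i hB
    rw [h1, h2, if_neg (mul_ne_zero hσ hA), if_pos (by rw [hB, mul_zero])]
    push_cast
    exact le_of_eq (by ring)
  · rw [if_neg (mul_ne_zero hσ hB), ← M.exponent_ne i hB]
    by_cases hA : A i = 0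
    · rw [if_pos (by rw [hA, mul_zero])]
      have := mul_nonneg (mul_nonneg hβ0 (sub_nonneg.mpr hle)) (sub_nonneg.mpr hXY)
      linarith
    · rw [if_neg (mul_ne_zero hσ hA)]
      have := mul_nonneg (mul_nonneg hβ0 (by linarith : (0 : ℝ) ≤ 2 * d - ν' i))
        (sub_nonneg.mpr hXY)
      linarith

/-- Half of a sector free of lines: the estimates for `T T*` come from the model and those for
`T* T` from the model with `x` and `y` exchanged. -/
theorem halfSummable (M : CriticalModel S P D A B ν ν' u v w c β d) {i₁ : ι} {σ a₂ b₂ : ℝ}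
    (hσ : σ ≠ 0) (hdet : σ * A i₁ * b₂ - a₂ * (σ * B i₁) ≠ 0)
    (hint : ∀ i, 0 ≤ (A i * b₂ - B i * a₂) * (σ * A i₁ * B i - σ * B i₁ * A i)) :
    HalfSummable S D (σ * A i₁) (σ * B i₁) a₂ b₂ (critExp β d) := by
  have hle : ν i₁ ≤ ∑ i, ν i := Finset.single_le_sum (fun i _ => Nat.zero_le _) (Finset.mem_univ i₁)
  have hle' : ν' i₁ ≤ ∑ i, ν' i :=
    Finset.single_le_sum (fun i _ => Nat.zero_le _) (Finset.mem_univ i₁)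
  have hdm := M.degree_mixed
  have hdd := M.degree_damp
  obtain ⟨e, he⟩ : ∃ e, ν i₁ + e = d + β := ⟨d + β - ν i₁, by omega⟩
  obtain ⟨e', he'⟩ : ∃ e', ν' i₁ + e' = d := ⟨d - ν' i₁, by omega⟩
  obtain ⟨C, h⟩ := M.exists_halfSector hσ hdet hint (e := e) (e' := e') (by omega) (by omega)
  obtain ⟨C', h'⟩ := M.swap_neg.exists_halfSector (i₁ := i₁) (σ := σ) (a₂ := b₂) (b₂ := a₂) hσ
    (fun h0 => hdet (by linarith)) (fun i => (hint i).trans_eq (by ring)) (e := e) (e' := e')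
    (by omega) (by omega)
  have hβ1 : (1 : ℝ) ≤ (β : ℝ) + 1 := by
    have : (0 : ℝ) ≤ β := by positivity
    linarith
  obtain ⟨K, hK, hn⟩ := exists_norm_sum_piece_le h h' (θ := 1 / ((β : ℝ) + 1)) (by positivity)
    (by rw [div_le_one (by positivity)]; exact hβ1)
    fun R δ hδ hδR => M.mean_le_one hσ he he' hδ hδR
  refine ⟨K, hK, fun z hz s hs => ⟨?_, hn z hz s hs⟩⟩
  have := NiceKernel.sum (Finset.univ : Finset s) (K := fun p =>
    piece S D (σ * A i₁) (σ * B i₁) a₂ b₂ z (2 ^ p.1.1) (2 ^ p.1.2)) fun p =>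
      h.niceKernel_piece z (by positivity) (zpow_le_zpow_right₀ one_le_two (hs _ p.2))
  convert this using 3 with x y
  exact (Finset.sum_coe_sort s fun p => piece S D (σ * A i₁) (σ * B i₁) a₂ b₂ z
    (2 ^ p.1) (2 ^ p.2) x y).symm

end CriticalModel

end DampedOIO

namespace DampedOIO

open scoped Topology ComplexConjugate ENNReal
open Filter

/-! ### Decomposition of the plane into sectors -/

theorem ae_lin_ne_zero {a b : ℝ} (h : a ≠ 0 ∨ b ≠ 0) :
    ∀ᵐ x : ℝ, ∀ᵐ y : ℝ, lin a b x y ≠ 0 := by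
  have h0 : ∀ᵐ x : ℝ, x ≠ 0 := Measure.ae_ne volume 0
  filter_upwards [h0] with x hx
  by_cases ha : a = 0
  · have hb : b ≠ 0 := h.resolve_left (not_not.mpr ha)
    refine .of_forall fun y => ?_
    simp only [lin, ha, zero_mul, zero_add]
    exact mul_ne_zero hb hx
  · have h1 : ∀ᵐ y : ℝ, y ≠ -(b * x) / a := Measure.ae_ne volume _
    filter_upwards [h1] with y hy h2
    refine hy ?_
    rw [eq_div_iff ha]
    unfold lin at h2
    linarith

namespace CriticalModel

variable {ι κ : Type*} [Fintype ι] [Fintype κ] {S P D : ℝ → ℝ → ℝ} {A B : ι → ℝ} {ν ν' : ι → ℕ}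
  {u v w : κ → ℝ} {c : ℝ} {β d : ℕ}

open Classical in
/-- The lines of the family that pass through the interior of the sector `0 < L₁`, `0 < L₂`. -/
noncomputable def interiorLines (A B : ι → ℝ) (a₁ b₁ a₂ b₂ : ℝ) : Finset ι :=
  Finset.univ.filter fun i => (A i * b₂ - B i * a₂) * (a₁ * B i - b₁ * A i) < 0

/-- Every sector bounded by two lines of the family is cut by the lines in its interior into
sectors without interior lines. -/
theorem exists_l2Bounded_sector (M : CriticalModel S P D A B ν ν' u v w c β d)
    (hloc : ∀ z : ℂ, z.re = critExp β d →
      ∀ᵐ x : ℝ, ∀ f, TestFun f → Integrable fun y => kernel S D z x y * f y) :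
    ∀ (N : ℕ) (i₁ i₂ : ι) (σ₁ σ₂ : ℝ), σ₁ ≠ 0 → σ₂ ≠ 0 → i₁ ≠ i₂ →
      (interiorLines A B (σ₁ * A i₁) (σ₁ * B i₁) (σ₂ * A i₂) (σ₂ * B i₂)).card ≤ N →
      ∃ K : ℝ, 0 < K ∧ ∀ z : ℂ, z.re = critExp β d →
        L2Bounded (restrictSector (σ₁ * A i₁) (σ₁ * B i₁) (σ₂ * A i₂) (σ₂ * B i₂) (kernel S D z))
          (K * (1 + ‖z‖)) := by
  classical
  intro N
  induction N with
  | zero =>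
    intro i₁ i₂ σ₁ σ₂ h1 h2 h12 hcard
    have hemp := Finset.card_eq_zero.mp (Nat.le_zero.mp hcard)
    have hint : ∀ i, 0 ≤ (A i * (σ₂ * B i₂) - B i * (σ₂ * A i₂)) *
        (σ₁ * A i₁ * B i - σ₁ * B i₁ * A i) := by
      intro i
      by_contra hlt
      have : i ∈ interiorLines A B (σ₁ * A i₁) (σ₁ * B i₁) (σ₂ * A i₂) (σ₂ * B i₂) := by
        simp only [interiorLines, Finset.mem_filter, Finset.mem_univ, true_and]
        exact not_le.mp hlt
      rw [hemp] at this
      exact absurd this (Finset.notMem_empty i)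
    have hdet : σ₁ * A i₁ * (σ₂ * B i₂) - σ₂ * A i₂ * (σ₁ * B i₁) ≠ 0 := by
      rw [show σ₁ * A i₁ * (σ₂ * B i₂) - σ₂ * A i₂ * (σ₁ * B i₁) =
        σ₁ * σ₂ * (A i₁ * B i₂ - A i₂ * B i₁) by ring]
      exact mul_ne_zero (mul_ne_zero h1 h2) (M.lines i₁ i₂ h12)
    exact exists_l2Bounded_restrictSector M.continuous_phase M.continuous_damp hloc
      (M.halfSummable h1 hdet hint)
      (M.halfSummable h2 (fun h0 => hdet (by linarith)) fun i => (hint i).trans_eq (by ring))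
  | succ N ih =>
    intro i₁ i₂ σ₁ σ₂ h1 h2 h12 hcard
    by_cases hemp : interiorLines A B (σ₁ * A i₁) (σ₁ * B i₁) (σ₂ * A i₂) (σ₂ * B i₂) = ∅
    · exact ih i₁ i₂ σ₁ σ₂ h1 h2 h12 (by rw [hemp]; simp)
    obtain ⟨i, hi⟩ := Finset.nonempty_iff_ne_empty.mpr hemp
    obtain ⟨a₁, ha₁⟩ : ∃ a₁, a₁ = σ₁ * A i₁ := ⟨_, rfl⟩
    obtain ⟨b₁, hb₁⟩ : ∃ b₁, b₁ = σ₁ * B i₁ := ⟨_, rfl⟩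
    obtain ⟨a₂, ha₂⟩ : ∃ a₂, a₂ = σ₂ * A i₂ := ⟨_, rfl⟩
    obtain ⟨b₂, hb₂⟩ : ∃ b₂, b₂ = σ₂ * B i₂ := ⟨_, rfl⟩
    have hdet : a₁ * b₂ - a₂ * b₁ ≠ 0 := by
      rw [ha₁, ha₂, hb₁, hb₂, show σ₁ * A i₁ * (σ₂ * B i₂) - σ₂ * A i₂ * (σ₁ * B i₁) =
        σ₁ * σ₂ * (A i₁ * B i₂ - A i₂ * B i₁) by ring]
      exact mul_ne_zero (mul_ne_zero h1 h2) (M.lines i₁ i₂ h12)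
    have hi' : (A i * b₂ - B i * a₂) * (a₁ * B i - b₁ * A i) < 0 := by
      rw [ha₁, ha₂, hb₁, hb₂]
      simpa [interiorLines] using hi
    have hne1 : i ≠ i₁ := by
      rintro rfl
      rw [ha₁, hb₁] at hi'
      refine absurd hi' (not_lt.mpr (le_of_eq ?_))
      ring
    have hne2 : i ≠ i₂ := by
      rintro rfl
      rw [ha₂, hb₂] at hi'
      refine absurd hi' (not_lt.mpr (le_of_eq ?_))
      ring
    -- the interior line as a combination of the two bounding ones, suitably oriented
    obtain ⟨σ, p, q, hσ, hp, hq, ha, hb⟩ : ∃ σ p q : ℝ, σ ≠ 0 ∧ 0 < p ∧ q < 0 ∧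
        σ * A i = p * a₁ + q * a₂ ∧ σ * B i = p * b₁ + q * b₂ := by
      have hp : A i * b₂ - B i * a₂ ≠ 0 := left_ne_zero_of_mul hi'.ne
      exact ⟨(a₁ * b₂ - a₂ * b₁) * (A i * b₂ - B i * a₂), (A i * b₂ - B i * a₂) ^ 2,
        (A i * b₂ - B i * a₂) * (a₁ * B i - b₁ * A i), mul_ne_zero hdet hp, by positivity, hi',
        by ring, by ring⟩
    -- the two subsectors have fewer interior lines, since they lose the line `i`
    have hlt : ∀ T : Finset ι, T ⊆ interiorLines A B a₁ b₁ a₂ b₂ → i ∉ T → T.card ≤ N := by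
      intro T hT hiT
      have h3 : T.card < (interiorLines A B a₁ b₁ a₂ b₂).card :=
        Finset.card_lt_card ⟨hT, fun h => hiT (h (by
          simp only [interiorLines, Finset.mem_filter, Finset.mem_univ, true_and]; exact hi'))⟩
      rw [← ha₁, ← hb₁, ← ha₂, ← hb₂] at hcard
      omega
    have hc1 : (interiorLines A B (σ * A i) (σ * B i) (σ₂ * A i₂) (σ₂ * B i₂)).card ≤ N := by
      rw [← ha₂, ← hb₂]
      refine hlt _ (fun j hj => ?_) fun hj => ?_
      · simp only [interiorLines, Finset.mem_filter, Finset.mem_univ, true_and] at hj ⊢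
        rw [ha, hb] at hj
        have e : (A j * b₂ - B j * a₂) * ((p * a₁ + q * a₂) * B j - (p * b₁ + q * b₂) * A j) =
            p * ((A j * b₂ - B j * a₂) * (a₁ * B j - b₁ * A j)) - q * (A j * b₂ - B j * a₂) ^ 2 := by
          ring
        rw [e] at hj
        by_contra hcon
        nlinarith [mul_nonneg hp.le (not_lt.mp hcon), mul_nonneg (neg_nonneg.mpr hq.le)
          (sq_nonneg (A j * b₂ - B j * a₂))]
      · simp only [interiorLines, Finset.mem_filter, Finset.mem_univ, true_and] at hj
        exact absurd hj (not_lt.mpr (le_of_eq (by ring)))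
    have hc2 : (interiorLines A B (-σ * A i) (-σ * B i) (σ₁ * A i₁) (σ₁ * B i₁)).card ≤ N := by
      rw [← ha₁, ← hb₁]
      refine hlt _ (fun j hj => ?_) fun hj => ?_
      · simp only [interiorLines, Finset.mem_filter, Finset.mem_univ, true_and] at hj ⊢
        rw [neg_mul σ (A i), neg_mul σ (B i), ha, hb] at hj
        have e : (A j * b₁ - B j * a₁) * (-(p * a₁ + q * a₂) * B j - -(p * b₁ + q * b₂) * A j) =
            -q * ((A j * b₂ - B j * a₂) * (a₁ * B j - b₁ * A j)) +
              p * (a₁ * B j - b₁ * A j) ^ 2 := by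
          ring
        rw [e] at hj
        by_contra hcon
        nlinarith [mul_nonneg (neg_nonneg.mpr hq.le) (not_lt.mp hcon), mul_nonneg hp.le
          (sq_nonneg (a₁ * B j - b₁ * A j))]
      · simp only [interiorLines, Finset.mem_filter, Finset.mem_univ, true_and] at hj
        exact absurd hj (not_lt.mpr (le_of_eq (by ring)))
    obtain ⟨K1, hK1, k1⟩ := ih i i₂ σ σ₂ hσ h2 hne2 hc1
    obtain ⟨K2, hK2, k2⟩ := ih i i₁ (-σ) σ₁ (neg_ne_zero.mpr hσ) h1 hne1 hc2
    refine ⟨K1 + K2, by positivity, fun z hz => ?_⟩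
    have hmeas := measurable_kernel M.continuous_phase M.continuous_damp z
    have := (k1 z hz).add (k2 z hz) (by positivity) (by positivity)
    rw [← add_mul] at this
    refine this.congr (measurable_restrictSector hmeas ..) ?_
    have hnz : σ * A i ≠ 0 ∨ σ * B i ≠ 0 := by
      by_contra! h0
      have e1 : A i = 0 := (mul_eq_zero.mp h0.1).resolve_left hσ
      have e2 : B i = 0 := (mul_eq_zero.mp h0.2).resolve_left hσ
      exact M.lines i i₁ hne1 (by rw [e1, e2]; ring)
    filter_upwards [ae_lin_ne_zero hnz] with x hx
    filter_upwards [hx] with y hy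
    have l1 : lin (-σ * A i) (-σ * B i) x y = -lin (σ * A i) (σ * B i) x y := by unfold lin; ring
    have l2 : lin (σ * A i) (σ * B i) x y = p * lin a₁ b₁ x y + q * lin a₂ b₂ x y := by
      rw [ha, hb]; unfold lin; ring
    simp only [restrictSector, ← ha₁, ← ha₂, ← hb₁, ← hb₂, l1]
    rw [l2] at hy ⊢
    set s := lin a₁ b₁ x y
    set t := lin a₂ b₂ x y
    rcases lt_or_gt_of_ne hy with hneg | hpos
    · rw [if_neg (by rintro ⟨h, -⟩; linarith), zero_add]
      congr 1
      refine propext ⟨fun h => ⟨h.2, ?_⟩, fun h => ⟨by linarith, h.1⟩⟩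
      by_contra hcon
      nlinarith [mul_pos hp h.2]
    · rw [if_neg (c := 0 < -(p * s + q * t) ∧ 0 < s) (by rintro ⟨h, -⟩; linarith), add_zero]
      congr 1
      refine propext ⟨fun h => ⟨?_, h.2⟩, fun h => ⟨by linarith, h.2⟩⟩
      by_contra hcon
      nlinarith [mul_neg_of_neg_of_pos hq h.2]

/-- The kernel at the critical exponent is bounded on `L²`. -/
theorem exists_l2Bounded (M : CriticalModel S P D A B ν ν' u v w c β d)
    (hloc : ∀ z : ℂ, z.re = critExp β d →
      ∀ᵐ x : ℝ, ∀ f, TestFun f → Integrable fun y => kernel S D z x y * f y) :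
    ∃ K : ℝ, 0 < K ∧ ∀ z : ℂ, z.re = critExp β d →
      L2Bounded (kernel S D z) (K * (1 + ‖z‖)) := by
  obtain ⟨ix, hx1, hx2⟩ := M.axis_x
  obtain ⟨iy, hy1, hy2⟩ := M.axis_y
  have hne : ix ≠ iy := by rintro rfl; rw [hx1] at hy1; exact zero_ne_one hy1
  have hq : ∀ σ₁ σ₂ : ℝ, σ₁ ≠ 0 → σ₂ ≠ 0 → ∃ K : ℝ, 0 < K ∧ ∀ z : ℂ, z.re = critExp β d →
      L2Bounded (restrictSector 0 σ₁ σ₂ 0 (kernel S D z)) (K * (1 + ‖z‖)) := by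
    intro σ₁ σ₂ h1 h2
    simpa only [hx1, hx2, hy1, hy2, mul_zero, mul_one] using
      M.exists_l2Bounded_sector hloc _ ix iy σ₁ σ₂ h1 h2 hne le_rfl
  obtain ⟨K1, p1, k1⟩ := hq 1 1 one_ne_zero one_ne_zero
  obtain ⟨K2, p2, k2⟩ := hq 1 (-1) one_ne_zero (by norm_num)
  obtain ⟨K3, p3, k3⟩ := hq (-1) 1 (by norm_num) one_ne_zero
  obtain ⟨K4, p4, k4⟩ := hq (-1) (-1) (by norm_num) (by norm_num)
  refine ⟨K1 + K2 + (K3 + K4), by positivity, fun z hz => ?_⟩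
  have := ((k1 z hz).add (k2 z hz) (by positivity) (by positivity)).add
    ((k3 z hz).add (k4 z hz) (by positivity) (by positivity)) (by positivity) (by positivity)
  rw [← add_mul, ← add_mul, ← add_mul] at this
  refine this.congr (measurable_kernel M.continuous_phase M.continuous_damp z) ?_
  have h0 : ∀ᵐ x : ℝ, x ≠ 0 := Measure.ae_ne volume 0
  filter_upwards [h0] with x hx
  filter_upwards [h0] with y hy
  have l1 : ∀ σ, lin 0 σ x y = σ * x := fun σ => by unfold lin; ring
  have l2 : ∀ σ, lin σ 0 x y = σ * y := fun σ => by unfold lin; ring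
  simp only [restrictSector, l1, l2, one_mul, neg_mul, neg_pos]
  rcases lt_or_gt_of_ne hx with hx | hx <;> rcases lt_or_gt_of_ne hy with hy | hy <;>
    simp [hx, hy, not_lt.mpr hx.le, not_lt.mpr hy.le]

end CriticalModel

end DampedOIO

namespace DampedOIO

open scoped Topology ComplexConjugate ENNReal
open Filter

/-! ### Local integrability of the kernel -/

theorem intervalIntegrable_abs_rpow {r : ℝ} (hr : -1 < r) (a b : ℝ) :
    IntervalIntegrable (fun t : ℝ => |t| ^ r) volume a b := by
  have hpos : ∀ c : ℝ, 0 ≤ c → IntervalIntegrable (fun t : ℝ => |t| ^ r) volume 0 c := by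
    intro c hc
    refine (intervalIntegral.intervalIntegrable_rpow' hr (a := 0) (b := c)).congr ?_
    intro t ht
    rw [Set.uIoc_of_le hc] at ht
    simp only [abs_of_pos ht.1]
  have hall : ∀ c : ℝ, IntervalIntegrable (fun t : ℝ => |t| ^ r) volume 0 c := by
    intro c
    rcases le_total 0 c with hc | hc
    · exact hpos c hc
    · have := (hpos (-c) (by linarith)).comp_mul_left (c := -1)
      simpa using this
  exact (hall a).symm.trans (hall b)

theorem locallyIntegrable_of_intervalIntegrable {f : ℝ → ℝ}
    (h : ∀ a b : ℝ, IntervalIntegrable f volume a b) : LocallyIntegrable f := by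
  rw [locallyIntegrable_iff]
  intro K hK
  obtain ⟨R, hR⟩ := hK.isBounded.exists_norm_le
  have hsub : K ⊆ Set.Icc (-|R|) |R| := fun y hy => by
    have := (hR y hy).trans (le_abs_self R)
    simpa [Set.mem_Icc, abs_le] using this
  refine IntegrableOn.mono_set ?_ hsub
  rw [← intervalIntegrable_iff_integrableOn_Icc_of_le (by linarith [abs_nonneg R])]
  exact h _ _

theorem locallyIntegrable_abs_lin_rpow {r : ℝ} (hr : -1 < r) (a b x : ℝ) :
    LocallyIntegrable fun y : ℝ => |lin a b x y| ^ r := by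
  by_cases ha : a = 0
  · simp only [lin, ha, zero_mul, zero_add]
    exact locallyIntegrable_const _
  · refine locallyIntegrable_of_intervalIntegrable fun s t => ?_
    have h1 := ((intervalIntegrable_abs_rpow hr (a * s + b * x) (a * t + b * x)).comp_add_right
      (b * x)).comp_mul_left (c := a)
    simpa [lin, ha] using h1

theorem ae_ne_zero_of_prod {ι : Type*} [Fintype ι] {F : ι → ℝ → ℝ}
    (h : ∀ i, ∀ᵐ y : ℝ, F i y ≠ 0) (k : ι → ℕ) : ∀ᵐ y : ℝ, ∏ i, F i y ^ k i ≠ 0 := by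
  filter_upwards [ae_all_iff.mpr h] with y hy
  exact Finset.prod_ne_zero_iff.mpr fun i _ => pow_ne_zero _ (hy i)

namespace CriticalModel

variable {ι κ : Type*} [Fintype ι] [Fintype κ] {S P D : ℝ → ℝ → ℝ} {A B : ι → ℝ} {ν ν' : ι → ℕ}
  {u v w : κ → ℝ} {c : ℝ} {β d : ℕ}

/-- The critical exponent can be negative; even so, a power of a linear form with exponent
`critExp β d * d` is locally integrable. -/
theorem neg_one_lt_critExp_mul (M : CriticalModel S P D A B ν ν' u v w c β d) :
    -1 < critExp β d * d := by
  have hd : (0 : ℝ) < d := by exact_mod_cast M.degree_pos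
  have hb : (0 : ℝ) ≤ β := by positivity
  have : critExp β d * d = (d - β) / (2 * (β + 1)) := by unfold critExp; field_simp
  rw [this, lt_div_iff₀ (by positivity)]
  linarith

theorem line_ne_zero (M : CriticalModel S P D A B ν ν' u v w c β d) (i : ι) :
    A i ≠ 0 ∨ B i ≠ 0 := by
  by_contra! h0
  obtain ⟨ix, hx1, hx2⟩ := M.axis_x
  obtain ⟨iy, hy1, hy2⟩ := M.axis_y
  have hne : i ≠ ix := by rintro rfl; rw [hx2] at h0; exact one_ne_zero h0.2
  exact M.lines i ix hne (by rw [h0.1, h0.2]; ring)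

theorem quad_pos (M : CriticalModel S P D A B ν ν' u v w c β d) (k : κ) {x : ℝ} (hx : x ≠ 0)
    (y : ℝ) : 0 < u k * y ^ 2 + v k * x * y + w k * x ^ 2 := by
  obtain ⟨h1, h2⟩ := M.quad k
  have hx2 : 0 < x ^ 2 := by positivity
  have : 0 < 4 * u k * (u k * y ^ 2 + v k * x * y + w k * x ^ 2) := by
    nlinarith [sq_nonneg (2 * u k * y + v k * x), mul_pos (sub_pos.mpr h2) hx2]
  exact pos_of_mul_pos_right this (by linarith)

/-- A weighted geometric mean of negative powers of the factors of `D` is at most the arithmetic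
one. -/
theorem abs_damp_rpow_le_sum (M : CriticalModel S P D A B ν ν' u v w c β d) (α : ℝ) {x y : ℝ}
    (hx : x ≠ 0) :
    |D x y| ^ α ≤ ∑ i, (ν' i / d : ℝ) * |lin (A i) (B i) x y| ^ (α * d) +
      ∑ k, (2 / d : ℝ) * (u k * y ^ 2 + v k * x * y + w k * x ^ 2) ^ (α * d / 2) := by
  have hd : (0 : ℝ) < d := by exact_mod_cast M.degree_pos
  have hsum : ∑ i, (ν' i / d : ℝ) + ∑ _k : κ, (2 / d : ℝ) = 1 := by
    rw [← Finset.sum_div, Finset.sum_const, Finset.card_univ, nsmul_eq_mul, mul_div_assoc',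
      ← add_div, div_eq_one_iff_eq hd.ne']
    have := M.degree_damp
    rw [← this]; push_cast; ring
  have hgm := Real.geom_mean_le_arith_mean_weighted (Finset.univ : Finset (ι ⊕ κ))
    (Sum.elim (fun i => (ν' i / d : ℝ)) fun _ => (2 / d : ℝ))
    (Sum.elim (fun i => |lin (A i) (B i) x y| ^ (α * d)) fun k =>
      (u k * y ^ 2 + v k * x * y + w k * x ^ 2) ^ (α * d / 2))
    (by rintro (i | k) _ <;> simp only [Sum.elim_inl, Sum.elim_inr] <;> positivity)
    (by simpa only [Fintype.sum_sum_type, Sum.elim_inl, Sum.elim_inr] using hsum)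
    (by
      rintro (i | k) _ <;> simp only [Sum.elim_inl, Sum.elim_inr]
      · positivity
      · exact Real.rpow_nonneg (M.quad_pos k hx y).le _)
  simp only [Fintype.sum_sum_type, Fintype.prod_sum_type, Sum.elim_inl, Sum.elim_inr] at hgm
  refine le_trans (le_of_eq ?_) hgm
  rw [M.damp_eq x y, abs_mul, Real.mul_rpow (abs_nonneg _) (abs_nonneg _), Finset.abs_prod,
    Finset.abs_prod, ← Real.finsetProd_rpow _ _ fun _ _ => abs_nonneg _,
    ← Real.finsetProd_rpow _ _ fun _ _ => abs_nonneg _]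
  congr 1
  · refine Finset.prod_congr rfl fun i _ => ?_
    rw [abs_pow, ← Real.rpow_natCast, ← Real.rpow_mul (abs_nonneg _),
      ← Real.rpow_mul (abs_nonneg _)]
    congr 1; field_simp
  · refine Finset.prod_congr rfl fun k _ => ?_
    rw [abs_of_pos (M.quad_pos k hx y), ← Real.rpow_mul (M.quad_pos k hx y).le]
    congr 1; field_simp

/-- For almost every `x` the kernel is locally integrable in `y`, being dominated by a sum of powers of
the factors of `D` with exponents above `-1`. -/
theorem ae_integrable_kernel (M : CriticalModel S P D A B ν ν' u v w c β d) {z : ℂ}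
    (hz : z.re = critExp β d) :
    ∀ᵐ x : ℝ, ∀ f, TestFun f → Integrable fun y => kernel S D z x y * f y := by
  have h0 : ∀ᵐ x : ℝ, x ≠ 0 := Measure.ae_ne volume 0
  have h1 : ∀ᵐ x : ℝ, ∀ i, ∀ᵐ y : ℝ, lin (A i) (B i) x y ≠ 0 :=
    ae_all_iff.mpr fun i => ae_lin_ne_zero (M.line_ne_zero i)
  filter_upwards [h0, h1] with x hx hlin f hf
  refine hf.integrable_mul ?_
  set g : ℝ → ℝ := fun y => ∑ i, (ν' i / d : ℝ) * |lin (A i) (B i) x y| ^ (critExp β d * d) +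
      ∑ k, (2 / d : ℝ) * (u k * y ^ 2 + v k * x * y + w k * x ^ 2) ^ (critExp β d * d / 2) with hg
  have hgi : LocallyIntegrable g := by
    refine LocallyIntegrable.add (locallyIntegrable_finsetSum _ fun i _ => ?_)
      (Continuous.locallyIntegrable ?_)
    · exact (locallyIntegrable_abs_lin_rpow M.neg_one_lt_critExp_mul _ _ _).smul (ν' i / d : ℝ)
    · refine continuous_finsetSum _ fun k _ => continuous_const.mul ?_
      exact Continuous.rpow_const (by fun_prop) fun y => Or.inl (M.quad_pos k hx y).ne'
  refine hgi.mono
    ((measurable_kernel M.continuous_phase M.continuous_damp z).comp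
      measurable_prodMk_left).aestronglyMeasurable ?_
  filter_upwards [ae_ne_zero_of_prod hlin ν'] with y hy
  have hD : D x y ≠ 0 := by
    rw [M.damp_eq]
    exact mul_ne_zero hy (Finset.prod_ne_zero_iff.mpr fun k _ => (M.quad_pos k hx y).ne')
  show ‖kernel S D z x y‖ ≤ ‖g y‖
  rw [norm_kernel_of_ne hD, hz]
  exact (M.abs_damp_rpow_le_sum _ hx).trans (le_abs_self _)

end CriticalModel

end DampedOIO

namespace DampedOIO

open scoped Topology ComplexConjugate ENNReal
open Filter

/-! ### Oscillation of a monomial -/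

/-- The Fourier transform of a `C²` function with compact support decays quadratically. -/
theorem exists_norm_fourier_le {W : ℝ → ℝ} (hW : ContDiff ℝ 2 W) (hs : HasCompactSupport W) :
    ∃ C : ℝ, 0 < C ∧ ∀ ξ : ℝ, ‖∫ x, Complex.exp (Complex.I * ((ξ * x : ℝ) : ℂ)) * (W x : ℂ)‖ ≤ C ∧
      (ξ ≠ 0 → ‖∫ x, Complex.exp (Complex.I * ((ξ * x : ℝ) : ℂ)) * (W x : ℂ)‖ ≤ C * (1 / |ξ|) ^ 2) := by
  have h1 : ContDiff ℝ 1 (deriv W) := by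
    have := hW
    rw [show (2 : ℕ∞ω) = 1 + 1 from rfl, contDiff_succ_iff_deriv] at this
    exact this.2.2
  have h2 : Continuous (deriv (deriv W)) := h1.continuous_deriv le_rfl
  obtain ⟨M0, hM0⟩ := hW.continuous.bounded_above_of_compact_support hs
  obtain ⟨M1, hM1⟩ := h1.continuous.bounded_above_of_compact_support hs.deriv
  obtain ⟨M2, hM2⟩ := h2.bounded_above_of_compact_support hs.deriv.deriv
  obtain ⟨R, hR⟩ := hs.isCompact.isBounded.exists_norm_le
  have p0 : 0 ≤ M0 := (norm_nonneg _).trans (hM0 0)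
  have p1 : 0 ≤ M1 := (norm_nonneg _).trans (hM1 0)
  have p2 : 0 ≤ M2 := (norm_nonneg _).trans (hM2 0)
  set a := M0 + M1 + M2 with ha
  set ℓ := 2 * (|R| + 1) with hℓ
  have hI : Integrable fun x => (W x : ℂ) :=
    (Complex.continuous_ofReal.comp hW.continuous).integrable_of_hasCompactSupport
      (hs.comp_left (g := ((↑) : ℝ → ℂ)) rfl)
  refine ⟨4 * a * ℓ + (∫ x, ‖(W x : ℂ)‖) + 1, ?_, fun ξ => ⟨?_, fun hξ => ?_⟩⟩
  · have : 0 ≤ ∫ x, ‖(W x : ℂ)‖ := integral_nonneg fun _ => norm_nonneg _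
    positivity
  · refine (norm_integral_le_integral_norm _).trans ?_
    simp only [norm_mul, mul_comm Complex.I, Complex.norm_exp_ofReal_mul_I, one_mul]
    have : 0 ≤ 4 * a * ℓ := by positivity
    linarith
  · have key := norm_integral_exp_mul_le (A := fun x => (W x : ℂ)) (Φ := fun x => ξ * x)
      (Φ1 := fun _ => ξ) (Φ2 := fun _ => 0) (Φ3 := fun _ => 0)
      (U := Metric.ball (0 : ℝ) (|R| + 1)) (a := a) (κ := 0) (κ' := 1) (Λ := |ξ|) (ℓ := ℓ)
      Metric.isOpen_ball (abs_pos.mpr hξ) le_rfl zero_le_one (by positivity) (by positivity)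
      (fun y _ => ⟨by simpa using (hasDerivAt_id y).const_mul ξ, hasDerivAt_const _ _,
        hasDerivAt_const _ _, le_rfl, by simp, by simp⟩)
      ⟨fun x => ((deriv W x : ℝ) : ℂ), fun x => ((deriv (deriv W) x : ℝ) : ℂ), fun y _ =>
        ⟨((hW.differentiable (by norm_num)) y).hasDerivAt.ofReal_comp,
          ((h1.differentiable (by norm_num)) y).hasDerivAt.ofReal_comp, by
            rw [Complex.norm_real]; exact (hM0 y).trans (by linarith), by
            rw [Complex.norm_real]; exact (hM1 y).trans (by linarith), by
            rw [Complex.norm_real]; exact (hM2 y).trans (by linarith)⟩⟩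
      (fun y hy => by
        have hnot : y ∉ tsupport W := fun h => hy (by
          rw [mem_ball_zero_iff]
          exact lt_of_le_of_lt (hR y h) (by linarith [le_abs_self R]))
        filter_upwards [(isClosed_tsupport W).isOpen_compl.mem_nhds hnot] with w hw
        simp [image_eq_zero_of_notMem_tsupport hw])
      (by rw [Real.volume_ball])
    refine key.trans ?_
    rw [zero_add]
    have h0 : 0 ≤ ∫ x, ‖(W x : ℂ)‖ := integral_nonneg fun _ => norm_nonneg _
    calc 4 * a * (1 / |ξ|) ^ 2 * ℓ = 4 * a * ℓ * (1 / |ξ|) ^ 2 := by ring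
      _ ≤ _ := by gcongr; linarith

/-- `|y ^ k - t ^ k| ≥ |y - t| ^ k` for `y`, `t` of the same sign. -/
theorem abs_sub_pow_le {ε y t : ℝ} (hε : ε = 1 ∨ ε = -1) (hy : 0 < ε * y) (ht : 0 < ε * t) {k : ℕ}
    (hk : k ≠ 0) : |y - t| ^ k ≤ |y ^ k - t ^ k| := by
  have key : ∀ s r : ℝ, 0 < s → 0 < r → |s - r| ^ k ≤ |s ^ k - r ^ k| := by
    intro s r hs hr
    wlog h : r ≤ s generalizing s r
    · rw [abs_sub_comm, abs_sub_comm (s ^ k)]; exact this r s hr hs (le_of_not_ge h)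
    rw [abs_of_nonneg (by linarith)]
    refine le_trans ?_ (le_abs_self _)
    have := pow_add_pow_le (sub_nonneg.mpr h) hr.le hk
    rw [sub_add_cancel] at this
    linarith
  rcases hε with rfl | rfl
  · exact key y t (by linarith) (by linarith)
  · have := key (-y) (-t) (by linarith) (by linarith)
    rw [neg_pow y, neg_pow t, ← mul_sub, abs_mul, abs_pow, abs_neg, abs_one, one_pow, one_mul,
      show -y - -t = -(y - t) by ring, abs_neg] at this
    exact this

open Classical in
/-- The kernel `W(x) e^{i b x y ^ k}` restricted to `0 < ε y ≤ N`. -/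
noncomputable def monoKernel (W : ℝ → ℝ) (b : ℝ) (k : ℕ) (ε N x y : ℝ) : ℂ :=
  if 0 < ε * y ∧ ε * y ≤ N then Complex.exp (Complex.I * ((b * x * y ^ k : ℝ) : ℂ)) * (W x : ℂ)
  else 0

theorem measurable_monoKernel {W : ℝ → ℝ} (hW : Continuous W) (b : ℝ) (k : ℕ) (ε N : ℝ) :
    Measurable (Function.uncurry (monoKernel W b k ε N)) := by
  refine Measurable.ite ?_ ?_ measurable_const
  · exact ((isOpen_lt continuous_const
      (show Continuous fun p : ℝ × ℝ => ε * p.2 by fun_prop)).measurableSet).inter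
      (isClosed_le (show Continuous fun p : ℝ × ℝ => ε * p.2 by fun_prop)
        continuous_const).measurableSet
  · exact Continuous.measurable (show Continuous fun p : ℝ × ℝ =>
      Complex.exp (Complex.I * ((b * p.1 * p.2 ^ k : ℝ) : ℂ)) * (W p.1 : ℂ) by fun_prop)

theorem norm_monoKernel_le {W : ℝ → ℝ} (b : ℝ) (k : ℕ) (ε N x y : ℝ) :
    ‖monoKernel W b k ε N x y‖ ≤ |W x| := by
  unfold monoKernel
  split_ifs
  · rw [norm_mul, mul_comm Complex.I, Complex.norm_exp_ofReal_mul_I, one_mul, Complex.norm_real,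
      Real.norm_eq_abs]
  · simp

theorem niceKernel_monoKernel {W : ℝ → ℝ} (hW : Continuous W) (hs : HasCompactSupport W) (b : ℝ)
    (k : ℕ) {ε : ℝ} (hε : ε = 1 ∨ ε = -1) (N : ℝ) : NiceKernel (monoKernel W b k ε N) := by
  obtain ⟨M, hM⟩ := hW.bounded_above_of_compact_support hs
  obtain ⟨R, hR⟩ := hs.isCompact.isBounded.exists_norm_le
  have hM0 : 0 ≤ M := (norm_nonneg _).trans (hM 0)
  refine ⟨measurable_monoKernel hW .., M + |R| + |N|, by positivity, fun x y => ?_,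
    fun x y h => ⟨?_, ?_⟩⟩
  · refine (norm_monoKernel_le ..).trans ((hM x).trans ?_)
    linarith [abs_nonneg R, abs_nonneg N]
  · have hx : W x ≠ 0 := fun h0 => h (by
      have := norm_monoKernel_le (W := W) b k ε N x y
      rw [h0, abs_zero] at this
      exact norm_le_zero_iff.mp this)
    have := hR x (subset_tsupport W hx)
    rw [Real.norm_eq_abs] at this
    linarith [le_abs_self R, abs_nonneg N]
  · have hy : 0 < ε * y ∧ ε * y ≤ N := by
      by_contra hc
      exact h (if_neg hc)
    have : |y| = ε * y := by
      rw [← abs_of_pos hy.1, abs_mul]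
      rcases hε with rfl | rfl <;> simp
    rw [this]
    linarith [le_abs_self N, abs_nonneg R]

/-- The oscillation of `e^{i b x y ^ k}` gains `|b| ^ {-1 / (2 k)}`. -/
theorem exists_norm_kerOp_monoKernel_le {W : ℝ → ℝ} (hW : ContDiff ℝ 2 W)
    (hs : HasCompactSupport W) {k : ℕ} (hk : k ≠ 0) : ∃ C : ℝ, 0 < C ∧ ∀ b ε N : ℝ, b ≠ 0 →
      (ε = 1 ∨ ε = -1) →
      ‖kerOp (monoKernel W b k ε N)‖ ≤ C * |b| ^ (-(1 / (2 * (k : ℝ)))) := by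
  obtain ⟨C, hC, hF⟩ := exists_norm_fourier_le (W := fun x => W x ^ 2) (hW.pow 2)
    (hs.comp_left (g := fun t => t ^ 2) (by simp))
  refine ⟨Real.sqrt (2 * Real.pi * C), by positivity, fun b ε N hb hε => ?_⟩
  have hbp : 0 < |b| := abs_pos.mpr hb
  have hkp : (0 : ℝ) < k := by exact_mod_cast Nat.pos_of_ne_zero hk
  have hnice := niceKernel_monoKernel hW.continuous hs b k hε N
  obtain ⟨w, hw⟩ : ∃ w, w = |b| ^ (-(1 / (k : ℝ))) := ⟨_, rfl⟩
  have hw0 : 0 < w := by rw [hw]; positivity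
  have hwk : w ^ k * |b| = 1 := by
    rw [hw, ← Real.rpow_natCast, ← Real.rpow_mul hbp.le]
    have : -(1 / (k : ℝ)) * k = -1 := by field_simp
    rw [this, Real.rpow_neg_one, inv_mul_cancel₀ hbp.ne']
  -- the kernel of `T† T`
  have hker : ∀ y t, ‖∫ x, conj (monoKernel W b k ε N x y) * monoKernel W b k ε N x t‖ ≤ C ∧
      (y ≠ t → ‖∫ x, conj (monoKernel W b k ε N x y) * monoKernel W b k ε N x t‖ ≤
        C * (w / |y - t|) ^ 2) := by
    intro y t
    by_cases hyt : (0 < ε * y ∧ ε * y ≤ N) ∧ (0 < ε * t ∧ ε * t ≤ N)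
    · have heq : ∫ x, conj (monoKernel W b k ε N x y) * monoKernel W b k ε N x t =
          ∫ x, Complex.exp (Complex.I * ((b * (t ^ k - y ^ k) * x : ℝ) : ℂ)) *
            ((W x ^ 2 : ℝ) : ℂ) := by
        refine integral_congr_ae (.of_forall fun x => ?_)
        simp only [monoKernel, if_pos hyt.1, if_pos hyt.2, map_mul, ← Complex.exp_conj,
          Complex.conj_I, Complex.conj_ofReal]
        rw [mul_mul_mul_comm, ← Complex.exp_add]
        push_cast
        ring_nf
      rw [heq]
      refine ⟨(hF _).1, fun hne => ?_⟩
      have hp : 0 < |y - t| := abs_pos.mpr (sub_ne_zero.mpr hne)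
      have hge : |b| * |y - t| ^ k ≤ |b * (t ^ k - y ^ k)| := by
        rw [abs_mul, abs_sub_comm (t ^ k)]
        gcongr
        exact abs_sub_pow_le hε hyt.1.1 hyt.2.1 hk
      have hξ : b * (t ^ k - y ^ k) ≠ 0 := by
        rw [← abs_pos]; exact lt_of_lt_of_le (by positivity) hge
      have h2 : 1 / |b * (t ^ k - y ^ k)| ≤ (w / |y - t|) ^ k := by
        rw [div_pow, div_le_div_iff₀ (abs_pos.mpr hξ) (by positivity), one_mul]
        calc |y - t| ^ k = w ^ k * (|b| * |y - t| ^ k) := by rw [← mul_assoc, hwk, one_mul]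
          _ ≤ _ := by gcongr
      rcases le_total (w / |y - t|) 1 with h1 | h1
      · refine ((hF _).2 hξ).trans (mul_le_mul_of_nonneg_left
          (pow_le_pow_left₀ (by positivity) (h2.trans ?_) 2) hC.le)
        calc (w / |y - t|) ^ k ≤ (w / |y - t|) ^ 1 :=
              pow_le_pow_of_le_one (by positivity) h1 (Nat.one_le_iff_ne_zero.mpr hk)
          _ = _ := pow_one _
      · exact ((hF _).1).trans (le_mul_of_one_le_right hC.le (one_le_pow₀ h1))
    · have h0 : ∫ x, conj (monoKernel W b k ε N x y) * monoKernel W b k ε N x t = 0 := by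
        refine integral_eq_zero_of_ae (.of_forall fun x => ?_)
        rw [not_and_or] at hyt
        rcases hyt with h | h <;> simp [monoKernel, if_neg h]
      rw [h0, norm_zero]
      exact ⟨hC.le, fun _ => by positivity⟩
  have hTT : star (kerOp (monoKernel W b k ε N)) * kerOp (monoKernel W b k ε N) =
      kerOp fun y t => ∫ x, conj (monoKernel W b k ε N x y) * monoKernel W b k ε N x t := by
    rw [star_kerOp hnice, kerOp_mul hnice.swap.starKernel hnice]
  have hsq : ‖kerOp (monoKernel W b k ε N)‖ ^ 2 ≤ 2 * Real.pi * C * w := by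
    rw [sq, ← CStarRing.norm_star_mul_self, hTT]
    exact norm_kerOp_le_of_decay (hnice.swap.starKernel.comp hnice) hC.le hw0
      (fun y t => (hker y t).1) fun y t => (hker y t).2
  refine le_of_sq_le_sq (hsq.trans_eq ?_) (by positivity)
  rw [mul_pow, Real.sq_sqrt (by positivity), hw, ← Real.rpow_natCast, ← Real.rpow_mul hbp.le]
  congr 2
  push_cast
  field_simp

/-- The estimate for the whole line in `y`, as the sum of its two halves. -/
theorem exists_l2Bounded_monomial {W : ℝ → ℝ} (hW : ContDiff ℝ 2 W)
    (hs : HasCompactSupport W) {k : ℕ} (hk : k ≠ 0) : ∃ C : ℝ, 0 < C ∧ ∀ b : ℝ, b ≠ 0 →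
      L2Bounded (fun x y => Complex.exp (Complex.I * ((b * x * y ^ k : ℝ) : ℂ)) * (W x : ℂ))
        (C * |b| ^ (-(1 / (2 * (k : ℝ))))) := by
  classical
  obtain ⟨C, hC, h⟩ := exists_norm_kerOp_monoKernel_le hW hs hk
  refine ⟨2 * C, by positivity, fun b hb => ?_⟩
  obtain ⟨E, hE⟩ : ∃ E : ℝ → ℝ → ℂ, E = fun x y =>
    Complex.exp (Complex.I * ((b * x * y ^ k : ℝ) : ℂ)) * (W x : ℂ) := ⟨_, rfl⟩
  have hWc := hW.continuous
  have hm : Measurable (Function.uncurry E) := by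
    rw [hE]
    exact Continuous.measurable (show Continuous fun p : ℝ × ℝ =>
      Complex.exp (Complex.I * ((b * p.1 * p.2 ^ k : ℝ) : ℂ)) * (W p.1 : ℂ) by fun_prop)
  have hEn : ∀ x y, ‖E x y‖ ≤ |W x| := fun x y => by
    rw [hE, norm_mul, mul_comm Complex.I, Complex.norm_exp_ofReal_mul_I, one_mul,
      Complex.norm_real, Real.norm_eq_abs]
  obtain ⟨B, hB⟩ : ∃ B, B = C * |b| ^ (-(1 / (2 * (k : ℝ)))) := ⟨_, rfl⟩
  have hB0 : 0 ≤ B := by rw [hB]; positivity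
  -- the two half planes `0 < ε y`
  have half : ∀ ε : ℝ, ε = 1 ∨ ε = -1 →
      L2Bounded (fun x y => if 0 < ε * y then E x y else 0) B := by
    intro ε hε
    have hms : Measurable (Function.uncurry fun x y => if 0 < ε * y then E x y else 0) :=
      Measurable.ite (isOpen_lt continuous_const
        (show Continuous fun p : ℝ × ℝ => ε * p.2 by fun_prop)).measurableSet hm measurable_const
    refine L2Bounded.of_tendsto (G := fun N => monoKernel W b k ε (N : ℝ)) hms
      (.of_forall fun x f hf => hf.integrable_mul ?_) (fun N => L2Bounded.of_kerOp
        (niceKernel_monoKernel hWc hs b k hε N) (hB ▸ h b ε N hb hε)) (fun N x y => ?_)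
      fun x y => ?_
    · refine (locallyIntegrable_const |W x|).mono
        (hms.comp measurable_prodMk_left).aestronglyMeasurable (.of_forall fun y => ?_)
      refine le_trans ?_ (le_abs_self _)
      change ‖if 0 < ε * y then E x y else 0‖ ≤ |W x|
      split_ifs
      · exact hEn x y
      · simp
    · by_cases h1 : 0 < ε * y
      · by_cases h2 : ε * y ≤ N
        · simp [monoKernel, h1, h2, hE]
        · simp [monoKernel, h2]
      · simp [monoKernel, h1]
    · refine tendsto_const_nhds.congr' ?_
      filter_upwards [eventually_ge_atTop ⌈ε * y⌉₊] with N hN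
      have h2 : ε * y ≤ N := (Nat.le_ceil _).trans (by exact_mod_cast hN)
      simp [monoKernel, h2, hE]
  have hsum := (half 1 (Or.inl rfl)).add (half (-1) (Or.inr rfl)) hB0 hB0
  rw [show 2 * C * |b| ^ (-(1 / (2 * (k : ℝ)))) = B + B by rw [hB]; ring, ← hE]
  refine hsum.congr hm (.of_forall fun x => ?_)
  filter_upwards [Measure.ae_ne volume (0 : ℝ)] with y hy
  rcases lt_or_gt_of_ne hy with h1 | h1
  · rw [if_neg (by linarith), if_pos (by linarith), zero_add]
  · rw [if_pos (by linarith), if_neg (by linarith), add_zero]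

end DampedOIO

namespace DampedOIO

open scoped Topology ComplexConjugate ENNReal
open Filter

/-! ### Dilations -/

theorem eLpNorm_two_comp_mul_left {t : ℝ} (ht : 0 < t) {F : ℝ → ℂ} (hF : Measurable F) :
    eLpNorm (fun x => F (t * x)) 2 volume =
      ENNReal.ofReal t⁻¹ ^ (1 / 2 : ℝ) * eLpNorm F 2 volume := by
  have h1 := eLpNorm_map_measure (p := 2) (μ := (volume : Measure ℝ)) (f := fun x => t * x) (g := F)
    hF.aestronglyMeasurable (by fun_prop)
  rw [Real.map_volume_mul_left ht.ne', abs_of_pos (inv_pos.mpr ht),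
    eLpNorm_smul_measure_of_ne_top (by norm_num)] at h1
  rw [show (fun x => F (t * x)) = F ∘ fun x => t * x from rfl, ← h1, smul_eq_mul]
  norm_num

theorem TestFun.comp_mul_left {f : ℝ → ℂ} (hf : TestFun f) {t : ℝ} (ht : 0 < t) :
    TestFun fun y => f (t * y) := by
  obtain ⟨h1, R, h2⟩ := hf
  have hR0 : 0 ≤ R := (norm_nonneg _).trans (h2 0).1
  refine ⟨h1.comp (by fun_prop), R + t⁻¹ * R, fun y => ⟨?_, fun h => ?_⟩⟩
  · have := (h2 (t * y)).1
    have : 0 ≤ t⁻¹ * R := by positivity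
    linarith
  · have := (h2 (t * y)).2 h
    rw [abs_mul, abs_of_pos ht] at this
    have h3 : |y| ≤ t⁻¹ * R := by
      rw [inv_mul_eq_div, le_div_iff₀ ht]; linarith
    linarith

theorem ae_comp_mul_left {t : ℝ} (ht : 0 < t) {p : ℝ → Prop} (h : ∀ᵐ x : ℝ, p x) :
    ∀ᵐ x : ℝ, p (t * x) := by
  have hq : Measure.QuasiMeasurePreserving (fun x : ℝ => t * x) volume volume := by
    refine ⟨by fun_prop, ?_⟩
    rw [Real.map_volume_mul_left ht.ne']
    exact Measure.smul_absolutelyContinuous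
  exact hq.ae h

namespace L2Bounded

variable {K : ℝ → ℝ → ℂ} {B : ℝ}

theorem const_mul (hK : L2Bounded K B) (c : ℂ) :
    L2Bounded (fun x y => c * K x y) (‖c‖ * B) := by
  refine ⟨measurable_const.mul hK.meas, ?_, fun f hf => ?_⟩
  · filter_upwards [hK.int] with x h f hf
    simpa only [mul_assoc] using (h f hf).const_mul c
  · simp only [mul_assoc]
    simp_rw [integral_const_mul]
    have : (fun x => c * ∫ y, K x y * f y) = c • fun x => ∫ y, K x y * f y := rfl
    rw [this, eLpNorm_const_smul, ENNReal.ofReal_mul (norm_nonneg _), ofReal_norm, mul_assoc]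
    gcongr
    exact hK.le f hf

/-- Dilation of both variables by `t` divides the norm by `t`. -/
theorem dilate (hK : L2Bounded K B) {t : ℝ} (ht : 0 < t) :
    L2Bounded (fun x y => K (t * x) (t * y)) (t⁻¹ * B) := by
  have hti : 0 < t⁻¹ := inv_pos.mpr ht
  have hback : ∀ (f : ℝ → ℂ) (y : ℝ), f y = f (t⁻¹ * (t * y)) := fun f y => by
    rw [inv_mul_cancel_left₀ ht.ne']
  refine ⟨hK.meas.comp (show Measurable fun p : ℝ × ℝ => (t * p.1, t * p.2) by fun_prop), ?_,
    fun f hf => ?_⟩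
  · filter_upwards [ae_comp_mul_left ht hK.int] with x hx f hf
    refine ((hx _ (hf.comp_mul_left hti)).comp_mul_left' ht.ne').congr (.of_forall fun y => ?_)
    simp only [← hback f y]
  · have hg := hf.comp_mul_left hti
    have h1 : (fun x => ∫ y, K (t * x) (t * y) * f y) = fun x =>
        ((t⁻¹ : ℝ) : ℂ) • (fun x => ∫ y, K x y * f (t⁻¹ * y)) (t * x) := by
      funext x
      have := Measure.integral_comp_mul_left (fun y => K (t * x) y * f (t⁻¹ * y)) t
      simp only [← hback f] at this
      rw [this, abs_of_pos hti, Complex.real_smul, smul_eq_mul]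
    have hm : Measurable fun x => ∫ y, K x y * f (t⁻¹ * y) :=
      ((hK.meas.mul (hg.1.comp measurable_snd)).stronglyMeasurable.integral_prod_right'
        (ν := (volume : Measure ℝ))).measurable
    have h2 : eLpNorm f 2 volume =
        ENNReal.ofReal t⁻¹ ^ (1 / 2 : ℝ) * eLpNorm (fun y => f (t⁻¹ * y)) 2 volume := by
      rw [← eLpNorm_two_comp_mul_left ht hg.1]
      simp only [← hback f]
    rw [h1]
    have h3 : (fun x => ((t⁻¹ : ℝ) : ℂ) • (fun x => ∫ y, K x y * f (t⁻¹ * y)) (t * x)) =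
      ((t⁻¹ : ℝ) : ℂ) • fun x => (fun x => ∫ y, K x y * f (t⁻¹ * y)) (t * x) := rfl
    rw [h3, eLpNorm_const_smul, eLpNorm_two_comp_mul_left ht hm, h2, ENNReal.ofReal_mul hti.le,
      ← ofReal_norm, Complex.norm_real, Real.norm_eq_abs, abs_of_pos hti, mul_assoc]
    rw [mul_left_comm (ENNReal.ofReal B)]
    gcongr
    exact hK.le _ hg

end L2Bounded

/-! ### Mixed derivative equal to a power of `y` -/

/-- A function whose mixed derivative is `c y ^ β` is `c x y ^ (β + 1) / (β + 1)` up to functions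
of one variable. -/
theorem eq_add_of_mixed_eq_pow {S S1 : ℝ → ℝ → ℝ} {c : ℝ} {β : ℕ}
    (h1 : ∀ x y, HasDerivAt (fun y => S x y) (S1 x y) y)
    (h2 : ∀ x y, HasDerivAt (fun x => S1 x y) (c * y ^ β) x) (x y : ℝ) :
    S x y = S x 0 + c / ((β : ℝ) + 1) * x * y ^ (β + 1) + (S 0 y - S 0 0) := by
  have hβ : ((β : ℝ) + 1) ≠ 0 := by positivity
  have e1 : ∀ x y, S1 x y = S1 0 y + c * y ^ β * x := by
    intro x y
    have hd : ∀ x, HasDerivAt (fun x => S1 x y - c * y ^ β * x) 0 x := fun x => by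
      refine ((h2 x y).fun_sub ((hasDerivAt_id x).const_mul (c * y ^ β))).congr_deriv ?_
      rw [mul_one, sub_self]
    have := is_const_of_deriv_eq_zero (fun x => (hd x).differentiableAt)
      (fun x => (hd x).deriv) x 0
    simp only [mul_zero, sub_zero] at this
    linarith
  have hd : ∀ y, HasDerivAt
      (fun y => S x y - S 0 y - c / ((β : ℝ) + 1) * x * y ^ (β + 1)) 0 y := fun y => by
    refine (((h1 x y).fun_sub (h1 0 y)).fun_sub
      ((hasDerivAt_pow (β + 1) y).const_mul (c / ((β : ℝ) + 1) * x))).congr_deriv ?_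
    rw [e1 x y]
    rw [Nat.add_sub_cancel]
    push_cast
    field_simp
    ring
  have := is_const_of_deriv_eq_zero (fun y => (hd y).differentiableAt) (fun y => (hd y).deriv) y 0
  simp only [ne_eq, Nat.add_eq_zero_iff, one_ne_zero, and_false, not_false_eq_true, zero_pow,
    mul_zero, sub_zero] at this
  linarith

theorem exists_l2Bounded_of_mixed_eq_pow {S S1 : ℝ → ℝ → ℝ} {c : ℝ} (hc : c ≠ 0) {β : ℕ}
    (h1 : ∀ x y, HasDerivAt (fun y => S x y) (S1 x y) y)
    (h2 : ∀ x y, HasDerivAt (fun x => S1 x y) (c * y ^ β) x)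
    (hS : Continuous (Function.uncurry S)) {φ : ℝ × ℝ → ℂ} (hφ : ContDiff ℝ ∞ φ)
    (hs : HasCompactSupport φ) : ∃ C : ℝ, 0 < C ∧ ∀ l : ℝ, l ≠ 0 →
      L2Bounded (fun x y => Complex.exp (Complex.I * ((l * S x y : ℝ) : ℂ)) * φ (x, y))
        (C * |l| ^ (-(1 / (2 * ((β : ℝ) + 1))))) := by
  obtain ⟨R, hR⟩ := hs.isCompact.isBounded.exists_norm_le
  let W : ContDiffBump (0 : ℝ) := ⟨|R| + 1, |R| + 2, by positivity, by linarith⟩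
  have hW1 : ∀ x y, (W x : ℂ) * φ (x, y) = φ (x, y) := by
    intro x y
    by_cases h : φ (x, y) = 0
    · rw [h, mul_zero]
    · have hx : |x| ≤ |R| + 1 := by
        have := (norm_fst_le (x, y)).trans (hR _ (subset_tsupport φ h))
        rw [Real.norm_eq_abs] at this
        linarith [le_abs_self R]
      rw [W.one_of_mem_closedBall (by simpa using hx)]
      simp
  obtain ⟨C₁, hC₁, H₁⟩ := exists_l2Bounded_monomial (W := W) W.contDiff W.hasCompactSupport
    (Nat.succ_ne_zero β)
  obtain ⟨C₂, hC₂, H₂⟩ := exists_l2Bounded_mul_smooth hφ hs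
  obtain ⟨b, hb⟩ : ∃ b, b = c / ((β : ℝ) + 1) := ⟨_, rfl⟩
  have hb0 : b ≠ 0 := by rw [hb]; exact div_ne_zero hc (by positivity)
  have hb1 : 0 < |b| := abs_pos.mpr hb0
  refine ⟨C₂ * (C₁ * |b| ^ (-(1 / (2 * ((β : ℝ) + 1))))), by positivity, fun l hl => ?_⟩
  have hSx : Continuous fun x => S x 0 := hS.comp (Continuous.prodMk_left 0)
  have hSy : Continuous fun y => S 0 y := hS.comp (Continuous.prodMk_right 0)
  have hexp : ∀ g : ℝ → ℝ, Continuous g →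
      Measurable (fun x => Complex.exp (Complex.I * ((g x : ℝ) : ℂ))) ∧
      ∀ x, ‖Complex.exp (Complex.I * ((g x : ℝ) : ℂ))‖ ≤ 1 := fun g hg =>
    ⟨Continuous.measurable (by fun_prop), fun x => by
      rw [mul_comm, Complex.norm_exp_ofReal_mul_I]⟩
  obtain ⟨m1, n1⟩ := hexp (fun x => l * S x 0) (by fun_prop)
  obtain ⟨m2, n2⟩ := hexp (fun y => l * (S 0 y - S 0 0)) (by fun_prop)
  have key := H₂ _ _ (by positivity)
    (((H₁ (l * b) (mul_ne_zero hl hb0)).mul_left m1 n1).mul_right m2 n2)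
  have hbound : C₂ * (C₁ * |l * b| ^ (-(1 / (2 * ((β + 1 : ℕ) : ℝ))))) =
      C₂ * (C₁ * |b| ^ (-(1 / (2 * ((β : ℝ) + 1))))) * |l| ^ (-(1 / (2 * ((β : ℝ) + 1)))) := by
    rw [abs_mul, Real.mul_rpow (abs_nonneg _) (abs_nonneg _)]
    push_cast
    ring
  rw [hbound] at key
  convert key using 3 with x y
  conv_lhs => rw [← hW1 x y]
  simp only [← mul_assoc]
  congr 1
  rw [mul_right_comm _ _ (Complex.exp _), ← Complex.exp_add, ← Complex.exp_add,
    eq_add_of_mixed_eq_pow h1 h2 x y, ← hb, Nat.succ_eq_add_one]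
  push_cast
  ring_nf

end DampedOIO

namespace DampedOIO

open scoped Topology ComplexConjugate ENNReal
open Filter

/-! ### Homogeneity in the parameter -/

theorem CriticalModel.neg {ι κ : Type*} [Fintype ι] [Fintype κ] {S P D : ℝ → ℝ → ℝ} {A B : ι → ℝ}
    {ν ν' : ι → ℕ} {u v w : κ → ℝ} {c : ℝ} {β d : ℕ}
    (M : CriticalModel S P D A B ν ν' u v w c β d) :
    CriticalModel (fun x y => -S x y) (fun x y => -P x y) D A B ν ν' u v w (-c) β d where
  phase_eq := by
    obtain ⟨s, c, p, q, rfl, rfl⟩ := M.phase_eq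
    refine ⟨s, fun k => -c k, p, q, ?_, ?_⟩ <;>
    · funext x y
      simp only [monoSum, ← Finset.sum_neg_distrib, neg_mul]
  const_ne := neg_ne_zero.mpr M.const_ne
  mixed_eq x y := by rw [M.mixed_eq]; ring
  damp_eq := M.damp_eq
  lines := M.lines
  quad := M.quad
  axis_x := M.axis_x
  axis_y := M.axis_y
  slanted := M.slanted
  degree_pos := M.degree_pos
  degree_damp := M.degree_damp
  degree_mixed := M.degree_mixed
  exponent_y := M.exponent_y
  exponent_ne := M.exponent_ne

/-- The dependence of the norm on the coefficient `l` of the phase follows by dilating both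
variables by `|l| ^ {1 / n}`. -/
theorem CriticalModel.exists_l2Bounded_smul {ι κ : Type*} [Fintype ι] [Fintype κ]
    {S P D : ℝ → ℝ → ℝ} {A B : ι → ℝ} {ν ν' : ι → ℕ} {u v w : κ → ℝ} {c : ℝ} {β d : ℕ}
    (M : CriticalModel S P D A B ν ν' u v w c β d)
    (hS : ∀ t x y, S (t * x) (t * y) = t ^ (d + β + 2) * S x y)
    (hD : ∀ t x y, D (t * x) (t * y) = t ^ d * D x y) :
    ∃ C : ℝ, 0 < C ∧ ∀ z : ℂ, z.re = critExp β d → ∀ l : ℝ, l ≠ 0 →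
      L2Bounded (kernel (fun x y => l * S x y) D z)
        (C * (1 + ‖z‖) * |l| ^ (-(1 / (2 * ((β : ℝ) + 1))))) := by
  obtain ⟨C₁, h₁, H₁⟩ := M.exists_l2Bounded fun z hz => M.ae_integrable_kernel hz
  obtain ⟨C₂, h₂, H₂⟩ := M.neg.exists_l2Bounded fun z hz => M.neg.ae_integrable_kernel hz
  have hsign : ∀ ε : ℝ, ε = 1 ∨ ε = -1 → ∀ z : ℂ, z.re = critExp β d →
      L2Bounded (kernel (fun x y => ε * S x y) D z) ((C₁ + C₂) * (1 + ‖z‖)) := by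
    intro ε hε z hz
    have hn : 0 ≤ 1 + ‖z‖ := by positivity
    rcases hε with rfl | rfl
    · simp only [one_mul]
      exact (H₁ z hz).mono (by gcongr; linarith)
    · simp only [neg_mul, one_mul]
      exact (H₂ z hz).mono (by gcongr; linarith)
  refine ⟨C₁ + C₂, by positivity, fun z hz l hl => ?_⟩
  have hlp : 0 < |l| := abs_pos.mpr hl
  obtain ⟨ε, hε, hεl⟩ : ∃ ε : ℝ, (ε = 1 ∨ ε = -1) ∧ ε * |l| = l := by
    rcases le_total 0 l with h | h
    · exact ⟨1, Or.inl rfl, by rw [abs_of_nonneg h, one_mul]⟩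
    · exact ⟨-1, Or.inr rfl, by rw [abs_of_nonpos h]; ring⟩
  obtain ⟨t, ht⟩ : ∃ t, t = |l| ^ (1 / ((d + β + 2 : ℕ) : ℝ)) := ⟨_, rfl⟩
  have ht0 : 0 < t := by rw [ht]; positivity
  have htn : t ^ (d + β + 2) = |l| := by
    rw [ht, ← Real.rpow_natCast, ← Real.rpow_mul hlp.le, one_div,
      inv_mul_cancel₀ (by positivity), Real.rpow_one]
  have htd : 0 < t ^ d := by positivity
  have key := ((hsign ε hε z hz).dilate ht0).const_mul ((((t ^ d : ℝ) : ℂ) ^ z)⁻¹)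
  have hd0 : (0 : ℝ) < d := by exact_mod_cast M.degree_pos
  have hnorm : ‖(((t ^ d : ℝ) : ℂ) ^ z)⁻¹‖ * (t⁻¹ * ((C₁ + C₂) * (1 + ‖z‖))) =
      (C₁ + C₂) * (1 + ‖z‖) * |l| ^ (-(1 / (2 * ((β : ℝ) + 1)))) := by
    have : ‖(((t ^ d : ℝ) : ℂ) ^ z)⁻¹‖ * t⁻¹ = |l| ^ (-(1 / (2 * ((β : ℝ) + 1)))) := by
      rw [norm_inv, Complex.norm_cpow_eq_rpow_re_of_pos htd, hz, ← Real.rpow_neg htd.le,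
        ← Real.rpow_natCast, ← Real.rpow_mul ht0.le, ← Real.rpow_neg_one, ← Real.rpow_add ht0, ht,
        ← Real.rpow_mul hlp.le, critExp]
      congr 1
      push_cast
      field_simp
      ring
    rw [← this]; ring
  rw [hnorm] at key
  convert key using 1
  funext x y
  have hne : ((t ^ d : ℝ) : ℂ) ^ z ≠ 0 := by
    rw [Complex.cpow_ne_zero_iff]
    exact Or.inl (by exact_mod_cast htd.ne')
  simp only [kernel]
  rw [hS, hD, htn, ← mul_assoc ε, hεl, abs_mul, abs_of_pos htd, Complex.ofReal_mul (t ^ d),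
    Complex.mul_cpow_ofReal_nonneg htd.le (abs_nonneg _)]
  field_simp

/-! ### Factored mixed derivatives -/

theorem phase_eq_monoSum (n : ℕ) (a : ℕ → ℝ) :
    phase n a = monoSum (Finset.range (n + 1)) a (fun k => n - k) (fun k => k) 0 0 := by
  funext x y
  simp [phase, monoSum]

theorem mixedDeriv_monoSum (s : Finset ℕ) (c : ℕ → ℝ) (p q : ℕ → ℕ) (x y : ℝ) :
    mixedDeriv (monoSum s c p q 0 0) x y = monoSum s c p q 1 1 x y := by
  have h : (fun u => deriv (fun v => monoSum s c p q 0 0 u v) y) =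
      fun u => monoSum s c p q 0 1 u y :=
    funext fun u => (hasDerivAt_monoSum_right s c p q 0 0 u y).deriv
  rw [mixedDeriv, h]
  exact (hasDerivAt_monoSum_left s c p q 0 1 x y).deriv

theorem phase_mul_mul (n : ℕ) (a : ℕ → ℝ) (t x y : ℝ) :
    phase n a (t * x) (t * y) = t ^ n * phase n a x y := by
  simp only [phase, Finset.mul_sum]
  refine Finset.sum_congr rfl fun k hk => ?_
  have : n = (n - k) + k := by have := Finset.mem_range.mp hk; omega
  rw [mul_pow, mul_pow]
  nth_rewrite 3 [this]
  rw [pow_add]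
  ring

theorem mixed_mul_mul (n : ℕ) (a : ℕ → ℝ) (t x y : ℝ) :
    monoSum (Finset.range (n + 1)) a (fun k => n - k) (fun k => k) 1 1 (t * x) (t * y) =
      t ^ (n - 2) *
        monoSum (Finset.range (n + 1)) a (fun k => n - k) (fun k => k) 1 1 x y := by
  simp only [monoSum, Finset.mul_sum, Nat.descFactorial_one]
  refine Finset.sum_congr rfl fun k hk => ?_
  rcases Nat.eq_zero_or_pos k with rfl | h0
  · simp
  rcases Nat.eq_zero_or_pos (n - k) with h1 | h1
  · simp [h1]
  have : n - 2 = (n - k - 1) + (k - 1) := by omega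
  rw [mul_pow, mul_pow, this, pow_add]
  ring

/-- The value of a binary quadratic form in terms of its three coefficients. -/
theorem quadraticForm_apply (q : QuadraticForm ℝ (ℝ × ℝ)) (x y : ℝ) :
    q (x, y) = q (0, 1) * y ^ 2 + QuadraticMap.polar q (1, 0) (0, 1) * x * y +
      q (1, 0) * x ^ 2 := by
  have : (x, y) = x • ((1, 0) : ℝ × ℝ) + y • ((0, 1) : ℝ × ℝ) := by simp
  rw [this, QuadraticMap.map_add q, QuadraticMap.map_smul, QuadraticMap.map_smul,
    QuadraticMap.polar_smul_left, QuadraticMap.polar_smul_right]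
  simp only [smul_eq_mul]
  ring

theorem quadraticForm_discrim {q : QuadraticForm ℝ (ℝ × ℝ)} (hq : q.PosDef) :
    0 < q (0, 1) ∧
      QuadraticMap.polar q (1, 0) (0, 1) ^ 2 < 4 * q (0, 1) * q (1, 0) := by
  have h1 : 0 < q (0, 1) := hq _ (by simp)
  have h2 : 0 < q (1, 0) := hq _ (by simp)
  refine ⟨h1, ?_⟩
  have h3 := hq (-QuadraticMap.polar q (1, 0) (0, 1), 2 * q (1, 0)) (by
    simp [Prod.ext_iff, h2.ne'])
  rw [quadraticForm_apply] at h3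
  have h4 : 0 < q (1, 0) *
      (4 * q (0, 1) * q (1, 0) - QuadraticMap.polar q (1, 0) (0, 1) ^ 2) := by
    linarith
  linarith [(mul_pos_iff_of_pos_left h2).mp h4]

section Factored

variable {n : ℕ} {a : ℕ → ℝ} {c : ℝ} {γ β m s : ℕ} {α : Fin m → ℝ} {μ : Fin m → ℕ}
  {Q : Fin s → QuadraticForm ℝ (ℝ × ℝ)}

theorem damping_mul_mul (t x y : ℝ) :
    damping γ α μ Q (t * x) (t * y) = t ^ (γ + ∑ j, μ j + 2 * s) * damping γ α μ Q x y := by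
  have h1 : ∀ j, (t * y - α j * (t * x)) ^ μ j = t ^ μ j * (y - α j * x) ^ μ j := fun j => by
    rw [← mul_pow]; ring
  have h2 : ∀ j, Q j (t * x, t * y) = t ^ 2 * Q j (x, y) := fun j => by
    have : (t * x, t * y) = t • (x, y) := by simp
    rw [this, QuadraticMap.map_smul, smul_eq_mul, sq]
  simp only [damping, h1, h2, Finset.prod_mul_distrib, Finset.prod_const, Finset.card_univ,
    Fintype.card_fin, Finset.prod_pow_eq_pow_sum, pow_add, pow_mul, mul_pow]
  ring

/-- The degrees of the two sides of the factorization agree. -/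
theorem degree_eq (hc : c ≠ 0) (hQ : ∀ j, (Q j).PosDef)
    (hS : ∀ x y : ℝ, mixedDeriv (phase n a) x y =
      c * x ^ γ * y ^ β * (∏ j, (y - α j * x) ^ μ j) * ∏ j, Q j (x, y)) :
    γ + β + ∑ j, μ j + 2 * s = n - 2 := by
  obtain ⟨y, hy⟩ := Infinite.exists_notMem_finset (insert 0 (Finset.univ.image α))
  simp only [Finset.mem_insert, Finset.mem_image, Finset.mem_univ, true_and, not_or,
    not_exists] at hy
  have hP : ∀ x y, mixedDeriv (phase n a) x y = c * y ^ β * damping γ α μ Q x y := fun x y => by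
    rw [hS, damping]; ring
  have hne : mixedDeriv (phase n a) 1 y ≠ 0 := by
    rw [hP, damping]
    refine mul_ne_zero (mul_ne_zero hc (pow_ne_zero _ hy.1)) (mul_ne_zero (mul_ne_zero
      (by simp) (Finset.prod_ne_zero_iff.mpr fun j _ => pow_ne_zero _ ?_))
      (Finset.prod_ne_zero_iff.mpr fun j _ => (hQ j _ (by simp)).ne'))
    rw [mul_one, sub_ne_zero]
    exact fun h => hy.2 j h.symm
  have e1 : mixedDeriv (phase n a) (2 * 1) (2 * y) = 2 ^ (n - 2) * mixedDeriv (phase n a) 1 y := by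
    rw [phase_eq_monoSum, mixedDeriv_monoSum, mixedDeriv_monoSum, mixed_mul_mul]
  have e2 : mixedDeriv (phase n a) (2 * 1) (2 * y) =
      2 ^ (γ + β + ∑ j, μ j + 2 * s) * mixedDeriv (phase n a) 1 y := by
    rw [hP, hP, damping_mul_mul]; ring
  have e3 := mul_right_cancel₀ hne (e2.symm.trans e1)
  exact (pow_right_injective₀ (by norm_num : (0 : ℝ) < 2) (by norm_num)) e3

/-- A function on `Fin m` extended to the indices `none` and `some none`, which stand for the
lines `x = 0` and `y = 0`. -/
def withAxes {T : Type*} (p q : T) (f : Fin m → T) : Option (Option (Fin m)) → T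
  | none => p
  | some none => q
  | some (some j) => f j

theorem criticalModel_phase (hc : c ≠ 0) (hα : ∀ j, α j ≠ 0) (hα_inj : Function.Injective α)
    (hμ : ∀ j, 0 < μ j) (hQ : ∀ j, (Q j).PosDef)
    (hS : ∀ x y : ℝ, mixedDeriv (phase n a) x y =
      c * x ^ γ * y ^ β * (∏ j, (y - α j * x) ^ μ j) * ∏ j, Q j (x, y)) {d : ℕ} (hd : 0 < d)
    (hdeg : γ + ∑ j, μ j + 2 * s = d) :
    CriticalModel (phase n a) (mixedDeriv (phase n a)) (damping γ α μ Q)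
      (withAxes 0 1 fun _ : Fin m => (1 : ℝ)) (withAxes 1 0 fun j => -α j)
      (withAxes γ β μ) (withAxes γ 0 μ) (fun j => Q j (0, 1))
      (fun j => QuadraticMap.polar (Q j) (1, 0) (0, 1)) (fun j => Q j (1, 0)) c β d where
  phase_eq := ⟨_, _, _, _, phase_eq_monoSum n a, by
    funext x y; rw [phase_eq_monoSum, mixedDeriv_monoSum]⟩
  const_ne := hc
  mixed_eq x y := by
    simp only [hS, Fintype.prod_option, withAxes, lin, ← quadraticForm_apply]
    simp only [zero_mul, one_mul, zero_add, add_zero, neg_mul, ← sub_eq_add_neg]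
    ring
  damp_eq x y := by
    simp only [damping, Fintype.prod_option, withAxes, lin, ← quadraticForm_apply]
    simp only [zero_mul, one_mul, zero_add, add_zero, neg_mul, ← sub_eq_add_neg, pow_zero]
  lines := by
    rintro (_ | _ | i) (_ | _ | j) h <;> simp [withAxes, hα] at h ⊢
    exact fun h0 => h (hα_inj (by linarith))
  quad j := quadraticForm_discrim (hQ j)
  axis_x := ⟨none, rfl, rfl⟩
  axis_y := ⟨some none, rfl, rfl⟩
  slanted := by
    rintro (_ | _ | i) h1 h2
    · exact absurd rfl h1
    · exact absurd rfl h2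
    · exact hμ i
  degree_pos := hd
  degree_damp := by
    simp only [Fintype.sum_option, withAxes, Fintype.card_fin]
    omega
  degree_mixed := by
    simp only [Fintype.sum_option, withAxes, Fintype.card_fin]
    omega
  exponent_y := by
    rintro (_ | _ | i) h
    · exact absurd h one_ne_zero
    · exact ⟨rfl, rfl⟩
    · exact absurd h (neg_ne_zero.mpr (hα i))
  exponent_ne := by
    rintro (_ | _ | i) h
    · rfl
    · exact absurd rfl h
    · rfl

end Factored

theorem critExp_eq_criticalExponent {n β d : ℕ} (hd : 0 < d) (h : n = d + β + 2) :
    critExp β d = criticalExponent n β := by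
  have hd0 : (d : ℝ) ≠ 0 := by positivity
  rw [critExp, criticalExponent, h]
  push_cast
  rw [show (d : ℝ) + β + 2 - β - 2 = d by ring]
  field_simp
  ring

theorem one_add_norm_le (z : ℂ) : 1 + ‖z‖ ≤ (1 + |z.re|) * (1 + |z.im|) ^ 2 := by
  have := Complex.norm_le_abs_re_add_abs_im z
  nlinarith [abs_nonneg z.re, abs_nonneg z.im, mul_nonneg (abs_nonneg z.re) (abs_nonneg z.im),
    mul_nonneg (abs_nonneg z.re) (sq_nonneg |z.im|), sq_nonneg |z.im|]

end DampedOIO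

theorem mainTheorem3 (n : ℕ) (hn : 3 ≤ n) (a : ℕ → ℝ)
    (c : ℝ) (hc : c ≠ 0) (γ β m s : ℕ)
    (α : Fin m → ℝ) (hα : ∀ j, α j ≠ 0) (hα_inj : Function.Injective α)
    (μ : Fin m → ℕ) (hμ : ∀ j, 0 < μ j)
    (Q : Fin s → QuadraticForm ℝ (ℝ × ℝ)) (hQ : ∀ j, (Q j).PosDef)
    (hS : ∀ x y : ℝ, DampedOIO.mixedDeriv (DampedOIO.phase n a) x y =
      c * x ^ γ * y ^ β * (∏ j, (y - α j * x) ^ μ j) * ∏ j, Q j (x, y)) :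
    (β + 2 < n →
      ∃ C : ℝ, 0 < C ∧ ∀ z : ℂ, z.re = DampedOIO.criticalExponent n β →
        DampedOIO.ExtendsToL2WithNormLE
          (DampedOIO.kernel (DampedOIO.phase n a) (DampedOIO.damping γ α μ Q) z)
          (C * (1 + |z.im|) ^ 2)) ∧
    (∀ φ : ℝ × ℝ → ℂ, ContDiff ℝ ∞ φ → HasCompactSupport φ →
      ∃ C : ℝ, 0 < C ∧ ∀ z : ℂ, (β + 2 < n → z.re = DampedOIO.criticalExponent n β) →
        ∀ lam : ℝ, lam ≠ 0 →
          DampedOIO.ExtendsToL2WithNormLE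
            (DampedOIO.cutoffKernel (DampedOIO.phase n a) (DampedOIO.damping γ α μ Q) z lam φ)
            (C * (1 + |z.im|) ^ 2 * |lam| ^ (-(1 / (2 * ((β : ℝ) + 1)))))) := by
  have hdeg := DampedOIO.degree_eq hc hQ hS
  by_cases hβ : β + 2 < n
  · -- `D` has positive degree
    obtain ⟨d, hd⟩ : ∃ d, d = γ + ∑ j, μ j + 2 * s := ⟨_, rfl⟩
    have hd0 : 0 < d := by omega
    have hnd : n = d + β + 2 := by omega
    have M := DampedOIO.criticalModel_phase hc hα hα_inj hμ hQ hS hd0 hd.symm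
    have hcrit := DampedOIO.critExp_eq_criticalExponent hd0 hnd
    obtain ⟨K, hK, H⟩ := M.exists_l2Bounded_smul
      (fun t x y => by rw [← hnd, DampedOIO.phase_mul_mul])
      fun t x y => by rw [hd, DampedOIO.damping_mul_mul]
    rw [hcrit] at H
    obtain ⟨A, hA⟩ : ∃ A, A = 1 + abs (DampedOIO.criticalExponent n β) := ⟨_, rfl⟩
    have hA0 : 0 < A := by rw [hA]; positivity
    have hz1 : ∀ z : ℂ, z.re = DampedOIO.criticalExponent n β →
        1 + ‖z‖ ≤ A * (1 + |z.im|) ^ 2 := fun z hz => by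
      rw [hA, ← hz]; exact DampedOIO.one_add_norm_le z
    refine ⟨fun _ => ⟨K * A, by positivity, fun z hz => ?_⟩, fun φ hφ hs => ?_⟩
    · have h1 := H z hz 1 one_ne_zero
      simp only [one_mul, abs_one, Real.one_rpow, mul_one] at h1
      refine (h1.mono ?_).extendsToL2 (by positivity)
      rw [mul_assoc]
      exact mul_le_mul_of_nonneg_left (hz1 z hz) hK.le
    · obtain ⟨C, hC, HC⟩ := DampedOIO.exists_l2Bounded_mul_smooth hφ hs
      refine ⟨C * (K * A), by positivity, fun z hz l hl => ?_⟩
      refine ((HC _ _ (by positivity) (H z (hz hβ) l hl)).mono ?_).extendsToL2 (by positivity)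
      have := mul_le_mul_of_nonneg_left (hz1 z (hz hβ)) hK.le
      calc C * (K * (1 + ‖z‖) * |l| ^ (-(1 / (2 * ((β : ℝ) + 1)))))
          ≤ C * (K * (A * (1 + |z.im|) ^ 2) * |l| ^ (-(1 / (2 * ((β : ℝ) + 1))))) := by gcongr
        _ = _ := by ring
  · -- `D` is constant and the mixed derivative is `c y ^ β`
    refine ⟨fun h => absurd h hβ, fun φ hφ hs => ?_⟩
    obtain rfl : γ = 0 := by omega
    obtain rfl : s = 0 := by omega
    have hm : IsEmpty (Fin m) := ⟨fun j => by
      have h1 := hμ j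
      have h2 : μ j ≤ ∑ j, μ j := Finset.single_le_sum (fun _ _ => Nat.zero_le _) (Finset.mem_univ j)
      omega⟩
    have hD : ∀ x y, DampedOIO.damping 0 α μ Q x y = 1 := fun x y => by simp [DampedOIO.damping]
    have hmix : ∀ x y, DampedOIO.monoSum (Finset.range (n + 1)) a (fun k => n - k) (fun k => k)
        1 1 x y = c * y ^ β := fun x y => by
      rw [← DampedOIO.mixedDeriv_monoSum, ← DampedOIO.phase_eq_monoSum, hS]
      simp
    obtain ⟨C, hC, H⟩ := DampedOIO.exists_l2Bounded_of_mixed_eq_pow (β := β) hc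
      (DampedOIO.hasDerivAt_monoSum_right (Finset.range (n + 1)) a (fun k => n - k) (fun k => k) 0 0)
      (fun x y => by
        rw [← hmix x y]
        exact DampedOIO.hasDerivAt_monoSum_left _ _ _ _ 0 1 x y)
      (DampedOIO.continuous_monoSum ..) hφ hs
    rw [← DampedOIO.phase_eq_monoSum] at H
    refine ⟨C, hC, fun z _ l hl => ?_⟩
    have heq : DampedOIO.cutoffKernel (DampedOIO.phase n a) (DampedOIO.damping 0 α μ Q) z l φ =
        fun x y => Complex.exp (Complex.I * ((l * DampedOIO.phase n a x y : ℝ) : ℂ)) * φ (x, y) := by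
      funext x y
      simp [DampedOIO.cutoffKernel, DampedOIO.kernel, hD]
    rw [heq]
    refine ((H l hl).mono ?_).extendsToL2 (by positivity)
    have h1 : (1 : ℝ) ≤ (1 + |z.im|) ^ 2 := one_le_pow₀ (by linarith [abs_nonneg z.im])
    gcongr
    exact le_mul_of_one_le_right hC.le h1
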